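/- **Model.** There are $n$ ad networks, a finite set $U_I$ of impressions, a finite set $U_B=\{b_0<\dots<b_K\}$ of nonnegative bid values with maximum $L$, and $M$ slots with discount rates $1\ge\varrho_1\ge\dots\ge\varrho_M\ge 0$ (a bid $v$ is worth $v\varrho_\ell$ for slot $\ell$). Given impression $j$, network $i$ bids $v\in U_B$ with known probability $p_{ijv}$, independently of the other networks. Impressions arrive independently from an unknown distribution $q$ on $U_I$; there are $m$ arrivals, and network $i$ may be called out at most $\rho_i m$ times in every run, where $\rho_i\in[0,1]$. A GSP-Reserve policy chooses for each arrival, online, possibly at random and depending on everything observed before, the set $S$ of called networks and, before the bids are seen, a uniform reserve price (and whether all slots or only the first one are sold). The called networks whose bid reaches the reserve $r$ are ranked by bid; the $\ell$-th gets slot $\ell$ and pays $\varrho_\ell$ times the maximum of $r$ and the next bid. The performance of a policy is its expected revenue per arrival; $\mathrm{OPT}_G$ and $\mathrm{OPT}_B$ are the best expected revenue and the best expected total value per arrival of admissible policies. $\mathrm{LP1}$ is the maximum of $\sum_j q_j\sum_{i,v,\ell} v\varrho_\ell y_{ijv\ell}$ subject to $\sum_j q_jx_{ij}\le\rho_i$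 and, for each $j$, the constraints $A_j$: $\sum_{i,v}y_{ijv\ell}\le1$, $0\le x_{ij}\le 1$, $\sum_\ell y_{ijv\ell}\le p_{ijv}x_{ij}$, $y\ge0$. For a set $S$, $\mathrm{LP}(j,S)$ is the maximum of $\sum_{i,v,\ell}v\varrho_\ell y_{ijv\ell}$ subject to $A_j$ with $x_{ij}=1$ for $i\in S$ and $x_{ij}=0$ otherwise, and $\mathrm{LP}^1(j,S)$ is the same with $\varrho_2,\dots,\varrho_M$ replaced by $0$. Bid distributions have a monotone hazard rate (MHR): $\Pr[V=b_k]/(\Pr[V\ge b_k](b_{k+1}-b_k))$, $k<K$, is nondecreasing in $k$ as long as $\Pr[V\ge b_k]>0$ (for consecutive integers: $\Pr[V=v]/\Pr[V\ge v]$ is nondecreasing). **LP-Val** with $t$ samples and perturbation $\sigma>0$: let $\mathrm{LP2}_\sigma(j,\lambda)=\max_{A_j}\big(\sum_{i,v,\ell} v\varrho_\ell y_{ijv\ell}-\sum_i\lambda_ix_{ij}-\frac\sigma2\sum_ix_{ij}^2\big)$. From the first $t$ impressions $j_1,\dots,j_t$ (on which no call-outs are made) compute optimal Lagrange multipliers $\lambda^*$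 of the sampled program, i.e. a minimizer over $\lambda\ge0$ of $\sum_i\lambda_i\rho_i+\frac1t\sum_{s\le t}\mathrm{LP2}_\sigma(j_s,\lambda)$. On each later impression $j$ take the optimal $x$ of $\mathrm{LP2}_\sigma(j,\lambda^*)$, select each network $i$ independently with probability $x_{ij}$, and call out the selected networks whose budget $\rho_im$ is not exhausted. **LP-GSP** makes the same call-outs; if $S$ is called out on $j$, it runs plain GSP when $\mathrm{LP}(j,S)\ge 3\,\mathrm{LP}^1(j,S)$, and otherwise a single-slot auction (first slot only) with the reserve in $U_B$ that maximizes its expected revenue. **Theorem 2.** There are absolute constants $c,C>0$ and $\kappa\in\mathbb N$ such that the following holds whenever all bid distributions are MHR. (a) For every impression $j$ and every set $S$ of called networks, the auction that LP-GSP runs among them has expected revenue at least $c\cdot\mathrm{LP}(j,S)$. (b) Let $0<\varepsilon\le1$, $\delta>0$, $X=n^2L/(\delta\varepsilon)$, $t\ge C\,X\log^\kappa(2+X)$ (that is, $t=\tilde O(n^2L/(\delta\varepsilon))$ samples suffice), $m\ge 2t$, and suppose $\mathrm{OPT}_G\ge\delta$. Then LP-GSP with $t$ samples and $\sigma=\varepsilon\delta/n$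 is well defined, and for every choice of optimal multipliers it is admissible, its call-outs are those of LP-Val, and its expected revenue per arrival, over all $m$ arrivals including the sample, is at least $c\cdot\mathrm{OPT}_G$ and at least $c\cdot\mathrm{LP1}$, where $\mathrm{LP1}\ge\mathrm{OPT}_B$. -/

import Mathlib

open scoped ENNReal

noncomputable section

namespace CallOut

/-- What the exchange knows.  There are `n` ad networks, `M` slots and the finite set
`{bid 0 < ⋯ < bid K}` of nonnegative bid values; `J` is the set of impressions.  A bid `v` is worth
`v * disc ℓ` for slot `ℓ`; given impression `j`, network `i` bids `bid k` with probability
`p i j k`, independently of the other networks; network `i` may be called out on at most a fraction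
`rate i` of the arrivals.  The distribution of the impressions is not part of this data. -/
structure Exchange (n M K : ℕ) (J : Type) where
  bid : Fin (K + 1) → ℝ
  bid_strictMono : StrictMono bid
  bid_nonneg : ∀ k, 0 ≤ bid k
  disc : Fin M → ℝ
  disc_antitone : Antitone disc
  disc_nonneg : ∀ l, 0 ≤ disc l
  disc_le_one : ∀ l, disc l ≤ 1
  p : Fin n → J → PMF (Fin (K + 1))
  rate : Fin n → ℝ
  rate_nonneg : ∀ i, 0 ≤ rate i
  rate_le_one : ∀ i, rate i ≤ 1

/-- A decision for one impression: the set of networks that are called out, and the auction that is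
run among them, announced before the bids are seen: GSP for all slots (`single = false`) or for the
first slot only (`single = true`), with a uniform reserve price. -/
structure Action (n : ℕ) where
  called : Finset (Fin n)
  single : Bool
  reserve : ℝ

/-- Everything that happens at one arrival (including bids the exchange does not see). -/
structure Record (n K : ℕ) (J : Type) where
  imp : J
  act : Action n
  bids : Fin n → Fin (K + 1)

/-- What the exchange sees of one arrival: only the called networks respond with a bid. -/
structure Obs (n K : ℕ) (J : Type) where
  imp : J
  act : Action n
  response : Fin n → Option (Fin (K + 1))

def Record.observe {n K : ℕ} {J : Type} (e : Record n K J) : Obs n K J where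
  imp := e.imp
  act := e.act
  response := fun i => if i ∈ e.act.called then some (e.bids i) else none

/-- A randomized, adaptive, online policy: from the observed past (in chronological order) and the
arriving impression to the law of the decision. -/
abbrev Policy (n K : ℕ) (J : Type) := List (Obs n K J) → J → PMF (Action n)

/-- The call-out part of a policy. -/
abbrev CalloutPolicy (n K : ℕ) (J : Type) := List (Obs n K J) → J → PMF (Finset (Fin n))

/-- The law of independent draws, one from each `d i`. -/
def indep {n N : ℕ} (d : Fin n → PMF (Fin N)) : PMF (Fin n → Fin N) :=
  PMF.ofFintype (fun b => ∏ i, d i (b i)) (by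
    have h : ∀ i, ∑ k, d i k = 1 := fun i => by
      rw [← tsum_fintype (L := SummationFilter.unconditional _)]; exact (d i).tsum_coe
    rw [← Fintype.prod_sum (fun i k => d i k)]
    simp [h])

/-- The random subset that contains each `i` independently with probability `x i`
(the numbers `x i` will always lie in `[0, 1]`). -/
def randomSubset {n : ℕ} (x : Fin n → ℝ) : PMF (Finset (Fin n)) :=
  PMF.ofFintype (fun S => (∏ i ∈ S, min (ENNReal.ofReal (x i)) 1) *
      ∏ i ∈ Finset.univ \ S, (1 - min (ENNReal.ofReal (x i)) 1)) (by
    have h := Finset.prod_add (fun i : Fin n => min (ENNReal.ofReal (x i)) 1)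
      (fun i => 1 - min (ENNReal.ofReal (x i)) 1) Finset.univ
    rw [Finset.powerset_univ] at h
    rw [← h]
    exact Finset.prod_eq_one fun i _ => add_tsub_cancel_of_le (min_le_right _ _))

namespace Exchange

variable {n M K : ℕ} {J : Type} (A : Exchange n M K J)

/-- The largest bid value. -/
def maxBid : ℝ := A.bid (Fin.last K)

/-! ### Monotone hazard rate -/

/-- `Pr[V_ij ≥ bid k]`. -/
def survival (i : Fin n) (j : J) (k : Fin (K + 1)) : ℝ :=
  ∑ k' ∈ Finset.Ici k, (A.p i j k').toReal

/-- The hazard rate of `V_ij` at `bid k`: the conditional probability of `V_ij = bid k` given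
`V_ij ≥ bid k`, per unit of length up to the next bid value.  If the bid values are consecutive
integers, this is `Pr[V = v] / Pr[V ≥ v]`. -/
def hazard (i : Fin n) (j : J) (k : Fin K) : ℝ :=
  (A.p i j k.castSucc).toReal /
    (A.survival i j k.castSucc * (A.bid k.succ - A.bid k.castSucc))

/-- All bid distributions have a monotone hazard rate: the hazard rate is nondecreasing as long as
the survival probability is positive.  (At the largest bid value the conditional probability is `1`
and there is no condition.) -/
def MHR : Prop :=
  ∀ (i : Fin n) (j : J) (k k' : Fin K), k ≤ k' → 0 < A.survival i j k'.castSucc →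
    A.hazard i j k ≤ A.hazard i j k'

/-! ### The auctions -/

/-- The bids of the networks in `S` that reach the reserve `r`, in nonincreasing order. -/
def ranked (S : Finset (Fin n)) (b : Fin n → Fin (K + 1)) (r : ℝ) : List ℝ :=
  ((S.val.map fun i => A.bid (b i)).filter fun v => r ≤ v).sort (fun v w => v ≥ w)

/-- The discount rates of the slots on offer: all slots, or the first slot only. -/
def offered (single : Bool) (l : Fin M) : ℝ :=
  if single = true ∧ (l : ℕ) ≠ 0 then 0 else A.disc l

/-- Revenue of GSP with reserve: the network ranked `l`-th gets slot `l` and pays the discount rate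
times the maximum of the next bid and the reserve (there is no payment for an unfilled slot). -/
def revenue (a : Action n) (b : Fin n → Fin (K + 1)) : ℝ :=
  ∑ l : Fin M, if (l : ℕ) < (A.ranked a.called b a.reserve).length then
    A.offered a.single l * max ((A.ranked a.called b a.reserve).getD ((l : ℕ) + 1) 0) a.reserve
  else 0

/-- Total value (welfare) of a set of called networks: slots are allotted in decreasing order of the
bids. -/
def welfare (S : Finset (Fin n)) (b : Fin n → Fin (K + 1)) : ℝ :=
  ∑ l : Fin M, A.disc l * (A.ranked S b 0).getD (l : ℕ) 0

/-- The joint law of the bids for impression `j`. -/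
def bidLaw (j : J) : PMF (Fin n → Fin (K + 1)) := indep fun i => A.p i j

/-- Expected revenue of the decision `a` for impression `j`. -/
def expRevenue (j : J) (a : Action n) : ℝ :=
  ∑ b, (A.bidLaw j b).toReal * A.revenue a b

/-! ### Policies over `m` arrivals -/

/-- Number of times that network `i` was called out. -/
def calls (h : List (Obs n K J)) (i : Fin n) : ℕ :=
  h.countP fun e => i ∈ e.act.called

/-- The law of the first `s` arrivals, if impressions are drawn independently from `q` and the
exchange follows the policy `π`. -/
def runLaw (q : PMF J) (π : Policy n K J) : ℕ → PMF (List (Record n K J))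
  | 0 => PMF.pure []
  | s + 1 => (runLaw q π s).bind fun h => q.bind fun j =>
      (π (h.map Record.observe) j).bind fun a => (A.bidLaw j).bind fun b =>
        PMF.pure (h ++ [⟨j, a, b⟩])

/-- In every possible run with `m` arrivals, each network `i` is called out at most `rate i * m`
times. -/
def Admissible (q : PMF J) (m : ℕ) (π : Policy n K J) : Prop :=
  ∀ h ∈ (A.runLaw q π m).support, ∀ i, (calls (h.map Record.observe) i : ℝ) ≤ A.rate i * m

/-- Expected value of an additive objective per arriving impression. -/
def perf (q : PMF J) (m : ℕ) (obj : Record n K J → ℝ) (π : Policy n K J) : ℝ :=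
  (∑' h, (A.runLaw q π m h).toReal * (h.map obj).sum) / m

/-- Expected GSP-Reserve revenue per arriving impression. -/
def gspPerf (q : PMF J) (m : ℕ) (π : Policy n K J) : ℝ :=
  A.perf q m (fun e => A.revenue e.act e.bids) π

/-- Expected total value per arriving impression. -/
def valPerf (q : PMF J) (m : ℕ) (π : Policy n K J) : ℝ :=
  A.perf q m (fun e => A.welfare e.act.called e.bids) π

/-- The optimal GSP-Reserve revenue per arriving impression. -/
def optGSP (q : PMF J) (m : ℕ) : ℝ := sSup (A.gspPerf q m '' {π | A.Admissible q m π})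

/-- The optimal total value per arriving impression. -/
def optVal (q : PMF J) (m : ℕ) : ℝ := sSup (A.valPerf q m '' {π | A.Admissible q m π})

/-! ### The linear programs -/

/-- The constraints for impression `j`: `x i` is the probability of calling out `i`, and `y i k l`
is the probability that `i` bids `bid k` and is assigned slot `l`. -/
def Feasible (j : J) (x : Fin n → ℝ) (y : Fin n → Fin (K + 1) → Fin M → ℝ) : Prop :=
  (∀ l, ∑ i, ∑ k, y i k l ≤ 1) ∧
  (∀ i, 0 ≤ x i ∧ x i ≤ 1) ∧
  (∀ i k, ∑ l, y i k l ≤ (A.p i j k).toReal * x i) ∧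
  (∀ i k l, 0 ≤ y i k l)

/-- The value of an assignment when the slots have the discount rates `d`. -/
def slotValue (d : Fin M → ℝ) (y : Fin n → Fin (K + 1) → Fin M → ℝ) : ℝ :=
  ∑ i, ∑ k, ∑ l, A.bid k * d l * y i k l

/-- The LP bound on the optimal welfare (per arriving impression). -/
def lp1 [Fintype J] (q : PMF J) : ℝ :=
  sSup {v | ∃ (x : J → Fin n → ℝ) (y : J → Fin n → Fin (K + 1) → Fin M → ℝ),
    (∀ j, A.Feasible j (x j) (y j)) ∧
    (∀ i, ∑ j, (q j).toReal * x j i ≤ A.rate i) ∧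
    v = ∑ j, (q j).toReal * A.slotValue A.disc (y j)}

/-- The LP bound on the welfare from impression `j` when exactly the set `S` is called out and the
slots have the discount rates `d`. -/
def lpSet (d : Fin M → ℝ) (j : J) (S : Finset (Fin n)) : ℝ :=
  sSup {v | ∃ y, A.Feasible j (fun i => if i ∈ S then 1 else 0) y ∧ v = A.slotValue d y}

/-- The objective of the decoupled program for one impression, with multipliers `lam` for the
call-out constraints.  The term with `σ` is a small perturbation that makes the optimal `x` unique
for all multipliers. -/
def lp2Obj (σ : ℝ) (lam x : Fin n → ℝ) (y : Fin n → Fin (K + 1) → Fin M → ℝ) : ℝ :=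
  A.slotValue A.disc y - ∑ i, lam i * x i - σ / 2 * ∑ i, x i ^ 2

/-- Its optimal value for impression `j`. -/
def lp2 (σ : ℝ) (j : J) (lam : Fin n → ℝ) : ℝ :=
  sSup {v | ∃ x y, A.Feasible j x y ∧ v = A.lp2Obj σ lam x y}

/-- `x` is (the call-out part of) an optimal solution of the decoupled program. -/
def IsLP2Optimal (σ : ℝ) (j : J) (lam x : Fin n → ℝ) : Prop :=
  ∃ y, A.Feasible j x y ∧
    ∀ x' y', A.Feasible j x' y' → A.lp2Obj σ lam x' y' ≤ A.lp2Obj σ lam x y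

/-- The Lagrangian dual function of the sampled program, in which the impressions of the sample `s`
are equally likely. -/
def sampleDual (σ : ℝ) {t : ℕ} (s : Fin t → J) (lam : Fin n → ℝ) : ℝ :=
  ∑ i, lam i * A.rate i + (1 / (t : ℝ)) * ∑ r, A.lp2 σ (s r) lam

/-- `lam` are optimal Lagrange multipliers for the call-out constraints of the sampled program. -/
def IsOptimalMultiplier (σ : ℝ) {t : ℕ} (s : Fin t → J) (lam : Fin n → ℝ) : Prop :=
  (∀ i, 0 ≤ lam i) ∧ ∀ lam' : Fin n → ℝ, (∀ i, 0 ≤ lam' i) →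
    A.sampleDual σ s lam ≤ A.sampleDual σ s lam'

/-! ### LP-Val and LP-GSP -/

/-- What LP-Val computes: from the sample, optimal multipliers of the sampled program; from these
and an impression, an optimal solution of the decoupled program. -/
structure LPValRun (σ : ℝ) (t : ℕ) where
  lam : (Fin t → J) → Fin n → ℝ
  lam_opt : ∀ s, A.IsOptimalMultiplier σ s (lam s)
  x : (Fin t → J) → J → Fin n → ℝ
  x_opt : ∀ s j, A.IsLP2Optimal σ j (lam s) (x s j)

/-- The call-outs of LP-Val over `m` arrivals.  The first `t` impressions are only used as a sample.
On a later impression, each network is selected with the probability given by the decoupled program,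
and the selected networks that have not exhausted their call-outs are called out. -/
def lpVal {σ : ℝ} {t : ℕ} (R : A.LPValRun σ t) (m : ℕ) : CalloutPolicy n K J := fun h j =>
  if hl : t ≤ h.length then
    (randomSubset (R.x (fun r => (h.get (r.castLE hl)).imp) j)).map fun S =>
      S.filter fun i => (calls h i : ℝ) + 1 ≤ A.rate i * m
  else PMF.pure ∅

/-- The index of a reserve price, among the bid values, that is best for the single-slot auction
with the networks in `S` on impression `j`. -/
def bestReserve (j : J) (S : Finset (Fin n)) : Fin (K + 1) :=
  Classical.choose (Finite.exists_max fun k => A.expRevenue j ⟨S, true, A.bid k⟩)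

/-- The auction of LP-GSP among the called networks `S`: plain GSP if the LP bound on the welfare
is at least three times its contribution from the first slot alone, and otherwise the single-slot
auction with a best reserve price. -/
def gspAction (j : J) (S : Finset (Fin n)) : Action n :=
  if 3 * A.lpSet (A.offered true) j S ≤ A.lpSet A.disc j S then ⟨S, false, 0⟩
  else ⟨S, true, A.bid (A.bestReserve j S)⟩

/-- The LP-GSP policy. -/
def lpGSP {σ : ℝ} {t : ℕ} (R : A.LPValRun σ t) (m : ℕ) : Policy n K J := fun h j =>
  (A.lpVal R m h j).map (A.gspAction j)

end Exchange

end CallOut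

end

noncomputable section

namespace CallOut

/-! The argument compares everything with linear programs and loses a constant factor at each of a
few independent stages.

The auction. Given the bids, an LP solution becomes a fractional matching once each network's share
of a slot is divided by one plus the total share of the others. By independence this costs a factor
2 in expectation, and ranking by bid is the best matching (`half_slotValue_le_welfare`). Plain GSP
loses at most the value of the first slot against the welfare, so it earns LP/2 - LP¹, which is
enough when LP ≥ 3 LP¹. Otherwise LP¹ dominates. It is at most a threshold price plus the expected
excesses of the bids over it, and a monotone hazard rate bounds the excess of a bidder by price
times selling probability as soon as that probability is at most 1/2. With the threshold near the
point where the expected number of bidders above it is one, everything is at most a constant times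
the best reserve revenue (`MHR.lpSet_single_le`). Together: `MHR.gspAction_revenue_ge`, with factor
1/39.

The benchmark. Averaging the decisions of an admissible policy over a uniformly random arrival gives
a feasible solution of LP1, so LP1 bounds both optima (`perf_le_lp1`).

The multipliers. The quadratic perturbation makes the optimal x of the decoupled program a Lipschitz
function of the multipliers (`IsLP2Optimal.abs_sub_le`). Multipliers above the largest bid may be
cut off without changing x, so a fine grid on a bounded box represents all of them, and a Chernoff
bound with a union bound over the grid shows that sampled and true call-out rates agree up to a
factor 2 and a small additive error (`exists_good_samples`). Optimal sample multipliers satisfy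
complementary slackness on the sample. With weak duality for the true distribution this gives a
solution of value about LP1/2 whose true rates exceed the budgets by a constant factor only
(`lp1_le_slotValue`, `eighth_lp1_le`).

The run. Selecting networks independently costs another factor 2 (`half_netValue_le_lpSet`). During
the first m/16 arrivals after the sample, Markov's inequality keeps each non-negligible network
within its budget with probability at least 1/2 (`expect_onSample_available_ge`). The revenue of
these arrivals alone is a constant fraction of m LP1 (`gspPerf_lpGSP_ge`, `lpGSP_ge_lp1`). -/

/-- The expectation of a real function under a probability mass function. -/
def expect {α : Type*} (p : PMF α) (f : α → ℝ) : ℝ := ∑' a, (p a).toReal * f a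

/-- `f` is bounded on the support of `p`. -/
def BddOn {α : Type*} (p : PMF α) (f : α → ℝ) : Prop := ∃ B : ℝ, ∀ a ∈ p.support, |f a| ≤ B

/-! ### Expectations of bounded functions under discrete laws. -/

section Expect

variable {α β : Type*} {p : PMF α} {f g : α → ℝ}

theorem summable_toReal (p : PMF α) : Summable fun a => (p a).toReal :=
  ENNReal.summable_toReal p.tsum_coe_ne_top

theorem tsum_toReal (p : PMF α) : ∑' a, (p a).toReal = 1 := by
  rw [← ENNReal.tsum_toReal_eq p.apply_ne_top, p.tsum_coe, ENNReal.toReal_one]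

theorem toReal_of_notMem {a : α} (h : a ∉ p.support) : (p a).toReal = 0 := by
  rw [PMF.mem_support_iff, not_not] at h
  simp [h]

theorem BddOn.of_le {B : ℝ} (h : ∀ a, |f a| ≤ B) : BddOn p f := ⟨B, fun a _ => h a⟩

theorem BddOn.summable (h : BddOn p f) : Summable fun a => (p a).toReal * f a := by
  obtain ⟨B, hB⟩ := h
  refine Summable.of_norm_bounded (g := fun a => (p a).toReal * B)
    ((summable_toReal p).mul_right B) fun a => ?_
  rw [Real.norm_eq_abs, abs_mul, abs_of_nonneg ENNReal.toReal_nonneg]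
  by_cases ha : a ∈ p.support
  · exact mul_le_mul_of_nonneg_left (hB a ha) ENNReal.toReal_nonneg
  · simp [toReal_of_notMem ha]

theorem BddOn.const (c : ℝ) : BddOn p fun _ => c := ⟨|c|, fun _ _ => le_rfl⟩

theorem BddOn.add (hf : BddOn p f) (hg : BddOn p g) : BddOn p fun a => f a + g a := by
  obtain ⟨B, hB⟩ := hf
  obtain ⟨C, hC⟩ := hg
  exact ⟨B + C, fun a ha => (abs_add_le _ _).trans (add_le_add (hB a ha) (hC a ha))⟩

theorem BddOn.mul (hf : BddOn p f) (hg : BddOn p g) : BddOn p fun a => f a * g a := by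
  obtain ⟨B, hB⟩ := hf
  obtain ⟨C, hC⟩ := hg
  refine ⟨B * C, fun a ha => ?_⟩
  rw [abs_mul]
  exact mul_le_mul (hB a ha) (hC a ha) (abs_nonneg _) ((abs_nonneg _).trans (hB a ha))

theorem BddOn.sub (hf : BddOn p f) (hg : BddOn p g) : BddOn p fun a => f a - g a := by
  simpa [sub_eq_add_neg] using hf.add ((BddOn.const (-1)).mul hg)

theorem BddOn.sum {ι : Type*} {s : Finset ι} {F : ι → α → ℝ} (h : ∀ i ∈ s, BddOn p (F i)) :
    BddOn p fun a => ∑ i ∈ s, F i a := by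
  classical
  induction s using Finset.induction_on with
  | empty => simpa using BddOn.const 0
  | insert i s hi ih =>
    simp only [Finset.sum_insert hi]
    exact (h i (Finset.mem_insert_self _ _)).add
      (ih fun j hj => h j (Finset.mem_insert_of_mem hj))

theorem BddOn.of_finite [Finite α] (f : α → ℝ) : BddOn p f := by
  have := Fintype.ofFinite α
  refine ⟨∑ a, |f a|, fun a _ => ?_⟩
  exact Finset.single_le_sum (f := fun a => |f a|) (fun _ _ => abs_nonneg _) (Finset.mem_univ a)

theorem expect_congr (h : ∀ a ∈ p.support, f a = g a) : expect p f = expect p g := by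
  refine tsum_congr fun a => ?_
  by_cases ha : a ∈ p.support
  · rw [h a ha]
  · simp [toReal_of_notMem ha]

theorem expect_fintype [Fintype α] (p : PMF α) (f : α → ℝ) :
    expect p f = ∑ a, (p a).toReal * f a := tsum_fintype _

theorem expect_const (p : PMF α) (c : ℝ) : expect p (fun _ => c) = c := by
  rw [expect, tsum_mul_right, tsum_toReal, one_mul]

theorem expect_add (hf : BddOn p f) (hg : BddOn p g) :
    expect p (fun a => f a + g a) = expect p f + expect p g := by
  rw [expect, expect, expect, ← hf.summable.tsum_add hg.summable]
  simp only [mul_add]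

theorem expect_sub (hf : BddOn p f) (hg : BddOn p g) :
    expect p (fun a => f a - g a) = expect p f - expect p g := by
  rw [expect, expect, expect, ← hf.summable.tsum_sub hg.summable]
  simp only [mul_sub]

theorem expect_const_mul (c : ℝ) : expect p (fun a => c * f a) = c * expect p f := by
  rw [expect, expect, ← tsum_mul_left]
  exact tsum_congr fun a => by ring

theorem expect_sum {ι : Type*} {s : Finset ι} {F : ι → α → ℝ} (h : ∀ i ∈ s, BddOn p (F i)) :
    expect p (fun a => ∑ i ∈ s, F i a) = ∑ i ∈ s, expect p (F i) := by
  classical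
  induction s using Finset.induction_on with
  | empty => simpa using expect_const p 0
  | insert i s hi ih =>
    have hs := fun j hj => h j (Finset.mem_insert_of_mem hj)
    simp only [Finset.sum_insert hi]
    rw [expect_add (h i (Finset.mem_insert_self _ _)) (BddOn.sum hs), ih hs]

theorem expect_mono (hf : BddOn p f) (hg : BddOn p g) (h : ∀ a ∈ p.support, f a ≤ g a) :
    expect p f ≤ expect p g := by
  refine hf.summable.tsum_le_tsum (fun a => ?_) hg.summable
  by_cases ha : a ∈ p.support
  · exact mul_le_mul_of_nonneg_left (h a ha) ENNReal.toReal_nonneg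
  · simp [toReal_of_notMem ha]

theorem expect_nonneg (h : ∀ a ∈ p.support, 0 ≤ f a) : 0 ≤ expect p f := by
  refine tsum_nonneg fun a => ?_
  by_cases ha : a ∈ p.support
  · exact mul_nonneg ENNReal.toReal_nonneg (h a ha)
  · simp [toReal_of_notMem ha]

theorem abs_expect_le {B : ℝ} (h : ∀ a ∈ p.support, |f a| ≤ B) : |expect p f| ≤ B := by
  have hf : BddOn p f := ⟨B, h⟩
  rw [abs_le]
  constructor
  · rw [← expect_const p (-B)]
    exact expect_mono (BddOn.const _) hf fun a ha => (abs_le.1 (h a ha)).1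
  · conv_rhs => rw [← expect_const p B]
    exact expect_mono hf (BddOn.const _) fun a ha => (abs_le.1 (h a ha)).2

theorem expect_pure (a : α) (f : α → ℝ) : expect (PMF.pure a) f = f a := by
  rw [expect, tsum_eq_single a]
  · simp
  · intro b hb
    simp [PMF.pure_apply, hb]

theorem expect_eq_toReal (p : PMF α) (hf : ∀ a, 0 ≤ f a) :
    expect p f = (∑' a, p a * ENNReal.ofReal (f a)).toReal := by
  rw [ENNReal.tsum_toReal_eq fun a => ENNReal.mul_ne_top (p.apply_ne_top a) ENNReal.ofReal_ne_top]
  exact tsum_congr fun a => by rw [ENNReal.toReal_mul, ENNReal.toReal_ofReal (hf a)]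

theorem ofReal_expect (p : PMF α) (hb : BddOn p f) (hf : ∀ a, 0 ≤ f a) :
    ENNReal.ofReal (expect p f) = ∑' a, p a * ENNReal.ofReal (f a) := by
  rw [expect, ENNReal.ofReal_tsum_of_nonneg
    (fun a => mul_nonneg ENNReal.toReal_nonneg (hf a)) hb.summable]
  refine tsum_congr fun a => ?_
  rw [ENNReal.ofReal_mul ENNReal.toReal_nonneg, ENNReal.ofReal_toReal (p.apply_ne_top a)]

theorem mem_support_bind {p : PMF α} {k : α → PMF β} {a : α} {b : β} (ha : a ∈ p.support)
    (hb : b ∈ (k a).support) : b ∈ (p.bind k).support :=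
  (PMF.mem_support_bind_iff _ _ _).2 ⟨a, ha, hb⟩

theorem BddOn.bind_expect {k : α → PMF β} {f : β → ℝ} (hf : BddOn (p.bind k) f) :
    BddOn p fun a => expect (k a) f := by
  obtain ⟨B, hB⟩ := hf
  exact ⟨B, fun a ha => abs_expect_le fun b hb => hB b (mem_support_bind ha hb)⟩

theorem BddOn.of_bind {k : α → PMF β} {f : β → ℝ} (hf : BddOn (p.bind k) f) {a : α}
    (ha : a ∈ p.support) : BddOn (k a) f := by
  obtain ⟨B, hB⟩ := hf
  exact ⟨B, fun b hb => hB b (mem_support_bind ha hb)⟩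

theorem expect_bind_of_nonneg (p : PMF α) (k : α → PMF β) {f : β → ℝ} (hb : BddOn (p.bind k) f)
    (hf : ∀ b, 0 ≤ f b) : expect (p.bind k) f = expect p fun a => expect (k a) f := by
  rw [expect_eq_toReal _ hf, expect_eq_toReal _ fun a => expect_nonneg fun b _ => hf b]
  congr 1
  have h : ∀ a, p a * ENNReal.ofReal (expect (k a) f)
      = ∑' b, p a * (k a b * ENNReal.ofReal (f b)) := fun a => by
    by_cases ha : a ∈ p.support
    · rw [ofReal_expect _ (hb.of_bind ha) hf, ENNReal.tsum_mul_left]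
    · rw [PMF.mem_support_iff, not_not] at ha
      simp [ha]
  simp only [h, PMF.bind_apply]
  rw [ENNReal.tsum_comm]
  refine tsum_congr fun b => ?_
  rw [← ENNReal.tsum_mul_right]
  exact tsum_congr fun a => by rw [mul_assoc]

/-- Adding the bound makes the function nonnegative on the support, where Tonelli's theorem for
`ENNReal` sums applies; the constant is subtracted again at the end. -/
theorem expect_bind (p : PMF α) (k : α → PMF β) {f : β → ℝ} (hb : BddOn (p.bind k) f) :
    expect (p.bind k) f = expect p fun a => expect (k a) f := by
  classical
  obtain ⟨B, hB⟩ := id hb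
  set s := (p.bind k).support
  let f' : β → ℝ := fun b => if b ∈ s then f b + B else 0
  have h0 : ∀ b, 0 ≤ f' b := fun b => by
    by_cases hbs : b ∈ s
    · simp only [f', if_pos hbs]
      linarith [(abs_le.1 (hB b hbs)).1]
    · simp only [f', if_neg hbs, le_refl]
  have heq : ∀ b ∈ s, f' b = f b + B := fun b hbs => if_pos hbs
  have hb' : BddOn (p.bind k) f' :=
    ⟨B + |B|, fun b hbs => by
      rw [heq b hbs]
      exact (abs_add_le _ _).trans (add_le_add_left (hB b hbs) _)⟩
  have key := expect_bind_of_nonneg p k hb' h0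
  rw [expect_congr heq, expect_add hb (BddOn.const B), expect_const] at key
  have h2 : (expect p fun a => expect (k a) f') = expect p fun a => expect (k a) f + B := by
    refine expect_congr fun a ha => ?_
    rw [expect_congr fun b hbk => heq b (mem_support_bind ha hbk),
      expect_add (hb.of_bind ha) (BddOn.const B), expect_const]
  rw [h2, expect_add hb.bind_expect (BddOn.const B), expect_const] at key
  linarith

theorem expect_map (p : PMF α) (φ : α → β) {f : β → ℝ} (hb : BddOn p fun a => f (φ a)) :
    expect (p.map φ) f = expect p fun a => f (φ a) := by
  have : BddOn (p.bind (PMF.pure ∘ φ)) f := by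
    obtain ⟨B, hB⟩ := hb
    refine ⟨B, fun b hbs => ?_⟩
    obtain ⟨a, ha, hab⟩ := (PMF.mem_support_bind_iff _ _ _).1 hbs
    rw [Function.comp, PMF.mem_support_pure_iff] at hab
    exact hab ▸ hB a ha
  rw [PMF.map, expect_bind _ _ this]
  simp only [Function.comp, expect_pure]

end Expect

/-! ### Independent draws -/

theorem sum_toReal {α : Type*} [Fintype α] (p : PMF α) : ∑ a, (p a).toReal = 1 := by
  rw [← tsum_fintype (L := SummationFilter.unconditional _), tsum_toReal]

theorem indep_toReal {n N : ℕ} (d : Fin n → PMF (Fin N)) (b : Fin n → Fin N) :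
    (indep d b).toReal = ∏ i, (d i (b i)).toReal := by
  simp [indep, ENNReal.toReal_prod]

theorem sum_indep_prod {n N : ℕ} (d : Fin n → PMF (Fin N)) (g : Fin n → Fin N → ℝ) :
    ∑ b, (indep d b).toReal * ∏ i, g i (b i) = ∏ i, ∑ k, (d i k).toReal * g i k := by
  rw [Fintype.prod_sum]
  simp only [indep_toReal, ← Finset.prod_mul_distrib]

theorem sum_indep_one {n N : ℕ} (d : Fin n → PMF (Fin N)) (i : Fin n) (f : Fin N → ℝ) :
    ∑ b, (indep d b).toReal * f (b i) = ∑ k, (d i k).toReal * f k := by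
  have h := sum_indep_prod d fun i' k => if i' = i then f k else 1
  have h1 : ∀ b : Fin n → Fin N, ∏ i', (if i' = i then f (b i') else 1) = f (b i) := fun b => by
    simp
  simp only [h1] at h
  rw [h, Finset.prod_eq_single i]
  · simp
  · intro i' _ hne
    simp [hne, sum_toReal]
  · simp

theorem sum_indep_two {n N : ℕ} (d : Fin n → PMF (Fin N)) {i i' : Fin n} (hne : i ≠ i')
    (f g : Fin N → ℝ) :
    ∑ b, (indep d b).toReal * (f (b i) * g (b i'))
      = (∑ k, (d i k).toReal * f k) * ∑ k, (d i' k).toReal * g k := by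
  have h := sum_indep_prod d fun a k => (if a = i then f k else 1) * (if a = i' then g k else 1)
  have h1 : ∀ b : Fin n → Fin N, ∏ a, ((if a = i then f (b a) else 1) *
      (if a = i' then g (b a) else 1)) = f (b i) * g (b i') := fun b => by
    rw [Finset.prod_mul_distrib]
    simp
  simp only [h1] at h
  rw [h, ← Finset.prod_subset (Finset.subset_univ {i, i'}), Finset.prod_pair hne]
  · simp [hne, hne.symm]
  · intro a _ ha
    simp only [Finset.mem_insert, Finset.mem_singleton, not_or] at ha
    simp [ha.1, ha.2, sum_toReal]

theorem randomSubset_toReal {n : ℕ} {x : Fin n → ℝ} (hx : ∀ i, 0 ≤ x i ∧ x i ≤ 1)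
    (S : Finset (Fin n)) :
    (randomSubset x S).toReal = (∏ i ∈ S, x i) * ∏ i ∈ Finset.univ \ S, (1 - x i) := by
  have h1 : ∀ i, min (ENNReal.ofReal (x i)) 1 = ENNReal.ofReal (x i) := fun i =>
    min_eq_left (by simpa using (hx i).2)
  simp only [randomSubset, PMF.ofFintype_apply, h1, ENNReal.toReal_mul, ENNReal.toReal_prod]
  congr 1
  · exact Finset.prod_congr rfl fun i _ => ENNReal.toReal_ofReal (hx i).1
  · refine Finset.prod_congr rfl fun i _ => ?_
    rw [ENNReal.toReal_sub_of_le (by simpa using (hx i).2) ENNReal.one_ne_top,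
      ENNReal.toReal_ofReal (hx i).1, ENNReal.toReal_one]

/-- Expand the product of `x i + (1 - x i) * [i ∉ T]` over all subsets. Sets `T` of one or two
elements give the marginals and the pairwise independence used in the rounding. -/
theorem sum_randomSubset_superset {n : ℕ} {x : Fin n → ℝ} (hx : ∀ i, 0 ≤ x i ∧ x i ≤ 1)
    (T : Finset (Fin n)) :
    ∑ S, (randomSubset x S).toReal * (if T ⊆ S then 1 else 0) = ∏ i ∈ T, x i := by
  have h := Finset.prod_add x (fun i => (1 - x i) * if i ∈ T then 0 else 1) Finset.univ
  have hL : ∏ i, (x i + (1 - x i) * if i ∈ T then 0 else 1) = ∏ i ∈ T, x i := by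
    rw [← Finset.prod_subset (Finset.subset_univ T)]
    · exact Finset.prod_congr rfl fun i hi => by simp [hi]
    · intro i _ hi
      simp [hi]
  rw [hL, Finset.powerset_univ] at h
  rw [h]
  refine Finset.sum_congr rfl fun S _ => ?_
  rw [randomSubset_toReal hx, Finset.prod_mul_distrib, mul_assoc]
  congr 2
  by_cases hT : T ⊆ S
  · rw [if_pos hT, Finset.prod_eq_one]
    intro i hi
    rw [if_neg fun hiT => (Finset.mem_sdiff.1 hi).2 (hT hiT)]
  · obtain ⟨i, hiT, hiS⟩ := Finset.not_subset.1 hT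
    rw [if_neg hT, Finset.prod_eq_zero (i := i) (by simp [hiS]) (by simp [hiT])]

namespace Exchange

variable {n M K : ℕ} {J : Type} (A : Exchange n M K J)

theorem offered_nonneg (s : Bool) (l : Fin M) : 0 ≤ A.offered s l := by
  unfold offered
  split_ifs
  exacts [le_rfl, A.disc_nonneg l]

theorem offered_le (s : Bool) (l : Fin M) : A.offered s l ≤ A.disc l := by
  unfold offered
  split_ifs
  exacts [A.disc_nonneg l, le_rfl]

theorem bid_le_maxBid (k : Fin (K + 1)) : A.bid k ≤ A.maxBid :=
  A.bid_strictMono.monotone (Fin.le_last k)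

theorem maxBid_nonneg : 0 ≤ A.maxBid := A.bid_nonneg _

theorem bidLaw_nonneg (j : J) (b : Fin n → Fin (K + 1)) : 0 ≤ (A.bidLaw j b).toReal :=
  ENNReal.toReal_nonneg

/-! ### Rankings of networks -/

/-- `ranked` records only bid values. To read an auction outcome as an LP assignment one needs the
networks behind the values, with ties broken somehow. -/
theorem exists_ranking (S : Finset (Fin n)) (b : Fin n → Fin (K + 1)) (r : ℝ) :
    ∃ N : List (Fin n), N.Nodup ∧ (∀ i ∈ N, i ∈ S) ∧
      N.map (fun i => A.bid (b i)) = A.ranked S b r := by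
  classical
  let v : Fin n → ℝ := fun i => A.bid (b i)
  let T := S.filter fun i => r ≤ v i
  let N := T.toList.insertionSort fun i i' => v i ≥ v i'
  have hp : N.Perm T.toList := List.perm_insertionSort _ _
  refine ⟨N, hp.nodup_iff.2 T.nodup_toList, fun i hi => ?_, ?_⟩
  · exact (Finset.mem_filter.1 (Finset.mem_toList.1 (hp.mem_iff.1 hi))).1
  · have : Std.Total fun i i' : Fin n => v i ≥ v i' := ⟨fun i i' => le_total _ _⟩
    have : IsTrans (Fin n) fun i i' => v i ≥ v i' := ⟨fun _ _ _ h h' => le_trans h' h⟩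
    have hs : N.Pairwise fun i i' => v i ≥ v i' := List.pairwise_insertionSort _ _
    have hs' : (N.map v).Pairwise (· ≥ ·) := List.pairwise_map.2 hs
    have hm : ((N.map v : List ℝ) : Multiset ℝ)
        = (S.val.map fun i => A.bid (b i)).filter fun w => r ≤ w := by
      rw [Multiset.filter_map, ← Multiset.map_coe]
      congr 1
      rw [Multiset.coe_eq_coe.2 hp, Finset.coe_toList]
      rfl
    have hs2 : (A.ranked S b r).Pairwise (· ≥ ·) := Multiset.pairwise_sort _ _
    refine List.Perm.eq_of_pairwise' hs' hs2 (Multiset.coe_eq_coe.1 ?_)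
    rw [hm]
    exact (Multiset.sort_eq _ _).symm

/-- A ranking by bid of the networks in `S` whose bid reaches the reserve `r`. -/
def ranking (S : Finset (Fin n)) (b : Fin n → Fin (K + 1)) (r : ℝ) : List (Fin n) :=
  (A.exists_ranking S b r).choose

theorem ranking_nodup (S : Finset (Fin n)) (b : Fin n → Fin (K + 1)) (r : ℝ) :
    (A.ranking S b r).Nodup := (A.exists_ranking S b r).choose_spec.1

theorem mem_of_mem_ranking {S : Finset (Fin n)} {b : Fin n → Fin (K + 1)} {r : ℝ} {i : Fin n}
    (h : i ∈ A.ranking S b r) : i ∈ S := (A.exists_ranking S b r).choose_spec.2.1 i h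

theorem map_ranking (S : Finset (Fin n)) (b : Fin n → Fin (K + 1)) (r : ℝ) :
    (A.ranking S b r).map (fun i => A.bid (b i)) = A.ranked S b r :=
  (A.exists_ranking S b r).choose_spec.2.2

/-- The bid at position `l` of the ranking, or `0` if there is none. -/
def rankedBid (S : Finset (Fin n)) (b : Fin n → Fin (K + 1)) (r : ℝ) (l : ℕ) : ℝ :=
  (A.ranked S b r).getD l 0

theorem mem_ranked {S : Finset (Fin n)} {b : Fin n → Fin (K + 1)} {r v : ℝ}
    (h : v ∈ A.ranked S b r) : 0 ≤ v ∧ r ≤ v := by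
  unfold ranked at h
  rw [Multiset.mem_sort, Multiset.mem_filter, Multiset.mem_map] at h
  obtain ⟨⟨i, _, rfl⟩, hr⟩ := h
  exact ⟨A.bid_nonneg _, hr⟩

theorem rankedBid_nonneg (S : Finset (Fin n)) (b : Fin n → Fin (K + 1)) (r : ℝ) (l : ℕ) :
    0 ≤ A.rankedBid S b r l := by
  unfold rankedBid
  by_cases h : l < (A.ranked S b r).length
  · rw [List.getD_eq_getElem _ _ h]
    exact (A.mem_ranked (List.getElem_mem h)).1
  · rw [List.getD_eq_default _ _ (not_lt.1 h)]

theorem rankedBid_antitone (S : Finset (Fin n)) (b : Fin n → Fin (K + 1)) (r : ℝ) :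
    Antitone (A.rankedBid S b r) := by
  intro l l' hl
  have hs2 : (A.ranked S b r).Pairwise (· ≥ ·) := Multiset.pairwise_sort _ _
  by_cases h : l' < (A.ranked S b r).length
  · unfold rankedBid
    rw [List.getD_eq_getElem _ _ h, List.getD_eq_getElem _ _ (hl.trans_lt h)]
    rcases hl.eq_or_lt with rfl | hlt
    · exact le_rfl
    · exact List.pairwise_iff_getElem.1 hs2 l l' _ _ hlt
  · have : A.rankedBid S b r l' = 0 := List.getD_eq_default _ _ (not_lt.1 h)
    rw [this]
    exact A.rankedBid_nonneg S b r l

theorem revenue_nonneg (a : Action n) (b : Fin n → Fin (K + 1)) : 0 ≤ A.revenue a b := by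
  refine Finset.sum_nonneg fun l _ => ?_
  split_ifs
  · exact mul_nonneg (A.offered_nonneg _ _)
      (le_max_of_le_left (A.rankedBid_nonneg a.called b a.reserve _))
  · exact le_rfl

theorem revenue_le (a : Action n) (b : Fin n → Fin (K + 1)) :
    A.revenue a b ≤ ∑ l : Fin M, A.disc l * A.rankedBid a.called b a.reserve l := by
  refine Finset.sum_le_sum fun l _ => ?_
  split_ifs with h
  · refine mul_le_mul (A.offered_le _ _) (max_le ?_ ?_)
      (le_max_of_le_left (A.rankedBid_nonneg a.called b a.reserve _)) (A.disc_nonneg l)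
    · exact A.rankedBid_antitone a.called b a.reserve (Nat.le_succ _)
    · unfold rankedBid
      rw [List.getD_eq_getElem _ _ h]
      exact (A.mem_ranked (List.getElem_mem h)).2
  · exact mul_nonneg (A.disc_nonneg l) (A.rankedBid_nonneg _ _ _ _)

theorem welfare_eq (S : Finset (Fin n)) (b : Fin n → Fin (K + 1)) :
    A.welfare S b = ∑ l : Fin M, A.disc l * A.rankedBid S b 0 l := rfl

/-! ### The fractional assignment of an auction -/

/-- The probability that network `i` bids `bid k` and is ranked at position `l`. -/
def assignment (j : J) (S : Finset (Fin n)) (r : ℝ) (i : Fin n) (k : Fin (K + 1)) (l : Fin M) :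
    ℝ :=
  ∑ b, (A.bidLaw j b).toReal *
    ((if b i = k then 1 else 0) * if (A.ranking S b r)[(l : ℕ)]? = some i then 1 else 0)

theorem sum_bidLaw (j : J) : ∑ b, (A.bidLaw j b).toReal = 1 := sum_toReal _

/-- A position holds at most one network, and the ranking has no duplicates, so a network has at
most one position. -/
theorem assignment_feasible (j : J) (S : Finset (Fin n)) (r : ℝ) :
    A.Feasible j (fun i => if i ∈ S then 1 else 0) (A.assignment j S r) := by
  refine ⟨fun l => ?_, fun i => ?_, fun i k => ?_, fun i k l => ?_⟩
  · unfold assignment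
    have : ∀ i : Fin n, ∑ k, ∑ b, (A.bidLaw j b).toReal * ((if b i = k then (1 : ℝ) else 0) *
          if (A.ranking S b r)[(l : ℕ)]? = some i then 1 else 0)
        = ∑ b, (A.bidLaw j b).toReal *
          if (A.ranking S b r)[(l : ℕ)]? = some i then (1 : ℝ) else 0 := fun i => by
      rw [Finset.sum_comm]
      refine Finset.sum_congr rfl fun b _ => ?_
      rw [← Finset.mul_sum, ← Finset.sum_mul]
      simp
    simp only [this]
    rw [Finset.sum_comm]
    refine (Finset.sum_le_sum (g := fun b => (A.bidLaw j b).toReal) fun b _ => ?_).trans_eq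
      (A.sum_bidLaw j)
    rw [← Finset.mul_sum]
    refine mul_le_of_le_one_right (A.bidLaw_nonneg j b) ?_
    cases (A.ranking S b r)[(l : ℕ)]? with
    | none => simp
    | some i => simp
  · dsimp only
    split_ifs <;> norm_num
  · unfold assignment
    rw [Finset.sum_comm]
    have h1 := sum_indep_one (fun i => A.p i j) i
      (fun k' => (if k' = k then (1 : ℝ) else 0) * if i ∈ S then 1 else 0)
    have h2 : ∑ k', (A.p i j k').toReal *
        ((if k' = k then (1 : ℝ) else 0) * if i ∈ S then 1 else 0)
        = (A.p i j k).toReal * if i ∈ S then 1 else 0 := by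
      rw [Finset.sum_eq_single k]
      · simp
      · intro k' _ hk
        simp [hk]
      · simp
    rw [← h2, ← h1]
    refine Finset.sum_le_sum fun b _ => ?_
    rw [← Finset.mul_sum, ← Finset.mul_sum]
    refine mul_le_mul_of_nonneg_left ?_ ENNReal.toReal_nonneg
    refine mul_le_mul_of_nonneg_left ?_ (by split_ifs <;> norm_num)
    by_cases hi : i ∈ A.ranking S b r
    · rw [if_pos (A.mem_of_mem_ranking hi), Finset.sum_boole]
      norm_cast
      refine Finset.card_le_one.2 fun l hl l' hl' => ?_
      simp only [Finset.mem_filter, Finset.mem_univ, true_and] at hl hl'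
      have hlt := (List.getElem?_eq_some_iff.1 hl).1
      exact Fin.ext ((List.getElem?_inj hlt (A.ranking_nodup S b r)).1 (hl.trans hl'.symm))
    · rw [Finset.sum_eq_zero]
      · split_ifs <;> norm_num
      · intro l _
        rw [if_neg fun h => hi (List.mem_of_getElem? h)]
  · refine Finset.sum_nonneg fun b _ => mul_nonneg (A.bidLaw_nonneg j b) (mul_nonneg ?_ ?_) <;>
      split_ifs <;> norm_num

theorem slotValue_assignment (j : J) (S : Finset (Fin n)) (r : ℝ) (d : Fin M → ℝ) :
    A.slotValue d (A.assignment j S r)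
      = ∑ b, (A.bidLaw j b).toReal * ∑ l : Fin M, d l * A.rankedBid S b r l := by
  have h1 : ∀ b (l : Fin M), ∑ i, ∑ k, A.bid k * d l * ((if b i = k then (1 : ℝ) else 0) *
      if (A.ranking S b r)[(l : ℕ)]? = some i then 1 else 0) = d l * A.rankedBid S b r l := by
    intro b l
    have : ∀ i, ∑ k, A.bid k * d l * ((if b i = k then (1 : ℝ) else 0) *
      if (A.ranking S b r)[(l : ℕ)]? = some i then 1 else 0)
        = if (A.ranking S b r)[(l : ℕ)]? = some i then d l * A.bid (b i) else 0 := by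
      intro i
      rw [Finset.sum_eq_single (b i)]
      · simp [mul_comm]
      · intro k _ hk
        simp [hk.symm]
      · simp
    simp only [this]
    unfold rankedBid
    rw [← A.map_ranking S b r, List.getD_eq_getElem?_getD, List.getElem?_map]
    cases (A.ranking S b r)[(l : ℕ)]? with
    | none => simp
    | some i => simp
  simp only [← h1, slotValue, assignment, Finset.mul_sum]
  have e1 : ∀ (F : Fin n → Fin (K + 1) → Fin M → (Fin n → Fin (K + 1)) → ℝ),
      ∑ i, ∑ k, ∑ l, ∑ b, F i k l b = ∑ b, ∑ l, ∑ i, ∑ k, F i k l b := by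
    intro F
    have : ∀ i, ∑ k, ∑ l, ∑ b, F i k l b = ∑ b, ∑ l, ∑ k, F i k l b := fun i => by
      rw [Finset.sum_comm' (t' := Finset.univ) (s' := fun _ => Finset.univ) (by simp)]
      simp only [Finset.sum_comm (s := (Finset.univ : Finset (Fin (K + 1))))
        (t := (Finset.univ : Finset (Fin n → Fin (K + 1))))]
      rw [Finset.sum_comm]
    simp only [this]
    rw [Finset.sum_comm]
    exact Finset.sum_congr rfl fun b _ => Finset.sum_comm
  rw [e1]
  refine Finset.sum_congr rfl fun b _ => Finset.sum_congr rfl fun l _ =>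
    Finset.sum_congr rfl fun i _ => Finset.sum_congr rfl fun k _ => by ring

/-! ### Elementary bounds for the linear programs -/

theorem Feasible.sum_le {j : J} {x : Fin n → ℝ} {y : Fin n → Fin (K + 1) → Fin M → ℝ}
    (h : A.Feasible j x y) (i : Fin n) : ∑ k, ∑ l, y i k l ≤ x i := by
  calc ∑ k, ∑ l, y i k l ≤ ∑ k, (A.p i j k).toReal * x i :=
        Finset.sum_le_sum fun k _ => h.2.2.1 i k
    _ = x i := by rw [← Finset.sum_mul, sum_toReal, one_mul]

/-- The contribution of network `i` to the value of an assignment. -/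
def netValue (d : Fin M → ℝ) (y : Fin n → Fin (K + 1) → Fin M → ℝ) (i : Fin n) : ℝ :=
  ∑ k, ∑ l, A.bid k * d l * y i k l

theorem slotValue_eq_sum (d : Fin M → ℝ) (y : Fin n → Fin (K + 1) → Fin M → ℝ) :
    A.slotValue d y = ∑ i, A.netValue d y i := rfl

theorem Feasible.netValue_le {j : J} {x : Fin n → ℝ} {y : Fin n → Fin (K + 1) → Fin M → ℝ}
    (h : A.Feasible j x y) {d : Fin M → ℝ} (hd : ∀ l, d l ≤ 1) (i : Fin n) :
    A.netValue d y i ≤ A.maxBid * x i := by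
  refine le_trans ?_ (mul_le_mul_of_nonneg_left (Feasible.sum_le A h i) A.maxBid_nonneg)
  simp only [netValue, Finset.mul_sum]
  refine Finset.sum_le_sum fun k _ => Finset.sum_le_sum fun l _ => ?_
  refine mul_le_mul_of_nonneg_right ?_ (h.2.2.2 i k l)
  calc A.bid k * d l ≤ A.bid k := mul_le_of_le_one_right (A.bid_nonneg k) (hd l)
    _ ≤ A.maxBid := A.bid_le_maxBid k

theorem Feasible.netValue_nonneg {j : J} {x : Fin n → ℝ} {y : Fin n → Fin (K + 1) → Fin M → ℝ}
    (h : A.Feasible j x y) {d : Fin M → ℝ} (hd : ∀ l, 0 ≤ d l) (i : Fin n) :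
    0 ≤ A.netValue d y i :=
  Finset.sum_nonneg fun k _ => Finset.sum_nonneg fun l _ =>
    mul_nonneg (mul_nonneg (A.bid_nonneg k) (hd l)) (h.2.2.2 i k l)

theorem Feasible.slotValue_nonneg {j : J} {x : Fin n → ℝ} {y : Fin n → Fin (K + 1) → Fin M → ℝ}
    (h : A.Feasible j x y) {d : Fin M → ℝ} (hd : ∀ l, 0 ≤ d l) : 0 ≤ A.slotValue d y :=
  Finset.sum_nonneg fun i _ => Feasible.netValue_nonneg A h hd i

theorem Feasible.slotValue_le {j : J} {x : Fin n → ℝ} {y : Fin n → Fin (K + 1) → Fin M → ℝ}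
    (h : A.Feasible j x y) {d : Fin M → ℝ} (hd : ∀ l, d l ≤ 1) :
    A.slotValue d y ≤ n * A.maxBid := by
  calc A.slotValue d y ≤ ∑ _i : Fin n, A.maxBid := Finset.sum_le_sum fun i _ =>
        (Feasible.netValue_le A h hd i).trans
          (mul_le_of_le_one_right A.maxBid_nonneg (h.2.1 i).2)
    _ = n * A.maxBid := by simp

theorem feasible_zero (j : J) {x : Fin n → ℝ} (hx : ∀ i, 0 ≤ x i ∧ x i ≤ 1) :
    A.Feasible j x fun _ _ _ => 0 := by
  refine ⟨fun l => by simp, hx, fun i k => ?_, fun _ _ _ => le_rfl⟩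
  simpa using mul_nonneg ENNReal.toReal_nonneg (hx i).1

theorem le_lpSet {d : Fin M → ℝ} (hd : ∀ l, d l ≤ 1) {j : J} {S : Finset (Fin n)}
    {y : Fin n → Fin (K + 1) → Fin M → ℝ}
    (h : A.Feasible j (fun i => if i ∈ S then 1 else 0) y) :
    A.slotValue d y ≤ A.lpSet d j S := by
  refine le_csSup ⟨n * A.maxBid, ?_⟩ ⟨y, h, rfl⟩
  rintro v ⟨y', h', rfl⟩
  exact Feasible.slotValue_le A h' hd

theorem lpSet_le {d : Fin M → ℝ} {j : J} {S : Finset (Fin n)} {B : ℝ}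
    (h : ∀ y, A.Feasible j (fun i => if i ∈ S then 1 else 0) y → A.slotValue d y ≤ B) :
    A.lpSet d j S ≤ B := by
  refine csSup_le ⟨_, A.assignment j S 0, A.assignment_feasible j S 0, rfl⟩ ?_
  rintro v ⟨y, hy, rfl⟩
  exact h y hy

theorem lpSet_nonneg {d : Fin M → ℝ} (hd0 : ∀ l, 0 ≤ d l) (hd : ∀ l, d l ≤ 1) (j : J)
    (S : Finset (Fin n)) : 0 ≤ A.lpSet d j S :=
  (Feasible.slotValue_nonneg A (A.assignment_feasible j S 0) hd0).trans
    (A.le_lpSet hd (A.assignment_feasible j S 0))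

end Exchange

/-! ### Elementary inequalities for sums and products. -/

theorem sum_range_getD (F : ℝ → ℝ) (hF : F 0 = 0) (L : List ℝ) :
    ∀ N, L.length ≤ N → ∑ l ∈ Finset.range N, F (L.getD l 0) = (L.map F).sum := by
  induction L with
  | nil => intro N _; simp [hF]
  | cons a L ih =>
    intro N hN
    obtain ⟨N, rfl⟩ : ∃ N', N = N' + 1 := ⟨N - 1, by simp at hN; omega⟩
    rw [Finset.sum_range_succ']
    simp only [List.getD_cons_succ, List.getD_cons_zero, List.map_cons, List.sum_cons]
    rw [ih N (by simpa using hN), add_comm]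

/-- Abel summation: nonnegative partial sums stay nonnegative under decreasing weights. -/
theorem sum_antitone_mul_nonneg {d g : ℕ → ℝ} (hd : Antitone d) (hd0 : ∀ l, 0 ≤ d l) {M : ℕ}
    (hg : ∀ m ≤ M, 0 ≤ ∑ l ∈ Finset.range m, g l) : 0 ≤ ∑ l ∈ Finset.range M, d l * g l := by
  suffices h : ∀ m ≤ M, d m * ∑ l ∈ Finset.range m, g l ≤ ∑ l ∈ Finset.range m, d l * g l from
    (mul_nonneg (hd0 M) (hg M le_rfl)).trans (h M le_rfl)
  intro m
  induction m with
  | zero => intro _; simp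
  | succ m ih =>
    intro hm
    have h1 := ih (by omega)
    have h2 : d (m + 1) * ∑ l ∈ Finset.range (m + 1), g l
        ≤ d m * ∑ l ∈ Finset.range (m + 1), g l :=
      mul_le_mul_of_nonneg_right (hd (Nat.le_succ m)) (hg _ hm)
    rw [Finset.sum_range_succ] at h2 ⊢
    rw [Finset.sum_range_succ]
    linarith [mul_add (d m) (∑ l ∈ Finset.range m, g l) (g m)]

theorem fin_exists_last {K : ℕ} {P : Fin (K + 1) → Prop} (h0 : P 0) :
    P (Fin.last K) ∨ ∃ k : Fin K, P k.castSucc ∧ ¬ P k.succ := by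
  by_contra! h
  exact h.1 (Fin.induction (motive := P) h0 (fun k hk => h.2 k hk) (Fin.last K))

/-- The product is at most exp(-s) ≤ 1/(1+s), where s is the sum. -/
theorem one_sub_prod_ge {ι : Type*} (S : Finset ι) {s : ι → ℝ} (h0 : ∀ i ∈ S, 0 ≤ s i)
    (h1 : ∀ i ∈ S, s i ≤ 1) :
    (∑ i ∈ S, s i) / (1 + ∑ i ∈ S, s i) ≤ 1 - ∏ i ∈ S, (1 - s i) := by
  have hs : 0 ≤ ∑ i ∈ S, s i := Finset.sum_nonneg h0
  have hp : ∏ i ∈ S, (1 - s i) ≤ Real.exp (-∑ i ∈ S, s i) := by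
    rw [← Finset.sum_neg_distrib, Real.exp_sum]
    exact Finset.prod_le_prod (fun i hi => sub_nonneg.2 (h1 i hi))
      fun i _ => Real.one_sub_le_exp_neg _
  have he : Real.exp (-∑ i ∈ S, s i) ≤ 1 / (1 + ∑ i ∈ S, s i) := by
    rw [Real.exp_neg, ← one_div]
    exact one_div_le_one_div_of_le (by linarith) (by linarith [Real.add_one_le_exp (∑ i ∈ S, s i)])
  have : (∑ i ∈ S, s i) / (1 + ∑ i ∈ S, s i) = 1 - 1 / (1 + ∑ i ∈ S, s i) := by
    field_simp
    ring
  linarith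

namespace Exchange

variable {n M K : ℕ} {J : Type} (A : Exchange n M K J)

/-! ### Welfare is at least half of the linear program -/

theorem sum_rankedBid (S : Finset (Fin n)) (b : Fin n → Fin (K + 1)) (F : ℝ → ℝ) (hF : F 0 = 0)
    {N : ℕ} (hN : (A.ranked S b 0).length ≤ N) :
    ∑ l ∈ Finset.range N, F (A.rankedBid S b 0 l) = ∑ i ∈ S, F (A.bid (b i)) := by
  unfold rankedBid
  rw [sum_range_getD F hF _ N hN, ← Multiset.sum_coe, ← Multiset.map_coe]
  unfold ranked
  rw [Multiset.sort_eq, Multiset.filter_eq_self.2, Multiset.map_map]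
  · rfl
  · intro v hv
    obtain ⟨i, _, rfl⟩ := Multiset.mem_map.1 hv
    exact A.bid_nonneg _

/-- LP duality for "choose m items", with the bid at position `m` (counted from 0) as threshold τ: a
bid is at most its positive excess over τ plus τ, and the excesses are carried by the top m bids. -/
theorem sum_mul_le_top (S : Finset (Fin n)) (b : Fin n → Fin (K + 1)) {w : Fin n → ℝ}
    (h0 : ∀ i, 0 ≤ w i) (h1 : ∀ i, w i ≤ 1) (hS : ∀ i, i ∉ S → w i = 0) {m : ℕ}
    (hm : ∑ i, w i ≤ m) :
    ∑ i, A.bid (b i) * w i ≤ ∑ l ∈ Finset.range m, A.rankedBid S b 0 l := by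
  set τ := A.rankedBid S b 0 m with hτ
  have hτ0 : 0 ≤ τ := A.rankedBid_nonneg S b 0 m
  let N := max (A.ranked S b 0).length m
  have hsum := A.sum_rankedBid S b (fun v => max (v - τ) 0) (by simpa using hτ0)
    (le_max_left _ m : _ ≤ N)
  have hsplit : ∑ l ∈ Finset.range N, max (A.rankedBid S b 0 l - τ) 0
      = ∑ l ∈ Finset.range m, (A.rankedBid S b 0 l - τ) := by
    have hsub : Finset.range m ⊆ Finset.range N :=
      Finset.range_subset_range.2 (le_max_right _ _)
    rw [← Finset.sum_subset hsub]
    · refine Finset.sum_congr rfl fun l hl => max_eq_left (sub_nonneg.2 ?_)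
      exact A.rankedBid_antitone S b 0 (Finset.mem_range.1 hl).le
    · intro l _ hl
      refine max_eq_right (sub_nonpos.2 (A.rankedBid_antitone S b 0 ?_))
      exact not_lt.1 fun h => hl (Finset.mem_range.2 h)
  rw [hsplit, Finset.sum_sub_distrib, Finset.sum_const, Finset.card_range, nsmul_eq_mul] at hsum
  have h2 : ∑ i, A.bid (b i) * w i ≤ ∑ i ∈ S, max (A.bid (b i) - τ) 0 + τ * ∑ i, w i := by
    rw [Finset.mul_sum, ← Finset.sum_subset (Finset.subset_univ S) (f := fun i => τ * w i)
      (fun i _ hi => by rw [hS i hi, mul_zero]),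
      ← Finset.sum_subset (Finset.subset_univ S) (f := fun i => A.bid (b i) * w i)
      (fun i _ hi => by rw [hS i hi, mul_zero]), ← Finset.sum_add_distrib]
    refine Finset.sum_le_sum fun i _ => ?_
    have h3 : (A.bid (b i) - τ) * w i ≤ max (A.bid (b i) - τ) 0 :=
      (mul_le_mul_of_nonneg_right (le_max_left _ _) (h0 i)).trans
        (mul_le_of_le_one_right (le_max_right _ _) (h1 i))
    linarith
  have h3 : τ * ∑ i, w i ≤ τ * m := mul_le_mul_of_nonneg_left hm hτ0
  linarith

/-- The first m slots of a fractional matching carry at most the top m bids. Abel summation turns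
this into the comparison under decreasing discounts. -/
theorem matching_le_welfare (S : Finset (Fin n)) (b : Fin n → Fin (K + 1)) {z : Fin n → Fin M → ℝ}
    (h0 : ∀ i l, 0 ≤ z i l) (hl : ∀ l, ∑ i, z i l ≤ 1) (hi : ∀ i, ∑ l, z i l ≤ 1)
    (hS : ∀ i, i ∉ S → ∀ l, z i l = 0) :
    ∑ i, ∑ l, A.bid (b i) * A.disc l * z i l ≤ A.welfare S b := by
  let z' : Fin n → ℕ → ℝ := fun i l => if h : l < M then z i ⟨l, h⟩ else 0
  let d : ℕ → ℝ := fun l => if h : l < M then A.disc ⟨l, h⟩ else 0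
  have hz0 : ∀ i l, 0 ≤ z' i l := fun i l => by
    dsimp only [z']; split_ifs; exacts [h0 _ _, le_rfl]
  have hd0 : ∀ l, 0 ≤ d l := fun l => by
    dsimp only [d]; split_ifs; exacts [A.disc_nonneg _, le_rfl]
  have hd : Antitone d := by
    intro l l' hll
    by_cases h' : l' < M
    · have h : l < M := hll.trans_lt h'
      simp only [d, dif_pos h, dif_pos h']
      exact A.disc_antitone hll
    · simp only [d, dif_neg h']
      exact hd0 l
  have hzl : ∀ i (l : Fin M), z' i l = z i l := fun i l => by simp [z']
  have hdl : ∀ l : Fin M, d l = A.disc l := fun l => by simp [d]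
  have hcol : ∀ l < M, ∑ i, z' i l ≤ 1 := fun l h => by
    simpa only [z', dif_pos h] using hl ⟨l, h⟩
  have key := sum_antitone_mul_nonneg (M := M) hd hd0
    (g := fun l => A.rankedBid S b 0 l - ∑ i, A.bid (b i) * z' i l) fun m hm => by
      rw [Finset.sum_sub_distrib, sub_nonneg, Finset.sum_comm]
      simp only [← Finset.mul_sum]
      refine A.sum_mul_le_top S b (fun i => Finset.sum_nonneg fun l _ => hz0 i l) (fun i => ?_)
        (fun i hiS => ?_) ?_
      · calc ∑ l ∈ Finset.range m, z' i l ≤ ∑ l ∈ Finset.range M, z' i l :=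
              Finset.sum_le_sum_of_subset_of_nonneg (Finset.range_subset_range.2 hm)
                fun l _ _ => hz0 i l
          _ = ∑ l, z i l := by rw [Finset.sum_range]; simp only [hzl]
          _ ≤ 1 := hi i
      · refine Finset.sum_eq_zero fun l _ => ?_
        simp only [z']
        split_ifs
        exacts [hS i hiS _, rfl]
      · rw [Finset.sum_comm]
        calc ∑ l ∈ Finset.range m, ∑ i, z' i l ≤ ∑ _l ∈ Finset.range m, (1 : ℝ) :=
              Finset.sum_le_sum fun l hlm => hcol l ((Finset.mem_range.1 hlm).trans_le hm)
          _ = m := by simp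
  rw [Finset.sum_range] at key
  simp only [hzl, hdl, mul_sub, Finset.sum_sub_distrib, sub_nonneg] at key
  rw [A.welfare_eq]
  refine le_trans (le_of_eq ?_) key
  rw [Finset.sum_comm]
  refine Finset.sum_congr rfl fun l _ => ?_
  rw [Finset.mul_sum]
  exact Finset.sum_congr rfl fun i _ => by ring

/-- The tangent at Z = 1 to a convex function. It bounds the mean of the reciprocal by the mean of
Z, and gives 1/2 when that mean is at most 1. -/
theorem inv_one_add_ge {Z : ℝ} (hZ : 0 ≤ Z) : 3 / 4 - Z / 4 ≤ 1 / (1 + Z) := by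
  rw [le_div_iff₀ (by linarith)]
  nlinarith [sq_nonneg (1 - Z)]

/-- Items of size at most one that are scaled down by one plus the total size of the others. -/
theorem sum_div_one_add_le {ι : Type*} [DecidableEq ι] (s : Finset ι) {a : ι → ℝ}
    (h0 : ∀ i ∈ s, 0 ≤ a i) (h1 : ∀ i ∈ s, a i ≤ 1) :
    ∑ i ∈ s, a i * (1 / (1 + ∑ i' ∈ s.erase i, a i')) ≤ 1 := by
  rcases (Finset.sum_nonneg h0).eq_or_lt with hW | hW
  · have h := (Finset.sum_eq_zero_iff_of_nonneg h0).1 hW.symm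
    rw [Finset.sum_eq_zero fun i hi => by rw [h i hi, zero_mul]]
    exact zero_le_one
  · refine le_trans ?_ (div_self hW.ne').le
    rw [Finset.sum_div]
    refine Finset.sum_le_sum fun i hi => ?_
    rw [div_eq_mul_one_div (a i)]
    refine mul_le_mul_of_nonneg_left (one_div_le_one_div_of_le hW ?_) (h0 i hi)
    rw [← Finset.add_sum_erase s a hi]
    linarith [h1 i hi]

/-- Contention resolution: conditionally on the bids, each share of a slot is divided by one plus
the shares `Z` of the other networks. This is a fractional matching, and `Z` is independent of the
network's own bid with mean at most 1. -/
theorem half_slotValue_le_welfare {j : J} {S : Finset (Fin n)}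
    {y : Fin n → Fin (K + 1) → Fin M → ℝ}
    (h : A.Feasible j (fun i => if i ∈ S then 1 else 0) y) :
    A.slotValue A.disc y / 2 ≤ ∑ b, (A.bidLaw j b).toReal * A.welfare S b := by
  obtain ⟨hslot, -, hnet, hy0⟩ := h
  beta_reduce at hnet
  -- The conditional probability of slot `l` given the bid. Division by zero is harmless, since `y`
  -- vanishes where `p` does.
  let a : Fin n → Fin (K + 1) → Fin M → ℝ := fun i k l => y i k l / (A.p i j k).toReal
  have hp0 : ∀ i k, 0 ≤ (A.p i j k).toReal := fun i k => ENNReal.toReal_nonneg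
  have hle : ∀ i k, ∑ l, y i k l ≤ (A.p i j k).toReal := fun i k =>
    (hnet i k).trans (mul_le_of_le_one_right (hp0 i k) (by split_ifs <;> norm_num))
  have hyle : ∀ i k l, y i k l ≤ (A.p i j k).toReal := fun i k l =>
    (Finset.single_le_sum (f := fun l => y i k l) (fun l _ => hy0 i k l)
      (Finset.mem_univ l)).trans (hle i k)
  have hpa : ∀ i k l, (A.p i j k).toReal * a i k l = y i k l := fun i k l => by
    rcases (hp0 i k).eq_or_lt with h | h
    · rw [← h, zero_mul]
      exact (le_antisymm (h ▸ hyle i k l) (hy0 i k l)).symm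
    · exact mul_div_cancel₀ _ h.ne'
  have ha0 : ∀ i k l, 0 ≤ a i k l := fun i k l => div_nonneg (hy0 i k l) (hp0 i k)
  have harow : ∀ i k, ∑ l, a i k l ≤ 1 := fun i k => by
    rw [← Finset.sum_div]
    exact div_le_one_of_le₀ (hle i k) (hp0 i k)
  have ha1 : ∀ i k l, a i k l ≤ 1 := fun i k l =>
    (Finset.single_le_sum (f := fun l => a i k l) (fun l _ => ha0 i k l)
      (Finset.mem_univ l)).trans (harow i k)
  have haS : ∀ i, i ∉ S → ∀ k l, a i k l = 0 := fun i hi k l => by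
    have h1 := hnet i k
    rw [if_neg hi, mul_zero] at h1
    have h2 : y i k l ≤ 0 := (Finset.single_le_sum (f := fun l => y i k l)
      (fun l _ => hy0 i k l) (Finset.mem_univ l)).trans h1
    simp only [a, le_antisymm h2 (hy0 i k l), zero_div]
  let Z : (Fin n → Fin (K + 1)) → Fin n → Fin M → ℝ := fun b i l =>
    ∑ i' ∈ Finset.univ.erase i, a i' (b i') l
  have hZ0 : ∀ b i l, 0 ≤ Z b i l := fun b i l => Finset.sum_nonneg fun i' _ => ha0 _ _ _
  have hwel : ∀ b, ∑ i, ∑ l, A.bid (b i) * A.disc l * (a i (b i) l * (1 / (1 + Z b i l)))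
      ≤ A.welfare S b := fun b => by
    refine A.matching_le_welfare S b (fun i l => ?_) (fun l => ?_) (fun i => ?_) fun i hi l => ?_
    · exact mul_nonneg (ha0 _ _ _) (one_div_nonneg.2 (by linarith [hZ0 b i l]))
    · exact sum_div_one_add_le Finset.univ (a := fun i => a i (b i) l) (fun i _ => ha0 _ _ _)
        fun i _ => ha1 _ _ _
    · refine le_trans (Finset.sum_le_sum fun l _ => ?_) (harow i (b i))
      refine mul_le_of_le_one_right (ha0 _ _ _) ?_
      rw [div_le_one (by linarith [hZ0 b i l])]
      linarith [hZ0 b i l]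
    · rw [haS i hi, zero_mul]
  have hval : ∀ i l, (∑ k, A.bid k * y i k l) / 2 ≤ ∑ b, (A.bidLaw j b).toReal *
      (A.bid (b i) * a i (b i) l * (1 / (1 + Z b i l))) := fun i l => by
    have e1 : ∑ b, (A.bidLaw j b).toReal * (A.bid (b i) * a i (b i) l) = ∑ k, A.bid k * y i k l := by
      refine (sum_indep_one (fun i => A.p i j) i fun k => A.bid k * a i k l).trans ?_
      exact Finset.sum_congr rfl fun k _ => by rw [← hpa i k l]; ring
    have e2 : ∀ i', i' ≠ i → ∑ b, (A.bidLaw j b).toReal *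
        (A.bid (b i) * a i (b i) l * a i' (b i') l)
          = (∑ k, A.bid k * y i k l) * ∑ k, y i' k l := fun i' hne => by
      refine (sum_indep_two (fun i => A.p i j) hne.symm (fun k => A.bid k * a i k l)
        fun k => a i' k l).trans ?_
      congr 1
      · exact Finset.sum_congr rfl fun k _ => by rw [← hpa i k l]; ring
      · exact Finset.sum_congr rfl fun k _ => hpa i' k l
    -- Independence factors the mean, and the slot constraint bounds the mean of `Z` by 1.
    have e3 : ∑ b, (A.bidLaw j b).toReal * (A.bid (b i) * a i (b i) l * Z b i l)
        ≤ ∑ k, A.bid k * y i k l := by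
      have : ∑ b, (A.bidLaw j b).toReal * (A.bid (b i) * a i (b i) l * Z b i l)
          = (∑ k, A.bid k * y i k l) * ∑ i' ∈ Finset.univ.erase i, ∑ k, y i' k l := by
        simp only [Z, Finset.mul_sum (s := Finset.univ.erase i)]
        rw [Finset.sum_comm]
        exact Finset.sum_congr rfl fun i' hi' => e2 i' (Finset.ne_of_mem_erase hi')
      rw [this]
      refine mul_le_of_le_one_right
        (Finset.sum_nonneg fun k _ => mul_nonneg (A.bid_nonneg k) (hy0 i k l)) ?_
      exact (Finset.sum_le_sum_of_subset_of_nonneg (Finset.erase_subset _ _)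
        fun i' _ _ => Finset.sum_nonneg fun k _ => hy0 _ _ _).trans (hslot l)
    calc (∑ k, A.bid k * y i k l) / 2
        ≤ 3 / 4 * ∑ b, (A.bidLaw j b).toReal * (A.bid (b i) * a i (b i) l)
          - 1 / 4 * ∑ b, (A.bidLaw j b).toReal * (A.bid (b i) * a i (b i) l * Z b i l) := by
          rw [e1]; linarith
      _ = ∑ b, (A.bidLaw j b).toReal *
            (A.bid (b i) * a i (b i) l * (3 / 4 - Z b i l / 4)) := by
          rw [Finset.mul_sum, Finset.mul_sum, ← Finset.sum_sub_distrib]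
          exact Finset.sum_congr rfl fun b _ => by ring
      _ ≤ _ := Finset.sum_le_sum fun b _ => mul_le_mul_of_nonneg_left
          (mul_le_mul_of_nonneg_left (inv_one_add_ge (hZ0 b i l))
            (mul_nonneg (A.bid_nonneg _) (ha0 _ _ _))) (A.bidLaw_nonneg j b)
  calc A.slotValue A.disc y / 2
      = ∑ i, ∑ l, A.disc l * ((∑ k, A.bid k * y i k l) / 2) := by
        simp only [slotValue, Finset.sum_div, Finset.mul_sum]
        refine Finset.sum_congr rfl fun i _ => ?_
        rw [Finset.sum_comm]
        exact Finset.sum_congr rfl fun l _ => Finset.sum_congr rfl fun k _ => by ring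
    _ ≤ ∑ i, ∑ l, A.disc l * ∑ b, (A.bidLaw j b).toReal *
          (A.bid (b i) * a i (b i) l * (1 / (1 + Z b i l))) :=
        Finset.sum_le_sum fun i _ => Finset.sum_le_sum fun l _ =>
          mul_le_mul_of_nonneg_left (hval i l) (A.disc_nonneg l)
    _ = ∑ b, (A.bidLaw j b).toReal *
          ∑ i, ∑ l, A.bid (b i) * A.disc l * (a i (b i) l * (1 / (1 + Z b i l))) := by
        simp only [Finset.mul_sum]
        rw [Finset.sum_comm' (t' := Finset.univ) (s' := fun _ => Finset.univ) (by simp)]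
        rw [Finset.sum_comm]
        rw [Finset.sum_congr rfl fun i _ => Finset.sum_comm]
        rw [Finset.sum_comm]
        refine Finset.sum_congr rfl fun b _ => Finset.sum_congr rfl fun i _ =>
          Finset.sum_congr rfl fun l _ => by ring
    _ ≤ _ := Finset.sum_le_sum fun b _ =>
          mul_le_mul_of_nonneg_left (hwel b) (A.bidLaw_nonneg j b)

/-! ### Plain GSP -/

/-- The winner of slot l pays the bid ranked l+1 at the discount of slot l, which is at least what
that bid contributes to the welfare in slot l+1. Only the first slot's contribution is lost. -/
theorem welfare_sub_le_revenue (S : Finset (Fin n)) (b : Fin n → Fin (K + 1)) :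
    A.welfare S b - ∑ l : Fin M, A.offered true l * A.rankedBid S b 0 l
      ≤ A.revenue ⟨S, false, 0⟩ b := by
  have h1 : A.revenue ⟨S, false, 0⟩ b = ∑ l : Fin M, A.disc l * A.rankedBid S b 0 (l + 1) := by
    refine Finset.sum_congr rfl fun l _ => ?_
    have hd : A.offered false l = A.disc l := by simp [offered]
    change (if (l : ℕ) < (A.ranked S b 0).length then
      A.offered false l * max (A.rankedBid S b 0 (l + 1)) 0 else 0) = _
    rw [max_eq_left (A.rankedBid_nonneg S b 0 _), hd]
    split_ifs with h
    · rfl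
    · have : A.rankedBid S b 0 (l + 1) = 0 := List.getD_eq_default _ _ (by omega)
      rw [this, mul_zero]
  rw [h1, A.welfare_eq]
  cases M with
  | zero => simp
  | succ M =>
    have h2 : ∑ l : Fin (M + 1), A.offered true l * A.rankedBid S b 0 l
        = A.disc 0 * A.rankedBid S b 0 0 := by
      rw [Fin.sum_univ_succ]
      simp [offered]
    rw [h2, Fin.sum_univ_succ, Fin.sum_univ_castSucc]
    have h3 : ∑ l : Fin M, A.disc l.succ * A.rankedBid S b 0 (l.succ : Fin (M + 1))
        ≤ ∑ l : Fin M, A.disc l.castSucc * A.rankedBid S b 0 (l.castSucc + 1) := by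
      refine Finset.sum_le_sum fun l _ => ?_
      simp only [Fin.val_succ, Fin.val_castSucc]
      exact mul_le_mul_of_nonneg_right (A.disc_antitone (Fin.castSucc_lt_succ).le)
        (A.rankedBid_nonneg _ _ _ _)
    have h4 := mul_nonneg (A.disc_nonneg (Fin.last M))
      (A.rankedBid_nonneg S b 0 (Fin.last M + 1))
    simp only [Fin.val_zero] at h3 ⊢
    linarith

theorem gsp_revenue_ge (j : J) (S : Finset (Fin n)) :
    A.lpSet A.disc j S / 2 - A.lpSet (A.offered true) j S ≤ A.expRevenue j ⟨S, false, 0⟩ := by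
  have h1 : A.lpSet A.disc j S ≤ 2 * ∑ b, (A.bidLaw j b).toReal * A.welfare S b :=
    A.lpSet_le fun y hy => by linarith [A.half_slotValue_le_welfare hy]
  have h2 := A.le_lpSet (fun l => (A.offered_le true l).trans (A.disc_le_one l))
    (A.assignment_feasible j S 0)
  rw [A.slotValue_assignment] at h2
  have h3 : ∑ b, (A.bidLaw j b).toReal * A.welfare S b - ∑ b, (A.bidLaw j b).toReal *
      ∑ l : Fin M, A.offered true l * A.rankedBid S b 0 l ≤ A.expRevenue j ⟨S, false, 0⟩ := by
    rw [← Finset.sum_sub_distrib]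
    refine Finset.sum_le_sum fun b _ => ?_
    rw [← mul_sub]
    exact mul_le_mul_of_nonneg_left (A.welfare_sub_le_revenue S b) (A.bidLaw_nonneg j b)
  linarith

variable {n M K : ℕ} {J : Type} (A : Exchange n M K J)

/-! ### Monotone hazard rates -/

theorem survival_castSucc (i : Fin n) (j : J) (k : Fin K) :
    A.survival i j k.castSucc = (A.p i j k.castSucc).toReal + A.survival i j k.succ := by
  have h : Finset.Ici k.castSucc = insert k.castSucc (Finset.Ici k.succ) := by
    ext k'
    simp only [Finset.mem_Ici, Finset.mem_insert, Fin.le_def, Fin.ext_iff, Fin.val_castSucc,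
      Fin.val_succ]
    omega
  rw [survival, h, Finset.sum_insert (by simp [Fin.le_def]), survival]

theorem survival_nonneg (i : Fin n) (j : J) (k : Fin (K + 1)) : 0 ≤ A.survival i j k :=
  Finset.sum_nonneg fun _ _ => ENNReal.toReal_nonneg

theorem survival_le_one (i : Fin n) (j : J) (k : Fin (K + 1)) : A.survival i j k ≤ 1 := by
  rw [← sum_toReal (A.p i j)]
  exact Finset.sum_le_sum_of_subset_of_nonneg (Finset.subset_univ _)
    fun _ _ _ => ENNReal.toReal_nonneg

theorem survival_zero (i : Fin n) (j : J) : A.survival i j 0 = 1 := by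
  rw [← sum_toReal (A.p i j), survival]
  congr 1
  ext k
  simp

theorem gap_pos (k : Fin K) : 0 < A.bid k.succ - A.bid k.castSucc :=
  sub_pos.2 (A.bid_strictMono Fin.castSucc_lt_succ)

theorem hazard_nonneg (i : Fin n) (j : J) (k : Fin K) : 0 ≤ A.hazard i j k :=
  div_nonneg ENNReal.toReal_nonneg (mul_nonneg (A.survival_nonneg i j _) (A.gap_pos k).le)

/-- Also true at zero survival, where the hazard is a quotient by zero: both sides vanish. -/
theorem toReal_p_eq (i : Fin n) (j : J) (k : Fin K) : (A.p i j k.castSucc).toReal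
    = A.hazard i j k * (A.bid k.succ - A.bid k.castSucc) * A.survival i j k.castSucc := by
  have hg := A.gap_pos k
  rcases (A.survival_nonneg i j k.castSucc).eq_or_lt with h | h
  · rw [← h, mul_zero]
    refine le_antisymm ?_ ENNReal.toReal_nonneg
    rw [h, survival_castSucc]
    linarith [A.survival_nonneg i j k.succ]
  · rw [hazard]
    field_simp

/-- The expected amount by which the bid of network `i` exceeds `bid k`. -/
def excess (i : Fin n) (j : J) (k : Fin (K + 1)) : ℝ :=
  ∑ k', (A.p i j k').toReal * max (A.bid k' - A.bid k) 0

theorem excess_nonneg (i : Fin n) (j : J) (k : Fin (K + 1)) : 0 ≤ A.excess i j k :=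
  Finset.sum_nonneg fun _ _ => mul_nonneg ENNReal.toReal_nonneg (le_max_right _ _)

theorem excess_last (i : Fin n) (j : J) : A.excess i j (Fin.last K) = 0 := by
  refine Finset.sum_eq_zero fun k _ => ?_
  rw [max_eq_right (sub_nonpos.2 (A.bid_strictMono.monotone (Fin.le_last k))), mul_zero]

theorem excess_castSucc (i : Fin n) (j : J) (k : Fin K) :
    A.excess i j k.castSucc = A.excess i j k.succ
      + (A.bid k.succ - A.bid k.castSucc) * A.survival i j k.succ := by
  have h : (A.bid k.succ - A.bid k.castSucc) * A.survival i j k.succ = ∑ k',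
      (A.p i j k').toReal * if k.succ ≤ k' then A.bid k.succ - A.bid k.castSucc else 0 := by
    rw [survival, Finset.mul_sum, ← Finset.sum_subset (Finset.subset_univ (Finset.Ici k.succ))]
    · refine Finset.sum_congr rfl fun k' hk' => ?_
      rw [if_pos (Finset.mem_Ici.1 hk'), mul_comm]
    · intro k' _ hk'
      rw [if_neg fun h => hk' (Finset.mem_Ici.2 h), mul_zero]
  rw [h, excess, excess, ← Finset.sum_add_distrib]
  refine Finset.sum_congr rfl fun k' _ => ?_
  rw [← mul_add]
  congr 1
  have hg := A.gap_pos k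
  split_ifs with hk
  · have := A.bid_strictMono.monotone hk
    rw [max_eq_left (by linarith), max_eq_left (by linarith)]
    ring
  · have hk' : k' ≤ k.castSucc := by
      simp only [Fin.le_def, Fin.val_succ, Fin.val_castSucc] at hk ⊢
      omega
    have := A.bid_strictMono.monotone hk'
    rw [max_eq_right (by linarith), max_eq_right (by linarith), add_zero]

/-- Going down one bid value, the excess grows by gap times the upper survival, while the survival
grows by hazard times gap times the lower survival. Hazards of at least `r` therefore preserve the
inequality. -/
theorem excess_mul_le {i : Fin n} {j : J} {k₀ : Fin (K + 1)} {r : ℝ}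
    (hr : ∀ k : Fin K, k₀ ≤ k.castSucc → 0 < A.survival i j k.castSucc → r ≤ A.hazard i j k)
    (k : Fin (K + 1)) : k₀ ≤ k → A.excess i j k * r ≤ A.survival i j k := by
  induction k using Fin.reverseInduction with
  | last =>
    intro _
    rw [excess_last, zero_mul]
    exact A.survival_nonneg _ _ _
  | cast k ih =>
    intro hk
    have hs := A.survival_castSucc i j k
    have hp := A.toReal_p_eq i j k
    have hg := A.gap_pos k
    have ih' := ih (hk.trans (Fin.castSucc_lt_succ).le)
    have hs0 := A.survival_nonneg i j k.succ
    have hp0 : 0 ≤ (A.p i j k.castSucc).toReal := ENNReal.toReal_nonneg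
    rcases (A.survival_nonneg i j k.castSucc).eq_or_lt with h | h
    · have h1 : A.survival i j k.succ = 0 := by linarith
      rw [excess_castSucc, h1, mul_zero, add_zero]
      linarith
    · rw [excess_castSucc, add_mul, hs]
      have h2 : (A.bid k.succ - A.bid k.castSucc) * A.survival i j k.succ * r
          ≤ (A.p i j k.castSucc).toReal := by
        rw [hp]
        calc (A.bid k.succ - A.bid k.castSucc) * A.survival i j k.succ * r
            ≤ (A.bid k.succ - A.bid k.castSucc) * A.survival i j k.succ * A.hazard i j k :=
              mul_le_mul_of_nonneg_left (hr k hk h) (mul_nonneg hg.le hs0)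
          _ = A.hazard i j k * (A.bid k.succ - A.bid k.castSucc) * A.survival i j k.succ := by
              ring
          _ ≤ _ := mul_le_mul_of_nonneg_left (by linarith)
              (mul_nonneg (A.hazard_nonneg i j k) hg.le)
      linarith

/-- The mass lost at each bid value is at most hazard times gap; the gaps telescope. -/
theorem one_sub_survival_le {i : Fin n} {j : J} {k₀ : Fin (K + 1)} {r : ℝ}
    (hr : ∀ k : Fin K, k.succ ≤ k₀ → A.hazard i j k ≤ r)
    (k : Fin (K + 1)) : k ≤ k₀ → 1 - A.survival i j k ≤ r * (A.bid k - A.bid 0) := by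
  induction k using Fin.induction with
  | zero =>
    intro _
    rw [survival_zero, sub_self, sub_self, mul_zero]
  | succ k ih =>
    intro hk
    have hs := A.survival_castSucc i j k
    have hp := A.toReal_p_eq i j k
    have hg := A.gap_pos k
    have ih' := ih ((Fin.castSucc_lt_succ).le.trans hk)
    have h1 : (A.p i j k.castSucc).toReal ≤ r * (A.bid k.succ - A.bid k.castSucc) := by
      rw [hp]
      calc _ ≤ A.hazard i j k * (A.bid k.succ - A.bid k.castSucc) :=
            mul_le_of_le_one_right (mul_nonneg (A.hazard_nonneg i j k) hg.le)
              (A.survival_le_one i j _)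
        _ ≤ _ := mul_le_mul_of_nonneg_right (hr k hk) hg.le
    linarith

variable {A}

/-- Let r be the hazard at `k`. Hazards below are at most r, and losing half of the mass forces r
times the bid to be at least 1/2; hazards above are at least r, so r times the excess is at most the
survival. Zero survival and the last bid, where no hazard is available, have zero excess. -/
theorem MHR.excess_le (h : A.MHR) {i : Fin n} {j : J} {k : Fin (K + 1)}
    (hk : A.survival i j k ≤ 1 / 2) : A.excess i j k ≤ 2 * (A.bid k * A.survival i j k) := by
  have hs0 := A.survival_nonneg i j k
  have hb0 := A.bid_nonneg k
  rcases hs0.eq_or_lt with hs | hs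
  · have : A.excess i j k = 0 := by
      refine Finset.sum_eq_zero fun k' _ => ?_
      rcases le_total k k' with hkk | hkk
      · have h1 : (A.p i j k').toReal ≤ A.survival i j k :=
          Finset.single_le_sum (f := fun k' => (A.p i j k').toReal)
            (fun _ _ => ENNReal.toReal_nonneg) (Finset.mem_Ici.2 hkk)
        rw [le_antisymm (hs ▸ h1) ENNReal.toReal_nonneg, zero_mul]
      · rw [max_eq_right (sub_nonpos.2 (A.bid_strictMono.monotone hkk)), mul_zero]
    rw [this]
    positivity
  · induction k using Fin.lastCases with
    | last =>
      rw [excess_last]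
      positivity
    | cast k =>
      set r := A.hazard i j k
      have hup := A.excess_mul_le (i := i) (j := j) (k₀ := k.castSucc) (r := r)
        (fun k' hk' hpos => h i j k k' (Fin.castSucc_le_castSucc_iff.1 hk') hpos) k.castSucc le_rfl
      have hdown := A.one_sub_survival_le (i := i) (j := j) (k₀ := k.castSucc) (r := r)
        (fun k' hk' => h i j k' k (Fin.castSucc_le_castSucc_iff.1
          ((Fin.castSucc_lt_succ).le.trans hk')) hs) k.castSucc le_rfl
      have hr0 : 0 ≤ r := A.hazard_nonneg i j k
      have h1 : 1 / 2 ≤ r * A.bid k.castSucc := by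
        have := mul_nonneg hr0 (A.bid_nonneg 0)
        linarith [mul_sub r (A.bid k.castSucc) (A.bid 0)]
      have he := A.excess_nonneg i j k.castSucc
      calc A.excess i j k.castSucc ≤ A.excess i j k.castSucc * (2 * (r * A.bid k.castSucc)) :=
            le_mul_of_one_le_right he (by linarith)
        _ = 2 * (A.bid k.castSucc * (A.excess i j k.castSucc * r)) := by ring
        _ ≤ _ := by gcongr

theorem MHR.excess_castSucc_le (h : A.MHR) {i : Fin n} {j : J} {k : Fin K}
    (hk : A.survival i j k.succ ≤ 1 / 2) :
    A.excess i j k.castSucc ≤ 3 * (A.bid k.succ * A.survival i j k.succ) := by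
  rw [excess_castSucc]
  have := h.excess_le hk
  have := mul_nonneg (A.bid_nonneg k.castSucc) (A.survival_nonneg i j k.succ)
  linarith [sub_mul (A.bid k.succ) (A.bid k.castSucc) (A.survival i j k.succ)]

theorem mean_le_add_excess (i : Fin n) (j : J) (k : Fin (K + 1)) :
    ∑ k', (A.p i j k').toReal * A.bid k' ≤ A.bid k + A.excess i j k := by
  have : A.bid k = ∑ k', (A.p i j k').toReal * A.bid k := by
    rw [← Finset.sum_mul, sum_toReal, one_mul]
  rw [this, excess, ← Finset.sum_add_distrib]
  refine Finset.sum_le_sum fun k' _ => ?_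
  rw [← mul_add]
  exact mul_le_mul_of_nonneg_left (by linarith [le_max_left (A.bid k' - A.bid k) 0])
    ENNReal.toReal_nonneg

theorem excess_le_mean (i : Fin n) (j : J) (k : Fin (K + 1)) :
    A.excess i j k ≤ ∑ k', (A.p i j k').toReal * A.bid k' :=
  Finset.sum_le_sum fun k' _ => mul_le_mul_of_nonneg_left
    (max_le (by linarith [A.bid_nonneg k]) (A.bid_nonneg k')) ENNReal.toReal_nonneg

/-- A single bidder with monotone hazard rate: the best posted price earns a constant fraction of
the mean. -/
theorem MHR.mean_le (h : A.MHR) {i : Fin n} {j : J} {R : ℝ}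
    (hR : ∀ k, A.bid k * A.survival i j k ≤ R) :
    ∑ k, (A.p i j k).toReal * A.bid k ≤ 5 * R := by
  have h2 : ∀ k, 1 / 2 < A.survival i j k → A.bid k ≤ 2 * R := fun k hk => by
    have := mul_le_mul_of_nonneg_left hk.le (A.bid_nonneg k)
    linarith [hR k]
  have hR0 : 0 ≤ R := (mul_nonneg (A.bid_nonneg 0) (A.survival_nonneg i j 0)).trans (hR 0)
  -- Split the mean at a bid where the survival passes 1/2: the bid itself is at most 2R and the
  -- excess over it at most 3R.
  rcases fin_exists_last (P := fun k => 1 / 2 < A.survival i j k)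
    (by rw [survival_zero]; norm_num) with hl | ⟨k, hk, hk'⟩
  · have := A.mean_le_add_excess i j (Fin.last K)
    rw [excess_last] at this
    linarith [h2 _ hl]
  · have h3 := A.mean_le_add_excess i j k.castSucc
    have h4 := h.excess_castSucc_le (not_lt.1 hk')
    linarith [h2 _ hk, hR k.succ]

variable (A)

/-! ### The single-slot auction -/

/-- The probability that some network in `S` bids at least `bid k`. -/
def reachProb (j : J) (S : Finset (Fin n)) (k : Fin (K + 1)) : ℝ :=
  1 - ∏ i ∈ S, (1 - A.survival i j k)

theorem survival_le_reachProb (j : J) {S : Finset (Fin n)} {i : Fin n} (hi : i ∈ S)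
    (k : Fin (K + 1)) : A.survival i j k ≤ A.reachProb j S k := by
  unfold reachProb
  rw [← Finset.mul_prod_erase S _ hi]
  have : ∏ i ∈ S.erase i, (1 - A.survival i j k) ≤ 1 :=
    Finset.prod_le_one (fun i _ => sub_nonneg.2 (A.survival_le_one i j k))
      fun i _ => by linarith [A.survival_nonneg i j k]
  have := mul_le_mul_of_nonneg_left this (sub_nonneg.2 (A.survival_le_one i j k))
  linarith

/-- Whenever some bid reaches the reserve, the winner pays at least the reserve; by independence the
probability that none does is a product. -/
theorem single_revenue_ge {M : ℕ} (A : Exchange n (M + 1) K J) (j : J) (S : Finset (Fin n))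
    (k : Fin (K + 1)) :
    A.disc 0 * (A.bid k * A.reachProb j S k) ≤ A.expRevenue j ⟨S, true, A.bid k⟩ := by
  have h1 : ∑ b, (A.bidLaw j b).toReal * ∏ i, (if i ∈ S then if b i < k then (1 : ℝ) else 0 else 1)
      = ∏ i ∈ S, (1 - A.survival i j k) := by
    rw [bidLaw, sum_indep_prod (fun i => A.p i j)
      (fun i k' => if i ∈ S then if k' < k then (1 : ℝ) else 0 else 1),
      ← Finset.prod_subset (Finset.subset_univ S)]
    · refine Finset.prod_congr rfl fun i hi => ?_
      have hs : A.survival i j k = ∑ k', (A.p i j k').toReal * if k' < k then 0 else 1 := by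
        rw [survival, ← Finset.sum_subset (Finset.subset_univ (Finset.Ici k))]
        · refine Finset.sum_congr rfl fun k' hk' => ?_
          rw [if_neg (not_lt.2 (Finset.mem_Ici.1 hk')), mul_one]
        · intro k' _ hk'
          rw [if_pos (not_le.1 fun h => hk' (Finset.mem_Ici.2 h)), mul_zero]
      rw [hs, eq_sub_iff_add_eq, ← Finset.sum_add_distrib]
      refine (Finset.sum_congr rfl fun k' _ => ?_).trans (sum_toReal (A.p i j))
      rw [if_pos hi]
      split_ifs <;> simp
    · intro i _ hi
      simp [hi, sum_toReal]
  have h2 : A.disc 0 * (A.bid k * A.reachProb j S k) = ∑ b, (A.bidLaw j b).toReal *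
      (A.disc 0 * A.bid k * (1 - ∏ i, (if i ∈ S then if b i < k then (1 : ℝ) else 0 else 1))) := by
    simp only [mul_sub, mul_one, Finset.sum_sub_distrib]
    rw [← Finset.sum_mul, sum_bidLaw, reachProb, ← h1, one_mul]
    have h3 : ∀ F : (Fin n → Fin (K + 1)) → ℝ, ∑ b, (A.bidLaw j b).toReal *
        (A.disc 0 * A.bid k * F b) = A.disc 0 * A.bid k * ∑ b, (A.bidLaw j b).toReal * F b := by
      intro F
      rw [Finset.mul_sum]
      exact Finset.sum_congr rfl fun b _ => by ring
    rw [h3]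
    ring
  rw [h2]
  refine Finset.sum_le_sum fun b _ => mul_le_mul_of_nonneg_left ?_ (A.bidLaw_nonneg j b)
  by_cases hb : ∃ i ∈ S, k ≤ b i
  · obtain ⟨i, hi, hk⟩ := hb
    rw [Finset.prod_eq_zero (Finset.mem_univ i) (by simp [hi, not_lt.2 hk]), sub_zero, mul_one]
    have hmem : A.bid (b i) ∈ A.ranked S b (A.bid k) := by
      unfold ranked
      rw [Multiset.mem_sort, Multiset.mem_filter]
      exact ⟨Multiset.mem_map_of_mem _ hi, A.bid_strictMono.monotone hk⟩
    have hlen : 0 < (A.ranked S b (A.bid k)).length := List.length_pos_of_mem hmem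
    have hterm : A.disc 0 * A.bid k ≤ (if ((0 : Fin (M + 1)) : ℕ) < (A.ranked S b (A.bid k)).length
        then A.offered true 0 * max ((A.ranked S b (A.bid k)).getD (((0 : Fin (M + 1)) : ℕ) + 1) 0)
          (A.bid k) else 0) := by
      rw [if_pos (by simpa using hlen)]
      have : A.offered true (0 : Fin (M + 1)) = A.disc 0 := by simp [offered]
      rw [this]
      exact mul_le_mul_of_nonneg_left (le_max_right _ _) (A.disc_nonneg 0)
    refine hterm.trans ?_
    refine Finset.single_le_sum (f := fun l : Fin (M + 1) =>
      if (l : ℕ) < (A.ranked S b (A.bid k)).length then A.offered true l *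
        max ((A.ranked S b (A.bid k)).getD ((l : ℕ) + 1) 0) (A.bid k) else 0)
      (fun l _ => ?_) (Finset.mem_univ 0)
    split_ifs
    · exact mul_nonneg (A.offered_nonneg _ _) (le_max_of_le_right (A.bid_nonneg k))
    · exact le_rfl
  · push Not at hb
    rw [Finset.prod_eq_one fun i _ => by
      by_cases hi : i ∈ S
      · rw [if_pos hi, if_pos (hb i hi)]
      · rw [if_neg hi], sub_self, mul_zero]
    exact A.revenue_nonneg _ _

/-- A dual bound with an arbitrary price: the slot constraint pays for the price, the bid
probabilities for the excess over it. -/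
theorem lpSet_single_le {M : ℕ} (A : Exchange n (M + 1) K J) (j : J) (S : Finset (Fin n))
    (k : Fin (K + 1)) :
    A.lpSet (A.offered true) j S ≤ A.disc 0 * (A.bid k + ∑ i ∈ S, A.excess i j k) := by
  refine A.lpSet_le fun y hy => ?_
  obtain ⟨hslot, -, hnet, hy0⟩ := hy
  beta_reduce at hnet
  have h1 : A.slotValue (A.offered true) y = A.disc 0 * ∑ i, ∑ k, A.bid k * y i k 0 := by
    simp only [slotValue, Finset.mul_sum]
    refine Finset.sum_congr rfl fun i _ => Finset.sum_congr rfl fun k _ => ?_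
    rw [Fin.sum_univ_succ]
    simp [offered]
    ring
  have hle : ∀ i k', y i k' 0 ≤ (A.p i j k').toReal * if i ∈ S then 1 else 0 := fun i k' =>
    (Finset.single_le_sum (f := fun l => y i k' l) (fun l _ => hy0 i k' l)
      (Finset.mem_univ 0)).trans (hnet i k')
  rw [h1]
  refine mul_le_mul_of_nonneg_left ?_ (A.disc_nonneg 0)
  calc ∑ i, ∑ k', A.bid k' * y i k' 0
      ≤ ∑ i, ∑ k', (A.bid k * y i k' 0 + (A.p i j k').toReal * max (A.bid k' - A.bid k) 0 *
          if i ∈ S then 1 else 0) := by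
        refine Finset.sum_le_sum fun i _ => Finset.sum_le_sum fun k' _ => ?_
        have h2 : (A.bid k' - A.bid k) * y i k' 0 ≤ max (A.bid k' - A.bid k) 0 *
            ((A.p i j k').toReal * if i ∈ S then 1 else 0) :=
          mul_le_mul (le_max_left _ _) (hle i k') (hy0 _ _ _) (le_max_right _ _)
        linarith
    _ = A.bid k * ∑ i, ∑ k', y i k' 0 + ∑ i ∈ S, A.excess i j k := by
        simp only [Finset.sum_add_distrib, ← Finset.sum_mul, ← Finset.mul_sum]
        congr 1
        simp [excess, Finset.sum_ite_mem]
    _ ≤ _ := by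
        have := mul_le_of_le_one_right (A.bid_nonneg k) (hslot 0)
        linarith

variable {A}

/-- The price is put where the expected number of bidders reaching it crosses 1. Just below, a sale
has probability at least 1/2, so the price is at most 2R; just above, the selling probability is
comparable with that expected number, so the excesses sum to O(R). -/
theorem MHR.lpSet_single_le (h : A.MHR) {j : J} {S : Finset (Fin n)} {R : ℝ}
    (hR : ∀ k, A.bid k * A.reachProb j S k ≤ R) {d : ℝ} (hd : 0 ≤ d)
    (hlp : ∀ k, A.lpSet (A.offered true) j S ≤ d * (A.bid k + ∑ i ∈ S, A.excess i j k)) :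
    A.lpSet (A.offered true) j S ≤ d * (13 * R) := by
  rcases S.eq_empty_or_nonempty with rfl | ⟨i₀, hi₀⟩
  · refine A.lpSet_le fun y hy => ?_
    have h0 : A.slotValue (A.offered true) y = 0 := by
      refine Finset.sum_eq_zero fun i _ => Finset.sum_eq_zero fun k _ =>
        Finset.sum_eq_zero fun l _ => ?_
      have h1 := hy.2.2.1 i k
      simp only [Finset.notMem_empty, if_false, mul_zero] at h1
      have h2 : y i k l ≤ 0 := (Finset.single_le_sum (f := fun l => y i k l)
        (fun l _ => hy.2.2.2 i k l) (Finset.mem_univ l)).trans h1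
      rw [le_antisymm h2 (hy.2.2.2 i k l), mul_zero]
    have hR0 : 0 ≤ R := by simpa [reachProb] using hR 0
    rw [h0]
    positivity
  have hreach : ∀ k, (∑ i ∈ S, A.survival i j k) / (1 + ∑ i ∈ S, A.survival i j k)
      ≤ A.reachProb j S k := fun k =>
    one_sub_prod_ge S (fun i _ => A.survival_nonneg i j k) fun i _ => A.survival_le_one i j k
  have hsingle : ∀ i ∈ S, ∀ k, A.bid k * A.survival i j k ≤ R := fun i hi k =>
    (mul_le_mul_of_nonneg_left (A.survival_le_reachProb j hi k) (A.bid_nonneg k)).trans (hR k)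
  have hR0 : 0 ≤ R := (mul_nonneg (A.bid_nonneg 0) (A.survival_nonneg i₀ j 0)).trans
    (hsingle i₀ hi₀ 0)
  have hbig : ∀ k, 1 ≤ ∑ i ∈ S, A.survival i j k → A.bid k ≤ 2 * R := fun k hk => by
    have h1 : 1 / 2 ≤ A.reachProb j S k := by
      refine le_trans ?_ (hreach k)
      rw [div_le_div_iff₀ (by norm_num) (by linarith)]
      linarith
    linarith [hR k, mul_le_mul_of_nonneg_left h1 (A.bid_nonneg k)]
  rcases fin_exists_last (P := fun k => 1 ≤ ∑ i ∈ S, A.survival i j k) (by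
    have := Finset.single_le_sum (f := fun i => A.survival i j 0)
      (fun i _ => A.survival_nonneg i j 0) hi₀
    rwa [survival_zero] at this) with hl | ⟨k, hk, hk'⟩
  · refine (hlp (Fin.last K)).trans (mul_le_mul_of_nonneg_left ?_ hd)
    simp only [excess_last, Finset.sum_const_zero]
    linarith [hbig _ hl]
  · refine (hlp k.castSucc).trans (mul_le_mul_of_nonneg_left ?_ hd)
    rw [not_le] at hk'
    set s := ∑ i ∈ S, A.survival i j k.succ with hs
    have hs0 : 0 ≤ s := Finset.sum_nonneg fun i _ => A.survival_nonneg i j _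
    have hbs : A.bid k.succ * s ≤ 2 * R := by
      have h1 : s / 2 ≤ A.reachProb j S k.succ := by
        refine le_trans ?_ (hreach k.succ)
        exact div_le_div_of_nonneg_left hs0 (by linarith) (by linarith)
      linarith [hR k.succ, mul_le_mul_of_nonneg_left h1 (A.bid_nonneg k.succ)]
    have hb0 := A.bid_nonneg k.succ
    have hex : ∑ i ∈ S, A.excess i j k.castSucc ≤ 3 * (A.bid k.succ * s) + 5 * R := by
      -- Since `s < 1`, at most one network has survival above 1/2. Its excess is bounded by its
      -- mean, hence by 5R; the others use the hazard bound.
      by_cases hall : ∀ i ∈ S, A.survival i j k.succ ≤ 1 / 2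
      · have : ∑ i ∈ S, A.excess i j k.castSucc ≤ 3 * (A.bid k.succ * s) := by
          rw [hs, Finset.mul_sum, Finset.mul_sum]
          exact Finset.sum_le_sum fun i hi => h.excess_castSucc_le (hall i hi)
        linarith
      · push Not at hall
        obtain ⟨i, hi, hlt⟩ := hall
        have hadd : s = A.survival i j k.succ + ∑ i' ∈ S.erase i, A.survival i' j k.succ :=
          (Finset.add_sum_erase S _ hi).symm
        have h1 : A.excess i j k.castSucc ≤ 5 * R :=
          (A.excess_le_mean i j _).trans (h.mean_le (hsingle i hi))
        have h2 : ∑ i' ∈ S.erase i, A.excess i' j k.castSucc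
            ≤ 3 * (A.bid k.succ * ∑ i' ∈ S.erase i, A.survival i' j k.succ) := by
          rw [Finset.mul_sum, Finset.mul_sum]
          refine Finset.sum_le_sum fun i' hi' => h.excess_castSucc_le ?_
          have := Finset.single_le_sum (f := fun i => A.survival i j k.succ)
            (fun i _ => A.survival_nonneg i j k.succ) hi'
          linarith
        rw [← Finset.add_sum_erase S _ hi]
        have h3 := mul_nonneg hb0 (A.survival_nonneg i j k.succ)
        rw [hadd, mul_add]
        linarith
    -- 13 = 2 + 3 * 2 + 5: the price, the excesses 3 * (2R), and the exceptional network.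
    linarith [hbig _ hk]

/-- Plain GSP earns 1/2 - 1/3 = 1/6 of the LP; otherwise the LP is below 3 LP¹ and LP¹ is at most 13
times the best reserve revenue. -/
theorem MHR.gspAction_revenue_ge (h : A.MHR) (j : J) (S : Finset (Fin n)) :
    1 / 39 * A.lpSet A.disc j S ≤ A.expRevenue j (A.gspAction j S) := by
  have hlp0 := A.lpSet_nonneg A.disc_nonneg A.disc_le_one j S
  unfold gspAction
  split_ifs with hc
  · linarith [A.gsp_revenue_ge j S]
  · rw [not_le] at hc
    have hbest : ∀ k, A.expRevenue j ⟨S, true, A.bid k⟩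
        ≤ A.expRevenue j ⟨S, true, A.bid (A.bestReserve j S)⟩ :=
      Classical.choose_spec (Finite.exists_max fun k => A.expRevenue j ⟨S, true, A.bid k⟩)
    cases M with
    | zero =>
      have h1 : A.lpSet A.disc j S ≤ 0 := A.lpSet_le fun y _ => by simp [slotValue]
      have h2 : 0 ≤ A.expRevenue j ⟨S, true, A.bid (A.bestReserve j S)⟩ :=
        Finset.sum_nonneg fun b _ => mul_nonneg (A.bidLaw_nonneg j b) (A.revenue_nonneg _ _)
      linarith
    | succ M =>
      obtain ⟨k₁, hk₁⟩ := Finite.exists_max fun k => A.bid k * A.reachProb j S k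
      have h1 := h.lpSet_single_le hk₁ (A.disc_nonneg 0) (A.lpSet_single_le j S)
      have h2 := (A.single_revenue_ge j S k₁).trans (hbest k₁)
      linarith

variable {n M K : ℕ} {J : Type} (A : Exchange n M K J)

/-! ### The decoupled program -/

theorem isClosed_feasible (j : J) :
    IsClosed {z : (Fin n → ℝ) × (Fin n → Fin (K + 1) → Fin M → ℝ) | A.Feasible j z.1 z.2} := by
  unfold Feasible
  simp only [Set.ofPred_and, Set.ofPred_forall]
  refine IsClosed.inter (isClosed_iInter fun l => isClosed_le (by fun_prop) (by fun_prop))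
    (IsClosed.inter (isClosed_iInter fun i => ?_) (IsClosed.inter
      (isClosed_iInter fun i => isClosed_iInter fun k => isClosed_le (by fun_prop) (by fun_prop))
      (isClosed_iInter fun i => isClosed_iInter fun k => isClosed_iInter fun l =>
        isClosed_le (by fun_prop) (by fun_prop))))
  exact IsClosed.inter (isClosed_le (by fun_prop) (by fun_prop))
    (isClosed_le (by fun_prop) (by fun_prop))

theorem toReal_le_one {α : Type*} (p : PMF α) (a : α) : (p a).toReal ≤ 1 :=
  ENNReal.toReal_mono ENNReal.one_ne_top (p.coe_le_one a)

theorem isCompact_feasible (j : J) :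
    IsCompact {z : (Fin n → ℝ) × (Fin n → Fin (K + 1) → Fin M → ℝ) | A.Feasible j z.1 z.2} := by
  refine IsCompact.of_isClosed_subset (isCompact_Icc (a := 0) (b := 1))
    (A.isClosed_feasible j) fun z hz => ?_
  obtain ⟨-, hx, hnet, hy⟩ := hz
  refine ⟨⟨fun i => (hx i).1, fun i k l => hy i k l⟩, ⟨fun i => (hx i).2, fun i k l => ?_⟩⟩
  calc z.2 i k l ≤ ∑ l, z.2 i k l :=
        Finset.single_le_sum (f := fun l => z.2 i k l) (fun l _ => hy i k l) (Finset.mem_univ l)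
    _ ≤ (A.p i j k).toReal * z.1 i := hnet i k
    _ ≤ 1 := mul_le_one₀ (toReal_le_one _ _) (hx i).1 (hx i).2

theorem exists_isLP2Optimal (σ : ℝ) (j : J) (lam : Fin n → ℝ) :
    ∃ x, A.IsLP2Optimal σ j lam x := by
  have hc : Continuous fun z : (Fin n → ℝ) × (Fin n → Fin (K + 1) → Fin M → ℝ) =>
      A.lp2Obj σ lam z.1 z.2 := by
    unfold lp2Obj slotValue
    fun_prop
  obtain ⟨z, hz, hmax⟩ := (A.isCompact_feasible j).exists_isMaxOn
    ⟨(fun _ => 0, fun _ _ _ => 0), A.feasible_zero j fun _ => ⟨le_rfl, zero_le_one⟩⟩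
    hc.continuousOn
  exact ⟨z.1, z.2, hz, fun x' y' h' => isMaxOn_iff.1 hmax (x', y') h'⟩

variable {A}

theorem isGreatest_lp2 {σ : ℝ} {j : J} {lam x : Fin n → ℝ}
    {y : Fin n → Fin (K + 1) → Fin M → ℝ} (hf : A.Feasible j x y)
    (hopt : ∀ x' y', A.Feasible j x' y' → A.lp2Obj σ lam x' y' ≤ A.lp2Obj σ lam x y) :
    A.lp2 σ j lam = A.lp2Obj σ lam x y := by
  refine IsGreatest.csSup_eq ⟨⟨x, y, hf, rfl⟩, ?_⟩
  rintro v ⟨x', y', h', rfl⟩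
  exact hopt x' y' h'

variable (A)

theorem le_lp2 (σ : ℝ) {j : J} (lam : Fin n → ℝ) {x : Fin n → ℝ}
    {y : Fin n → Fin (K + 1) → Fin M → ℝ} (hf : A.Feasible j x y) :
    A.lp2Obj σ lam x y ≤ A.lp2 σ j lam := by
  obtain ⟨x₀, y₀, h₀, hopt⟩ := A.exists_isLP2Optimal σ j lam
  rw [isGreatest_lp2 h₀ hopt]
  exact hopt x y hf

theorem lp2_nonneg (σ : ℝ) (j : J) (lam : Fin n → ℝ) : 0 ≤ A.lp2 σ j lam := by
  have h := A.le_lp2 σ lam (A.feasible_zero j (x := fun _ => 0) fun _ => ⟨le_rfl, zero_le_one⟩)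
  simpa [lp2Obj, slotValue] using h

theorem lp2Obj_sub (σ : ℝ) (lam lam' x : Fin n → ℝ) (y : Fin n → Fin (K + 1) → Fin M → ℝ) :
    A.lp2Obj σ lam' x y = A.lp2Obj σ lam x y - ∑ i, (lam' i - lam i) * x i := by
  simp only [lp2Obj, sub_mul, Finset.sum_sub_distrib]
  ring

variable {A}

/-- An optimal `x` is a (negated) subgradient of the optimal value in the multipliers. -/
theorem IsLP2Optimal.lp2_sub_le {σ : ℝ} {j : J} {lam x : Fin n → ℝ}
    (h : A.IsLP2Optimal σ j lam x) (lam' : Fin n → ℝ) :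
    A.lp2 σ j lam - ∑ i, (lam' i - lam i) * x i ≤ A.lp2 σ j lam' := by
  obtain ⟨y, hf, hopt⟩ := h
  rw [isGreatest_lp2 hf hopt, ← A.lp2Obj_sub]
  exact A.le_lp2 σ lam' hf

theorem IsLP2Optimal.mem {σ : ℝ} {j : J} {lam x : Fin n → ℝ}
    (h : A.IsLP2Optimal σ j lam x) (i : Fin n) : 0 ≤ x i ∧ x i ≤ 1 := by
  obtain ⟨y, hf, -⟩ := h
  exact hf.2.1 i

theorem Feasible.midpoint {j : J} {x x' : Fin n → ℝ} {y y' : Fin n → Fin (K + 1) → Fin M → ℝ}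
    (h : A.Feasible j x y) (h' : A.Feasible j x' y') :
    A.Feasible j (fun i => 1 / 2 * (x i + x' i)) fun i k l => 1 / 2 * (y i k l + y' i k l) := by
  refine ⟨fun l => ?_, fun i => ?_, fun i k => ?_, fun i k l => ?_⟩
  · simp only [← Finset.mul_sum, Finset.sum_add_distrib]
    linarith [h.1 l, h'.1 l]
  · constructor <;> linarith [h.2.1 i, h'.2.1 i]
  · simp only [← Finset.mul_sum, Finset.sum_add_distrib]
    linarith [h.2.2.1 i k, h'.2.2.1 i k]
  · linarith [h.2.2.2 i k l, h'.2.2.2 i k l]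

theorem lp2Obj_midpoint (σ : ℝ) (lam x x' : Fin n → ℝ)
    (y y' : Fin n → Fin (K + 1) → Fin M → ℝ) :
    A.lp2Obj σ lam (fun i => 1 / 2 * (x i + x' i)) (fun i k l => 1 / 2 * (y i k l + y' i k l))
      = 1 / 2 * (A.lp2Obj σ lam x y + A.lp2Obj σ lam x' y')
        + σ / 8 * ∑ i, (x i - x' i) ^ 2 := by
  have h1 : A.slotValue A.disc (fun i k l => 1 / 2 * (y i k l + y' i k l))
      = 1 / 2 * (A.slotValue A.disc y + A.slotValue A.disc y') := by
    simp only [slotValue, mul_add, Finset.mul_sum, ← Finset.sum_add_distrib]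
    refine Finset.sum_congr rfl fun i _ => Finset.sum_congr rfl fun k _ =>
      Finset.sum_congr rfl fun l _ => by ring
  have h2 : ∑ i, lam i * (1 / 2 * (x i + x' i))
      = 1 / 2 * (∑ i, lam i * x i + ∑ i, lam i * x' i) := by
    rw [← Finset.sum_add_distrib, Finset.mul_sum]
    exact Finset.sum_congr rfl fun i _ => by ring
  have h3 : ∑ i, (1 / 2 * (x i + x' i)) ^ 2
      = 1 / 2 * (∑ i, x i ^ 2 + ∑ i, x' i ^ 2) - 1 / 4 * ∑ i, (x i - x' i) ^ 2 := by
    rw [← Finset.sum_add_distrib, Finset.mul_sum, Finset.mul_sum, ← Finset.sum_sub_distrib]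
    exact Finset.sum_congr rfl fun i _ => by ring
  simp only [lp2Obj, h1, h2, h3]
  ring

/-- Strong concavity in x: the midpoint of two feasible solutions gains a quadratic term, yet cannot
beat the optimum. -/
theorem lp2Obj_add_le {σ : ℝ} {j : J} {lam x x' : Fin n → ℝ}
    {y y' : Fin n → Fin (K + 1) → Fin M → ℝ} (hf : A.Feasible j x y)
    (hopt : ∀ x' y', A.Feasible j x' y' → A.lp2Obj σ lam x' y' ≤ A.lp2Obj σ lam x y)
    (hf' : A.Feasible j x' y') :
    A.lp2Obj σ lam x' y' + σ / 4 * ∑ i, (x i - x' i) ^ 2 ≤ A.lp2Obj σ lam x y := by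
  have h := hopt _ _ (Feasible.midpoint hf hf')
  rw [lp2Obj_midpoint] at h
  linarith

/-- The optimal `x` depends on the multipliers in a Lipschitz way. -/
theorem IsLP2Optimal.abs_sub_le {σ h : ℝ} (hσ : 0 < σ) {j : J} {lam lam' x x' : Fin n → ℝ}
    (hx : A.IsLP2Optimal σ j lam x) (hx' : A.IsLP2Optimal σ j lam' x')
    (hlam : ∀ i, |lam i - lam' i| ≤ h) (i : Fin n) : |x i - x' i| ≤ 2 * n * h / σ := by
  obtain ⟨y, hf, hopt⟩ := hx
  obtain ⟨y', hf', hopt'⟩ := hx'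
  have h1 := lp2Obj_add_le hf hopt hf'
  have h2 := lp2Obj_add_le hf' hopt' hf
  rw [A.lp2Obj_sub σ lam lam', A.lp2Obj_sub σ lam lam'] at h2
  have hsymm : ∑ i, (x' i - x i) ^ 2 = ∑ i, (x i - x' i) ^ 2 :=
    Finset.sum_congr rfl fun i _ => by ring
  -- Strong concavity at both optima, added: the values cancel and only the change of multipliers
  -- remains.
  have h3 : σ / 2 * ∑ i, (x i - x' i) ^ 2 ≤ ∑ i, (lam' i - lam i) * (x i - x' i) := by
    have h4 : ∑ i, (lam' i - lam i) * (x i - x' i)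
        = ∑ i, (lam' i - lam i) * x i - ∑ i, (lam' i - lam i) * x' i := by
      rw [← Finset.sum_sub_distrib]
      exact Finset.sum_congr rfl fun i _ => mul_sub _ _ _
    rw [h4]
    rw [hsymm] at h2
    linarith
  have : Nonempty (Fin n) := ⟨i⟩
  obtain ⟨i₀, hi₀⟩ := Finite.exists_max fun i => |x i - x' i|
  refine (hi₀ i).trans ?_
  set D := |x i₀ - x' i₀|
  have h4 : ∑ i, (lam' i - lam i) * (x i - x' i) ≤ n * (h * D) := by
    calc ∑ i, (lam' i - lam i) * (x i - x' i) ≤ ∑ _i : Fin n, h * D := by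
          refine Finset.sum_le_sum fun i _ => (le_abs_self _).trans ?_
          rw [abs_mul, abs_sub_comm]
          exact mul_le_mul (hlam i) (hi₀ i) (abs_nonneg _) ((abs_nonneg _).trans (hlam i))
      _ = n * (h * D) := by simp
  have h5 : D ^ 2 ≤ ∑ i, (x i - x' i) ^ 2 := by
    rw [sq_abs]
    exact Finset.single_le_sum (f := fun i => (x i - x' i) ^ 2) (fun _ _ => sq_nonneg _)
      (Finset.mem_univ i₀)
  have hD : 0 ≤ D := abs_nonneg _
  have hh : 0 ≤ h := (abs_nonneg _).trans (hlam i)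
  rcases hD.eq_or_lt with hD0 | hD0
  · rw [← hD0]
    positivity
  · rw [le_div_iff₀ hσ]
    have h6 : σ / 2 * D ^ 2 ≤ n * (h * D) :=
      (mul_le_mul_of_nonneg_left h5 (by linarith)).trans (h3.trans h4)
    have h7 : D * (D * σ) ≤ D * (2 * n * h) := by linarith
    exact le_of_mul_le_mul_left h7 hD0

/-! ### Truncating the multipliers -/

theorem Feasible.zero_out {j : J} {x : Fin n → ℝ} {y : Fin n → Fin (K + 1) → Fin M → ℝ}
    (h : A.Feasible j x y) (T : Fin n → Prop) [DecidablePred T] :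
    A.Feasible j (fun i => if T i then 0 else x i) fun i k l => if T i then 0 else y i k l := by
  refine ⟨fun l => ?_, fun i => ?_, fun i k => ?_, fun i k l => ?_⟩
  · refine le_trans (Finset.sum_le_sum fun i _ => Finset.sum_le_sum fun k _ => ?_) (h.1 l)
    beta_reduce
    split_ifs
    exacts [h.2.2.2 i k l, le_rfl]
  · beta_reduce
    split_ifs
    exacts [⟨le_rfl, zero_le_one⟩, h.2.1 i]
  · beta_reduce
    split_ifs
    · simp
    · exact h.2.2.1 i k
  · beta_reduce
    split_ifs
    exacts [le_rfl, h.2.2.2 i k l]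

/-- A network contributes at most `maxBid` per unit of `x`, so dropping one whose multiplier is
larger is profitable. -/
theorem lp2Obj_zero_out_ge {σ : ℝ} (hσ : 0 ≤ σ) {j : J} {x : Fin n → ℝ}
    {y : Fin n → Fin (K + 1) → Fin M → ℝ} (h : A.Feasible j x y) (lam : Fin n → ℝ)
    (T : Fin n → Prop) [DecidablePred T] :
    A.lp2Obj σ lam x y + ∑ i, (if T i then (lam i - A.maxBid) * x i else 0) ≤
      A.lp2Obj σ lam (fun i => if T i then 0 else x i) fun i k l => if T i then 0 else y i k l := by
  simp only [lp2Obj, slotValue_eq_sum, Finset.mul_sum, ← Finset.sum_sub_distrib,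
    ← Finset.sum_add_distrib]
  refine Finset.sum_le_sum fun i _ => ?_
  have h1 := Feasible.netValue_le A h A.disc_le_one i
  by_cases hT : T i
  · have h0 : A.netValue A.disc (fun i k l => if T i then 0 else y i k l) i = 0 := by
      simp [netValue, hT]
    rw [h0]
    simp only [if_pos hT]
    have := mul_nonneg (half_pos (zero_lt_one' ℝ)).le (mul_nonneg hσ (sq_nonneg (x i)))
    linarith
  · have h0 : A.netValue A.disc (fun i k l => if T i then 0 else y i k l) i
        = A.netValue A.disc y i := by
      simp [netValue, hT]
    rw [h0]
    simp only [if_neg hT]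
    linarith

theorem lp2_min_le {σ : ℝ} (hσ : 0 ≤ σ) (j : J) (lam : Fin n → ℝ) :
    A.lp2 σ j (fun i => min (lam i) A.maxBid) ≤ A.lp2 σ j lam := by
  obtain ⟨x, y, hf, hopt⟩ := A.exists_isLP2Optimal σ j fun i => min (lam i) A.maxBid
  rw [isGreatest_lp2 hf hopt]
  refine le_trans ?_ (A.le_lp2 σ lam (Feasible.zero_out hf fun i => A.maxBid < lam i))
  refine le_trans ?_ (lp2Obj_zero_out_ge hσ hf lam fun i => A.maxBid < lam i)
  rw [A.lp2Obj_sub σ (fun i => min (lam i) A.maxBid) lam, sub_add, ← Finset.sum_sub_distrib]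
  refine le_sub_self_iff _ |>.2 (Finset.sum_nonpos fun i _ => ?_)
  split_ifs with h
  · rw [min_eq_right h.le, sub_self]
  · rw [min_eq_left (not_lt.1 h)]
    simp

theorem IsLP2Optimal.eq_zero {σ : ℝ} (hσ : 0 ≤ σ) {j : J} {lam x : Fin n → ℝ}
    (h : A.IsLP2Optimal σ j lam x) {i : Fin n} (hi : A.maxBid < lam i) : x i = 0 := by
  obtain ⟨y, hf, hopt⟩ := h
  have h1 := lp2Obj_zero_out_ge hσ hf lam fun i => A.maxBid < lam i
  have h2 := hopt _ _ (Feasible.zero_out hf fun i => A.maxBid < lam i)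
  have h3 : (lam i - A.maxBid) * x i
      ≤ ∑ i, (if A.maxBid < lam i then (lam i - A.maxBid) * x i else 0) := by
    have := Finset.single_le_sum
      (f := fun i => if A.maxBid < lam i then (lam i - A.maxBid) * x i else 0)
      (fun i _ => by
        split_ifs with h
        · exact mul_nonneg (sub_pos.2 h).le (hf.2.1 i).1
        · exact le_rfl) (Finset.mem_univ i)
    simpa only [if_pos hi] using this
  by_contra hne
  have := mul_pos (sub_pos.2 hi) (lt_of_le_of_ne (hf.2.1 i).1 (Ne.symm hne))
  linarith

/-- The truncation confines all multipliers that matter to a bounded box: the networks whose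
multiplier changes have x = 0. -/
theorem IsLP2Optimal.truncate {σ : ℝ} (hσ : 0 ≤ σ) {j : J} {lam x : Fin n → ℝ}
    (h : A.IsLP2Optimal σ j lam x) : A.IsLP2Optimal σ j (fun i => min (lam i) A.maxBid) x := by
  have hz := fun i => h.eq_zero hσ (i := i)
  obtain ⟨y, hf, hopt⟩ := h
  refine ⟨y, hf, fun x' y' h' => ?_⟩
  have h1 : A.lp2Obj σ (fun i => min (lam i) A.maxBid) x y = A.lp2Obj σ lam x y := by
    rw [A.lp2Obj_sub σ lam, Finset.sum_eq_zero, sub_zero]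
    intro i _
    rcases lt_or_ge A.maxBid (lam i) with hi | hi
    · rw [hz i hi, mul_zero]
    · rw [min_eq_left hi, sub_self, zero_mul]
  rw [h1, ← isGreatest_lp2 hf hopt]
  exact (A.le_lp2 σ _ h').trans (lp2_min_le hσ j lam)

/-! ### Optimal multipliers -/

variable (A)

theorem continuous_lp2 (σ : ℝ) (j : J) : Continuous (A.lp2 σ j) := by
  have key : ∀ lam lam' : Fin n → ℝ, A.lp2 σ j lam - A.lp2 σ j lam' ≤ n * dist lam lam' := by
    intro lam lam'
    obtain ⟨x, hx⟩ := A.exists_isLP2Optimal σ j lam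
    have h1 := hx.lp2_sub_le lam'
    have h2 : ∑ i, (lam' i - lam i) * x i ≤ ∑ _i : Fin n, dist lam lam' := by
      refine Finset.sum_le_sum fun i _ => (le_abs_self _).trans ?_
      rw [abs_mul, abs_of_nonneg (hx.mem i).1]
      refine (mul_le_of_le_one_right (abs_nonneg _) (hx.mem i).2).trans ?_
      rw [abs_sub_comm]
      exact dist_le_pi_dist lam lam' i
    rw [Finset.sum_const, Finset.card_univ, Fintype.card_fin, nsmul_eq_mul] at h2
    linarith
  refine (LipschitzWith.of_dist_le_mul (K := n) fun lam lam' => ?_).continuous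
  rw [Real.dist_eq, abs_le, NNReal.coe_natCast]
  constructor
  · have := key lam' lam
    rw [dist_comm] at this
    linarith
  · exact key lam lam'

/-- Truncation at `maxBid` does not increase the dual, so the minimum over a compact box is global.
-/
theorem exists_isOptimalMultiplier {σ : ℝ} (hσ : 0 ≤ σ) {t : ℕ} (s : Fin t → J) :
    ∃ lam, A.IsOptimalMultiplier σ s lam := by
  have hc : Continuous (A.sampleDual σ s) := by
    have := A.continuous_lp2 σ
    unfold sampleDual
    fun_prop
  obtain ⟨lam, hlam, hmin⟩ := (isCompact_Icc (a := (0 : Fin n → ℝ))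
    (b := fun _ => A.maxBid)).exists_isMinOn ⟨0, le_rfl, fun _ => A.maxBid_nonneg⟩ hc.continuousOn
  refine ⟨lam, fun i => hlam.1 i, fun lam' h' => ?_⟩
  refine (isMinOn_iff.1 hmin (fun i => min (lam' i) A.maxBid)
    ⟨fun i => le_min (h' i) A.maxBid_nonneg, fun i => min_le_right _ _⟩).trans ?_
  unfold sampleDual
  refine add_le_add (Finset.sum_le_sum fun i _ => ?_) ?_
  · exact mul_le_mul_of_nonneg_right (min_le_left _ _) (A.rate_nonneg i)
  · refine mul_le_mul_of_nonneg_left (Finset.sum_le_sum fun r _ => lp2_min_le hσ _ _) ?_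
    positivity

theorem nonempty_lpValRun {σ : ℝ} (hσ : 0 ≤ σ) (t : ℕ) : Nonempty (A.LPValRun σ t) := by
  choose lam hlam using fun s : Fin t → J => A.exists_isOptimalMultiplier hσ s
  choose x hx using fun (s : Fin t → J) (j : J) => A.exists_isLP2Optimal σ j (lam s)
  exact ⟨⟨lam, hlam, x, hx⟩⟩

/-- The frequency of call-outs of network `i` on the sample `s`. -/
def sampleRate {t : ℕ} (s : Fin t → J) (x : J → Fin n → ℝ) (i : Fin n) : ℝ :=
  1 / (t : ℝ) * ∑ r, x (s r) i

theorem abs_sampleRate_sub_le {t : ℕ} (s : Fin t → J) {x x' : J → Fin n → ℝ} {i : Fin n} {e : ℝ}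
    (he : 0 ≤ e) (h : ∀ j, |x j i - x' j i| ≤ e) :
    |sampleRate s x i - sampleRate s x' i| ≤ e := by
  unfold sampleRate
  rw [← mul_sub, ← Finset.sum_sub_distrib, abs_mul, abs_of_nonneg (by positivity)]
  have h1 : |∑ r, (x (s r) i - x' (s r) i)| ≤ t * e := by
    refine (Finset.abs_sum_le_sum_abs _ _).trans ?_
    refine (Finset.sum_le_sum fun r _ => h (s r)).trans_eq ?_
    simp
  rcases Nat.eq_zero_or_pos t with rfl | ht
  · simpa using he
  · have ht' : (0 : ℝ) < t := Nat.cast_pos.2 ht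
    rw [one_div, inv_mul_le_iff₀ ht']
    exact h1

variable {A}

/-- Move one multiplier by `u`. The dual cannot decrease, and the optimal solution at the moved
point is a subgradient there. -/
theorem IsOptimalMultiplier.mul_nonneg {σ : ℝ} {t : ℕ} {s : Fin t → J} {lam : Fin n → ℝ}
    (h : A.IsOptimalMultiplier σ s lam) {i : Fin n} {u : ℝ} (hu : 0 ≤ lam i + u)
    {x' : J → Fin n → ℝ}
    (hx' : ∀ j, A.IsLP2Optimal σ j (Function.update lam i (lam i + u)) (x' j)) :
    0 ≤ u * (A.rate i - sampleRate s x' i) := by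
  set lam' := Function.update lam i (lam i + u) with hlam'
  have hd : ∀ i', lam' i' - lam i' = if i' = i then u else 0 := fun i' => by
    by_cases hi : i' = i
    · subst hi; simp [hlam']
    · simp [hlam', hi]
  have h1 := h.2 lam' fun i' => by
    by_cases hi : i' = i
    · subst hi; simpa [hlam'] using hu
    · simpa [hlam', hi] using h.1 i'
  have h2 : ∀ j, A.lp2 σ j lam' ≤ A.lp2 σ j lam - u * x' j i := fun j => by
    have h3 := (hx' j).lp2_sub_le lam
    have h4 : ∑ i', (lam i' - lam' i') * x' j i' = -(u * x' j i) := by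
      rw [Finset.sum_eq_single i]
      · have := hd i
        rw [if_pos rfl] at this
        rw [← neg_sub, this]
        ring
      · intro i' _ hi
        have := hd i'
        rw [if_neg hi] at this
        rw [← neg_sub, this]
        simp
      · simp
    rw [h4] at h3
    linarith
  have h5 : ∑ i', lam' i' * A.rate i' = ∑ i', lam i' * A.rate i' + u * A.rate i := by
    have : ∀ i', lam' i' * A.rate i' = lam i' * A.rate i' + if i' = i then u * A.rate i else 0 :=
      fun i' => by
        have := hd i'
        split_ifs at this ⊢ with hi
        · subst hi
          rw [← sub_eq_iff_eq_add', ← sub_mul, this]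
        · rw [sub_eq_zero.1 this, add_zero]
    simp only [this, Finset.sum_add_distrib, Finset.sum_ite_eq', Finset.mem_univ, if_true]
  have h6 : 1 / (t : ℝ) * ∑ r, A.lp2 σ (s r) lam'
      ≤ 1 / (t : ℝ) * ∑ r, A.lp2 σ (s r) lam - u * sampleRate s x' i := by
    have : 1 / (t : ℝ) * ∑ r, A.lp2 σ (s r) lam - u * sampleRate s x' i
        = 1 / (t : ℝ) * ∑ r, (A.lp2 σ (s r) lam - u * x' (s r) i) := by
      rw [sampleRate, Finset.sum_sub_distrib, ← Finset.mul_sum]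
      ring
    rw [this]
    exact mul_le_mul_of_nonneg_left (Finset.sum_le_sum fun r _ => h2 (s r)) (by positivity)
  unfold sampleDual at h1
  rw [h5] at h1
  linarith [mul_sub u (A.rate i) (sampleRate s x' i)]

/-- The first-order condition at the multiplier itself: the Lipschitz bound replaces the moved
solution at a cost quadratic in `u`, negligible for small `u`. -/
theorem IsOptimalMultiplier.mul_ge {σ : ℝ} (hσ : 0 < σ) {t : ℕ} {s : Fin t → J}
    {lam : Fin n → ℝ} (h : A.IsOptimalMultiplier σ s lam) {x : J → Fin n → ℝ}
    (hx : ∀ j, A.IsLP2Optimal σ j lam (x j)) {i : Fin n} {u : ℝ} (hu : 0 ≤ lam i + u) :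
    -(|u| * (2 * n * |u| / σ)) ≤ u * (A.rate i - sampleRate s x i) := by
  choose x' hx' using fun j => A.exists_isLP2Optimal σ j (Function.update lam i (lam i + u))
  have h1 := h.mul_nonneg hu hx'
  have h2 : |sampleRate s x i - sampleRate s x' i| ≤ 2 * n * |u| / σ := by
    refine abs_sampleRate_sub_le s (by positivity) fun j => ?_
    refine (hx j).abs_sub_le hσ (hx' j) (fun i' => ?_) i
    by_cases hi : i' = i
    · subst hi; simp
    · simp [hi]
  have h3 : u * (A.rate i - sampleRate s x i) = u * (A.rate i - sampleRate s x' i)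
      - u * (sampleRate s x i - sampleRate s x' i) := by ring
  have h4 : |u * (sampleRate s x i - sampleRate s x' i)| ≤ |u| * (2 * n * |u| / σ) := by
    rw [abs_mul]
    exact mul_le_mul_of_nonneg_left h2 (abs_nonneg u)
  linarith [(abs_le.1 h4).2]

theorem IsOptimalMultiplier.sampleRate_le {σ : ℝ} (hσ : 0 < σ) {t : ℕ} {s : Fin t → J}
    {lam : Fin n → ℝ} (h : A.IsOptimalMultiplier σ s lam) {x : J → Fin n → ℝ}
    (hx : ∀ j, A.IsLP2Optimal σ j lam (x j)) (i : Fin n) : sampleRate s x i ≤ A.rate i := by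
  by_contra! hlt
  set d := sampleRate s x i - A.rate i with hd
  have hd0 : 0 < d := sub_pos.2 hlt
  have hn : (0 : ℝ) < n := by exact_mod_cast i.pos
  -- Small enough for the quadratic error to be half of the linear gain.
  set u := d * σ / (4 * n) with hu
  have hu0 : 0 < u := by positivity
  have h1 := h.mul_ge hσ hx (i := i) (u := u) (by linarith [h.1 i])
  rw [abs_of_pos hu0] at h1
  have h2 : 2 * n * u / σ = d / 2 := by
    rw [hu]; field_simp; norm_num
  rw [h2] at h1
  have h3 : u * (A.rate i - sampleRate s x i) = -(u * d) := by rw [hd]; ring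
  rw [h3] at h1
  have := mul_pos hu0 hd0
  linarith

/-- Complementary slackness: a positive multiplier can also be lowered a little. -/
theorem IsOptimalMultiplier.le_sampleRate {σ : ℝ} (hσ : 0 < σ) {t : ℕ} {s : Fin t → J}
    {lam : Fin n → ℝ} (h : A.IsOptimalMultiplier σ s lam) {x : J → Fin n → ℝ}
    (hx : ∀ j, A.IsLP2Optimal σ j lam (x j)) {i : Fin n} (hi : 0 < lam i) :
    A.rate i ≤ sampleRate s x i := by
  by_contra! hlt
  set d := A.rate i - sampleRate s x i with hd
  have hd0 : 0 < d := sub_pos.2 hlt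
  have hn : (0 : ℝ) < n := by exact_mod_cast i.pos
  set u := min (lam i) (d * σ / (4 * n)) with hu
  have hu0 : 0 < u := lt_min hi (by positivity)
  have h1 := h.mul_ge hσ hx (i := i) (u := -u) (by linarith [min_le_left (lam i) (d * σ / (4 * n))])
  rw [abs_neg, abs_of_pos hu0] at h1
  have h2 : 2 * n * u / σ ≤ d / 2 := by
    have h3 : u ≤ d * σ / (4 * n) := min_le_right _ _
    calc 2 * n * u / σ ≤ 2 * n * (d * σ / (4 * n)) / σ := by gcongr
      _ = d / 2 := by field_simp; norm_num
  have h3 := mul_le_mul_of_nonneg_left h2 hu0.le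
  have := mul_pos hu0 hd0
  linarith

/-! ### Weak duality -/

variable [Fintype J]

variable (A)

theorem lp1_le_of {q : PMF J} {B : ℝ} (h : ∀ (x : J → Fin n → ℝ)
    (y : J → Fin n → Fin (K + 1) → Fin M → ℝ), (∀ j, A.Feasible j (x j) (y j)) →
    (∀ i, ∑ j, (q j).toReal * x j i ≤ A.rate i) →
    ∑ j, (q j).toReal * A.slotValue A.disc (y j) ≤ B) : A.lp1 q ≤ B := by
  refine csSup_le ⟨_, fun _ _ => 0, fun _ _ _ _ => 0, fun j => A.feasible_zero j
    fun _ => ⟨le_rfl, zero_le_one⟩, fun i => by simpa using A.rate_nonneg i, rfl⟩ ?_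
  rintro v ⟨x, y, hf, hr, rfl⟩
  exact h x y hf hr

theorem le_lp1 {q : PMF J} {x : J → Fin n → ℝ}
    {y : J → Fin n → Fin (K + 1) → Fin M → ℝ} (hf : ∀ j, A.Feasible j (x j) (y j))
    (hr : ∀ i, ∑ j, (q j).toReal * x j i ≤ A.rate i) :
    ∑ j, (q j).toReal * A.slotValue A.disc (y j) ≤ A.lp1 q := by
  refine le_csSup ⟨n * A.maxBid, ?_⟩ ⟨x, y, hf, hr, rfl⟩
  rintro v ⟨x', y', h', -, rfl⟩
  calc ∑ j, (q j).toReal * A.slotValue A.disc (y' j)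
      ≤ ∑ j, (q j).toReal * (n * A.maxBid) := Finset.sum_le_sum fun j _ =>
        mul_le_mul_of_nonneg_left (Feasible.slotValue_le A (h' j) A.disc_le_one)
          ENNReal.toReal_nonneg
    _ = n * A.maxBid := by rw [← Finset.sum_mul, sum_toReal, one_mul]

theorem lp1_nonneg (q : PMF J) : 0 ≤ A.lp1 q := by
  have := A.le_lp1 (q := q) (fun j => A.feasible_zero j (x := fun _ => 0)
    fun _ => ⟨le_rfl, zero_le_one⟩) fun i => by simpa using A.rate_nonneg i
  simpa [slotValue] using this

theorem lp1_le (q : PMF J) : A.lp1 q ≤ n * A.maxBid := by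
  refine A.lp1_le_of fun x y hf _ => ?_
  calc ∑ j, (q j).toReal * A.slotValue A.disc (y j)
      ≤ ∑ j, (q j).toReal * (n * A.maxBid) := Finset.sum_le_sum fun j _ =>
        mul_le_mul_of_nonneg_left (Feasible.slotValue_le A (hf j) A.disc_le_one)
          ENNReal.toReal_nonneg
    _ = n * A.maxBid := by rw [← Finset.sum_mul, sum_toReal, one_mul]

theorem lp1_le_dual {σ : ℝ} (hσ : 0 ≤ σ) (q : PMF J) {lam : Fin n → ℝ} (hlam : ∀ i, 0 ≤ lam i) :
    A.lp1 q ≤ ∑ j, (q j).toReal * A.lp2 σ j lam + ∑ i, lam i * A.rate i + σ / 2 * n := by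
  refine A.lp1_le_of fun x y hf hr => ?_
  have h1 : ∀ j, A.slotValue A.disc (y j)
      ≤ A.lp2 σ j lam + ∑ i, lam i * x j i + σ / 2 * n := fun j => by
    have h2 := A.le_lp2 σ lam (hf j)
    have h3 : ∑ i, x j i ^ 2 ≤ n := by
      calc ∑ i, x j i ^ 2 ≤ ∑ _i : Fin n, (1 : ℝ) := Finset.sum_le_sum fun i _ =>
            pow_le_one₀ ((hf j).2.1 i).1 ((hf j).2.1 i).2
        _ = n := by simp
    have h4 := mul_le_mul_of_nonneg_left h3 (by linarith : 0 ≤ σ / 2)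
    unfold lp2Obj at h2
    linarith
  calc ∑ j, (q j).toReal * A.slotValue A.disc (y j)
      ≤ ∑ j, (q j).toReal * (A.lp2 σ j lam + ∑ i, lam i * x j i + σ / 2 * n) :=
        Finset.sum_le_sum fun j _ => mul_le_mul_of_nonneg_left (h1 j) ENNReal.toReal_nonneg
    _ = ∑ j, (q j).toReal * A.lp2 σ j lam + ∑ i, lam i * ∑ j, (q j).toReal * x j i
          + σ / 2 * n := by
        simp only [mul_add, Finset.sum_add_distrib]
        rw [← Finset.sum_mul, sum_toReal, one_mul]
        congr 2
        simp only [Finset.mul_sum]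
        rw [Finset.sum_comm]
        exact Finset.sum_congr rfl fun i _ => Finset.sum_congr rfl fun j _ => by ring
    _ ≤ _ := by
        have := Finset.sum_le_sum fun i (_ : i ∈ Finset.univ) =>
          mul_le_mul_of_nonneg_left (hr i) (hlam i)
        linarith

/-- The value of the decoupled program when its multipliers are near-optimal for the true
distribution: it suffices that the sampled call-out rates are not much larger than the true ones. -/
theorem lp1_le_slotValue {σ η : ℝ} (hσ : 0 < σ) (hη : 0 ≤ η) (q : PMF J) {t : ℕ} {s : Fin t → J}
    {lam : Fin n → ℝ} (h : A.IsOptimalMultiplier σ s lam) {x : J → Fin n → ℝ}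
    {y : J → Fin n → Fin (K + 1) → Fin M → ℝ} (hf : ∀ j, A.Feasible j (x j) (y j))
    (hopt : ∀ j x' y', A.Feasible j x' y' →
      A.lp2Obj σ lam x' y' ≤ A.lp2Obj σ lam (x j) (y j))
    (hrate : ∀ i, sampleRate s x i ≤ 2 * ∑ j, (q j).toReal * x j i + η) :
    A.lp1 q ≤ 2 * ∑ j, (q j).toReal * A.slotValue A.disc (y j) + n * (A.maxBid * η)
      + σ / 2 * n := by
  have hx : ∀ j, A.IsLP2Optimal σ j lam (x j) := fun j => ⟨y j, hf j, hopt j⟩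
  -- The optimal multipliers themselves may be unbounded; truncation keeps the loss from the rate
  -- error `η` below `maxBid * η` per network.
  set mu : Fin n → ℝ := fun i => min (lam i) A.maxBid with hmu
  have hmu0 : ∀ i, 0 ≤ mu i := fun i => le_min (h.1 i) A.maxBid_nonneg
  refine (A.lp1_le_dual hσ.le q hmu0).trans ?_
  have h1 : ∑ i, mu i * A.rate i ≤ 2 * ∑ i, mu i * ∑ j, (q j).toReal * x j i
      + n * (A.maxBid * η) := by
    calc ∑ i, mu i * A.rate i
        ≤ ∑ i, (2 * (mu i * ∑ j, (q j).toReal * x j i) + A.maxBid * η) := by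
          refine Finset.sum_le_sum fun i _ => ?_
          rcases (h.1 i).eq_or_lt with h0 | h0
          · have : mu i = 0 := by
              simp only [hmu, ← h0]
              exact min_eq_left A.maxBid_nonneg
            rw [this]
            simpa using mul_nonneg A.maxBid_nonneg hη
          · have h2 := (h.le_sampleRate hσ hx h0).trans (hrate i)
            have h3 := mul_le_mul_of_nonneg_left h2 (hmu0 i)
            have h4 : mu i * η ≤ A.maxBid * η :=
              mul_le_mul_of_nonneg_right (min_le_right _ _) hη
            linarith
      _ = _ := by rw [Finset.sum_add_distrib, ← Finset.mul_sum]; simp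
  have h2 : ∀ j, A.lp2 σ j mu + ∑ i, mu i * x j i ≤ A.slotValue A.disc (y j) := fun j => by
    have h3 : A.lp2 σ j mu = A.lp2Obj σ mu (x j) (y j) := by
      have h5 : A.lp2 σ j mu ≤ A.lp2 σ j lam := lp2_min_le hσ.le j lam
      rw [isGreatest_lp2 (hf j) (hopt j)] at h5
      refine le_antisymm (h5.trans ?_) (A.le_lp2 σ mu (hf j))
      rw [A.lp2Obj_sub σ lam mu]
      have : ∑ i, (mu i - lam i) * x j i ≤ 0 := Finset.sum_nonpos fun i _ =>
        mul_nonpos_of_nonpos_of_nonneg (sub_nonpos.2 (min_le_left _ _)) ((hf j).2.1 i).1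
      linarith
    rw [h3, lp2Obj]
    have := mul_nonneg (half_pos hσ).le
      (Finset.sum_nonneg fun i (_ : i ∈ Finset.univ) => sq_nonneg (x j i))
    linarith
  have h3 : ∑ j, (q j).toReal * A.lp2 σ j mu + ∑ i, mu i * ∑ j, (q j).toReal * x j i
      ≤ ∑ j, (q j).toReal * A.slotValue A.disc (y j) := by
    have : ∑ i, mu i * ∑ j, (q j).toReal * x j i = ∑ j, (q j).toReal * ∑ i, mu i * x j i := by
      simp only [Finset.mul_sum]
      rw [Finset.sum_comm]
      exact Finset.sum_congr rfl fun j _ => Finset.sum_congr rfl fun i _ => by ring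
    rw [this, ← Finset.sum_add_distrib]
    refine Finset.sum_le_sum fun j _ => ?_
    rw [← mul_add]
    exact mul_le_mul_of_nonneg_left (h2 j) ENNReal.toReal_nonneg
  -- Lets the factor 2 on the rates be applied to the decoupled values as well.
  have h4 : 0 ≤ ∑ j, (q j).toReal * A.lp2 σ j mu :=
    Finset.sum_nonneg fun j _ => mul_nonneg ENNReal.toReal_nonneg (A.lp2_nonneg σ j mu)
  linarith

end Exchange

theorem expect_le_of_le {α : Type*} {p : PMF α} {f : α → ℝ} {B : ℝ} (hf : BddOn p f)
    (h : ∀ a ∈ p.support, f a ≤ B) : expect p f ≤ B := by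
  rw [← expect_const p B]
  exact expect_mono hf (BddOn.const B) h

namespace Exchange

variable {n M K : ℕ} {J : Type} (A : Exchange n M K J)

/-! ### Mixtures of solutions -/

variable {A}

theorem Feasible.le_one {j : J} {x : Fin n → ℝ} {y : Fin n → Fin (K + 1) → Fin M → ℝ}
    (h : A.Feasible j x y) (i : Fin n) (k : Fin (K + 1)) (l : Fin M) : y i k l ≤ 1 :=
  calc y i k l ≤ ∑ l, y i k l :=
        Finset.single_le_sum (f := fun l => y i k l) (fun l _ => h.2.2.2 i k l) (Finset.mem_univ l)
    _ ≤ (A.p i j k).toReal * x i := h.2.2.1 i k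
    _ ≤ 1 := mul_le_one₀ (toReal_le_one _ _) (h.2.1 i).1 (h.2.1 i).2

theorem Feasible.bddOn {α : Type*} {μ : PMF α} {j : J} {x : α → Fin n → ℝ}
    {y : α → Fin n → Fin (K + 1) → Fin M → ℝ} (h : ∀ a, A.Feasible j (x a) (y a))
    (i : Fin n) (k : Fin (K + 1)) (l : Fin M) : BddOn μ fun a => y a i k l :=
  BddOn.of_le (B := 1) fun a => by
    rw [abs_of_nonneg ((h a).2.2.2 i k l)]
    exact Feasible.le_one (h a) i k l

theorem Feasible.expect {α : Type*} {μ : PMF α} {j : J} {x : α → Fin n → ℝ}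
    {y : α → Fin n → Fin (K + 1) → Fin M → ℝ} (h : ∀ a, A.Feasible j (x a) (y a)) :
    A.Feasible j (fun i => CallOut.expect μ fun a => x a i)
      fun i k l => CallOut.expect μ fun a => y a i k l := by
  have hy : ∀ i k l, BddOn μ fun a => y a i k l := Feasible.bddOn h
  have hx : ∀ i, BddOn μ fun a => x a i := fun i => BddOn.of_le (B := 1) fun a => by
    rw [abs_of_nonneg ((h a).2.1 i).1]
    exact ((h a).2.1 i).2
  refine ⟨fun l => ?_, fun i => ⟨expect_nonneg fun a _ => ((h a).2.1 i).1,
    expect_le_of_le (hx i) fun a _ => ((h a).2.1 i).2⟩, fun i k => ?_,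
    fun i k l => expect_nonneg fun a _ => (h a).2.2.2 i k l⟩
  · have : ∑ i, ∑ k, CallOut.expect μ (fun a => y a i k l)
        = CallOut.expect μ fun a => ∑ i, ∑ k, y a i k l := by
      rw [expect_sum fun i _ => BddOn.sum fun k _ => hy i k l]
      exact Finset.sum_congr rfl fun i _ => (expect_sum fun k _ => hy i k l).symm
    rw [this]
    exact expect_le_of_le (BddOn.sum fun i _ => BddOn.sum fun k _ => hy i k l)
      fun a _ => (h a).1 l
  · rw [← expect_sum fun l _ => hy i k l, ← expect_const_mul]
    exact expect_mono (BddOn.sum fun l _ => hy i k l) ((BddOn.const _).mul (hx i))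
      fun a _ => (h a).2.2.1 i k

theorem slotValue_expect {α : Type*} {μ : PMF α} {j : J} {x : α → Fin n → ℝ}
    {y : α → Fin n → Fin (K + 1) → Fin M → ℝ} (h : ∀ a, A.Feasible j (x a) (y a))
    (d : Fin M → ℝ) :
    A.slotValue d (fun i k l => CallOut.expect μ fun a => y a i k l)
      = CallOut.expect μ fun a => A.slotValue d (y a) := by
  have hy : ∀ i k l, BddOn μ fun a => A.bid k * d l * y a i k l := fun i k l =>
    (BddOn.const _).mul (Feasible.bddOn h i k l)
  unfold slotValue
  rw [expect_sum fun i _ => BddOn.sum fun k _ => BddOn.sum fun l _ => hy i k l]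
  refine Finset.sum_congr rfl fun i _ => ?_
  rw [expect_sum fun k _ => BddOn.sum fun l _ => hy i k l]
  refine Finset.sum_congr rfl fun k _ => ?_
  rw [expect_sum fun l _ => hy i k l]
  exact Finset.sum_congr rfl fun l _ => expect_const_mul _ |>.symm

variable (A)

/-! ### The law of a run -/

/-- The expectation of `g` at the next arrival after the history `h`. -/
def stepExpect (q : PMF J) (π : Policy n K J) (h : List (Record n K J))
    (g : Record n K J → ℝ) : ℝ :=
  expect q fun j => expect (π (h.map Record.observe) j) fun a =>
    expect (A.bidLaw j) fun b => g ⟨j, a, b⟩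

theorem length_of_mem_support {q : PMF J} {π : Policy n K J} {s : ℕ}
    {h : List (Record n K J)} (hh : h ∈ (A.runLaw q π s).support) : h.length = s := by
  induction s generalizing h with
  | zero =>
    rw [runLaw, PMF.mem_support_pure_iff] at hh
    simp [hh]
  | succ s ih =>
    simp only [runLaw, PMF.mem_support_bind_iff, PMF.mem_support_pure_iff] at hh
    obtain ⟨h', hh', j, -, a, -, b, -, rfl⟩ := hh
    simp [ih hh']

theorem expect_runLaw_succ {q : PMF J} {π : Policy n K J} {s : ℕ} {f : List (Record n K J) → ℝ}
    (hf : BddOn (A.runLaw q π (s + 1)) f) :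
    expect (A.runLaw q π (s + 1)) f
      = expect (A.runLaw q π s) fun h => A.stepExpect q π h fun e => f (h ++ [e]) := by
  have hf' := hf
  rw [runLaw] at hf' ⊢
  rw [expect_bind _ _ hf']
  refine expect_congr fun h hh => ?_
  have h1 := hf'.of_bind hh
  rw [expect_bind _ _ h1]
  refine expect_congr fun j hj => ?_
  have h2 := h1.of_bind hj
  rw [expect_bind _ _ h2]
  refine expect_congr fun a ha => ?_
  have h3 := h2.of_bind ha
  rw [expect_bind _ _ h3]
  simp only [expect_pure]

section Step

variable {q : PMF J} {π : Policy n K J} {h : List (Record n K J)} {g g' : Record n K J → ℝ}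

theorem abs_stepExpect_le {B : ℝ} (hg : ∀ e, |g e| ≤ B) : |A.stepExpect q π h g| ≤ B :=
  abs_expect_le fun _ _ => abs_expect_le fun _ _ => abs_expect_le fun _ _ => hg _

theorem stepExpect_const (c : ℝ) : A.stepExpect q π h (fun _ => c) = c := by
  simp only [stepExpect, expect_const]

theorem stepExpect_const_mul (c : ℝ) :
    A.stepExpect q π h (fun e => c * g e) = c * A.stepExpect q π h g := by
  simp only [stepExpect, expect_const_mul]

theorem stepExpect_add {B B' : ℝ} (hg : ∀ e, |g e| ≤ B) (hg' : ∀ e, |g' e| ≤ B') :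
    A.stepExpect q π h (fun e => g e + g' e) = A.stepExpect q π h g + A.stepExpect q π h g' := by
  unfold stepExpect
  rw [← expect_add (BddOn.of_le (B := B) fun _ => abs_expect_le fun _ _ => abs_expect_le
    fun _ _ => hg _) (BddOn.of_le (B := B') fun _ => abs_expect_le fun _ _ => abs_expect_le
    fun _ _ => hg' _)]
  refine expect_congr fun j _ => ?_
  rw [← expect_add (BddOn.of_le (B := B) fun _ => abs_expect_le
    fun _ _ => hg _) (BddOn.of_le (B := B') fun _ => abs_expect_le fun _ _ => hg' _)]
  refine expect_congr fun a _ => ?_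
  rw [← expect_add (BddOn.of_le (B := B) fun _ => hg _) (BddOn.of_le (B := B') fun _ => hg' _)]

end Step

variable {A} in
theorem abs_sum_map_le {g : Record n K J → ℝ} {B : ℝ} (hg : ∀ e, |g e| ≤ B)
    (h : List (Record n K J)) : |(h.map g).sum| ≤ h.length * B := by
  induction h with
  | nil => simp
  | cons e h ih =>
    simp only [List.map_cons, List.sum_cons, List.length_cons, Nat.cast_add, Nat.cast_one]
    exact (abs_add_le _ _).trans (by linarith [hg e])

theorem bddOn_sum {q : PMF J} {π : Policy n K J} {g : Record n K J → ℝ} {B : ℝ}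
    (hg : ∀ e, |g e| ≤ B) (s : ℕ) : BddOn (A.runLaw q π s) fun h => (h.map g).sum :=
  ⟨s * B, fun h hh => by
    have := abs_sum_map_le hg h
    rwa [A.length_of_mem_support hh] at this⟩

/-- The expectation of an additive objective is the sum of its expectations at each arrival. -/
theorem expect_sum_map {q : PMF J} {π : Policy n K J} {g : Record n K J → ℝ} {B : ℝ}
    (hg : ∀ e, |g e| ≤ B) (m : ℕ) :
    expect (A.runLaw q π m) (fun h => (h.map g).sum)
      = ∑ s ∈ Finset.range m, expect (A.runLaw q π s) fun h => A.stepExpect q π h g := by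
  induction m with
  | zero => simp [runLaw, expect_pure]
  | succ m ih =>
    rw [Finset.sum_range_succ, ← ih, A.expect_runLaw_succ (A.bddOn_sum hg _),
      ← expect_add (A.bddOn_sum hg m) (BddOn.of_le fun h => A.abs_stepExpect_le hg)]
    refine expect_congr fun h _ => ?_
    simp only [List.map_append, List.map_cons, List.map_nil, List.sum_append, List.sum_singleton]
    rw [A.stepExpect_add (B := |(h.map g).sum|) (fun _ => le_rfl) hg, stepExpect_const]

/-! ### Upper bounds on the performance of policies -/

/-- The law of the decision on impression `j`, averaged over the first `m` arrivals. -/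
def meanDecision (q : PMF J) (π : Policy n K J) (m : ℕ) [NeZero m] (j : J) : PMF (Action n) :=
  (PMF.uniformOfFintype (Fin m)).bind fun s => (A.runLaw q π s).bind fun h =>
    π (h.map Record.observe) j

theorem expect_meanDecision (q : PMF J) (π : Policy n K J) (m : ℕ) [NeZero m] (j : J)
    {f : Action n → ℝ} {B : ℝ} (hf : ∀ a, |f a| ≤ B) :
    (m : ℝ) * expect (A.meanDecision q π m j) f = ∑ s ∈ Finset.range m,
      expect (A.runLaw q π s) fun h => expect (π (h.map Record.observe) j) f := by
  have hm : (m : ℝ) ≠ 0 := Nat.cast_ne_zero.2 (NeZero.ne m)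
  unfold meanDecision
  rw [expect_bind _ _ (BddOn.of_le hf), expect_fintype, Finset.mul_sum, Finset.sum_range]
  refine Finset.sum_congr rfl fun s _ => ?_
  rw [expect_bind _ _ (BddOn.of_le hf), PMF.uniformOfFintype_apply, ENNReal.toReal_inv,
    Fintype.card_fin, ENNReal.toReal_natCast, mul_inv_cancel_left₀ hm]

/-- The arriving impression is independent of the history, so for a fixed impression the decisions
may be averaged over histories and times. -/
theorem sum_meanDecision [Fintype J] (q : PMF J) (π : Policy n K J) (m : ℕ) [NeZero m]
    {g : Record n K J → ℝ} {B : ℝ} (hg : ∀ e, |g e| ≤ B) :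
    (m : ℝ) * ∑ j, (q j).toReal * expect (A.meanDecision q π m j)
        (fun a => expect (A.bidLaw j) fun b => g ⟨j, a, b⟩)
      = expect (A.runLaw q π m) fun h => (h.map g).sum := by
  rw [A.expect_sum_map hg, Finset.mul_sum]
  have h1 : ∀ j, (m : ℝ) * ((q j).toReal * expect (A.meanDecision q π m j)
      (fun a => expect (A.bidLaw j) fun b => g ⟨j, a, b⟩))
      = ∑ s ∈ Finset.range m, (q j).toReal * expect (A.runLaw q π s) fun h =>
        expect (π (h.map Record.observe) j) fun a => expect (A.bidLaw j) fun b => g ⟨j, a, b⟩ :=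
    fun j => by
      rw [mul_left_comm, A.expect_meanDecision q π m j
        (fun a => abs_expect_le (B := B) fun _ _ => hg _), Finset.mul_sum]
  simp only [h1]
  rw [Finset.sum_comm]
  refine Finset.sum_congr rfl fun s _ => ?_
  have h2 : ∀ h, A.stepExpect q π h g = ∑ j, (q j).toReal * expect (π (h.map Record.observe) j)
      fun a => expect (A.bidLaw j) fun b => g ⟨j, a, b⟩ := fun h => expect_fintype _ _
  simp only [h2]
  rw [expect_sum fun j _ => (BddOn.const _).mul (BddOn.of_le (B := B) fun h =>
    abs_expect_le fun _ _ => abs_expect_le fun _ _ => hg _)]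
  exact Finset.sum_congr rfl fun j _ => (expect_const_mul _).symm

theorem sum_indicator_eq_calls (h : List (Record n K J)) (i : Fin n) :
    (h.map fun e => if i ∈ e.act.called then (1 : ℝ) else 0).sum
      = calls (h.map Record.observe) i := by
  induction h with
  | nil => simp [calls]
  | cons e h ih =>
    simp only [calls, List.map_cons, List.sum_cons, List.countP_cons, Record.observe] at ih ⊢
    rw [ih]
    split_ifs <;> simp_all [add_comm]

/-- The per-impression constraints are convex, hence kept by averaging assignments over
`meanDecision`; the budgets in every run give the rate constraints in expectation. -/
theorem perf_le_lp1 [Fintype J] (q : PMF J) {m : ℕ} {π : Policy n K J} (hπ : A.Admissible q m π)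
    {g : Record n K J → ℝ} {B : ℝ} (hg : ∀ e, |g e| ≤ B)
    (y : J → Action n → Fin n → Fin (K + 1) → Fin M → ℝ)
    (hy : ∀ j a, A.Feasible j (fun i => if i ∈ a.called then 1 else 0) (y j a))
    (hgy : ∀ j a, expect (A.bidLaw j) (fun b => g ⟨j, a, b⟩) ≤ A.slotValue A.disc (y j a)) :
    A.perf q m g π ≤ A.lp1 q := by
  rcases Nat.eq_zero_or_pos m with rfl | hm
  · simpa [perf] using A.lp1_nonneg q
  have : NeZero m := ⟨hm.ne'⟩
  have hm' : (0 : ℝ) < m := Nat.cast_pos.2 hm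
  have key := A.le_lp1 (q := q) (fun j => Feasible.expect (μ := A.meanDecision q π m j) (hy j))
    fun i => by
      have h1 := A.sum_meanDecision q π m (B := 1)
        (g := fun e => if i ∈ e.act.called then (1 : ℝ) else 0)
        fun e => by split_ifs <;> simp
      simp only [sum_indicator_eq_calls] at h1
      have h2 : (m : ℝ) * ∑ j, (q j).toReal * expect (A.meanDecision q π m j)
          (fun a => if i ∈ a.called then 1 else 0)
          = expect (A.runLaw q π m) fun h => (calls (h.map Record.observe) i : ℝ) := by
        rw [← h1]
        congr 1
        exact Finset.sum_congr rfl fun j _ => congrArg _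
          (expect_congr fun a _ => (expect_const (A.bidLaw j) _).symm)
      refine le_of_mul_le_mul_left ?_ hm'
      rw [h2]
      refine expect_le_of_le ⟨A.rate i * m, fun h hh => ?_⟩ fun h hh => ?_
      · rw [abs_of_nonneg (Nat.cast_nonneg _)]
        exact hπ h hh i
      · rw [mul_comm]
        exact hπ h hh i
  refine le_trans ?_ key
  have hperf : A.perf q m g π = (expect (A.runLaw q π m) fun h => (h.map g).sum) / m := rfl
  rw [hperf, div_le_iff₀' hm', ← A.sum_meanDecision q π m hg]
  refine mul_le_mul_of_nonneg_left (Finset.sum_le_sum fun j _ =>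
    mul_le_mul_of_nonneg_left ?_ ENNReal.toReal_nonneg) hm'.le
  rw [slotValue_expect (hy j)]
  refine expect_mono (BddOn.of_le (B := B) fun a => abs_expect_le fun _ _ => hg _) ?_
    fun a _ => hgy j a
  refine BddOn.of_le (B := n * A.maxBid) fun a => ?_
  rw [abs_of_nonneg (Feasible.slotValue_nonneg A (hy j a) A.disc_nonneg)]
  exact Feasible.slotValue_le A (hy j a) A.disc_le_one

theorem rankedBid_le (S : Finset (Fin n)) (b : Fin n → Fin (K + 1)) (r : ℝ) (l : ℕ) :
    A.rankedBid S b r l ≤ A.maxBid := by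
  unfold rankedBid
  by_cases h : l < (A.ranked S b r).length
  · rw [List.getD_eq_getElem _ _ h]
    have hm := List.getElem_mem h
    unfold ranked at hm
    rw [Multiset.mem_sort, Multiset.mem_filter, Multiset.mem_map] at hm
    obtain ⟨⟨i, _, hi⟩, -⟩ := hm
    exact hi.symm.trans_le (A.bid_le_maxBid _)
  · rw [List.getD_eq_default _ _ (not_lt.1 h)]
    exact A.maxBid_nonneg

theorem sum_rankedBid_le (S : Finset (Fin n)) (b : Fin n → Fin (K + 1)) (r : ℝ) :
    ∑ l : Fin M, A.disc l * A.rankedBid S b r l ≤ M * A.maxBid := by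
  calc ∑ l : Fin M, A.disc l * A.rankedBid S b r l ≤ ∑ _l : Fin M, A.maxBid :=
        Finset.sum_le_sum fun l _ => (mul_le_of_le_one_left (A.rankedBid_nonneg _ _ _ _)
          (A.disc_le_one l)).trans (A.rankedBid_le _ _ _ _)
    _ = M * A.maxBid := by simp

theorem abs_revenue_le (a : Action n) (b : Fin n → Fin (K + 1)) :
    |A.revenue a b| ≤ M * A.maxBid := by
  rw [abs_of_nonneg (A.revenue_nonneg a b)]
  exact (A.revenue_le a b).trans (A.sum_rankedBid_le _ _ _)

theorem abs_welfare_le (S : Finset (Fin n)) (b : Fin n → Fin (K + 1)) :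
    |A.welfare S b| ≤ M * A.maxBid := by
  rw [A.welfare_eq, abs_of_nonneg (Finset.sum_nonneg fun l _ =>
    mul_nonneg (A.disc_nonneg l) (A.rankedBid_nonneg _ _ _ _))]
  exact A.sum_rankedBid_le _ _ _

theorem gspPerf_le_lp1 [Fintype J] (q : PMF J) {m : ℕ} {π : Policy n K J}
    (hπ : A.Admissible q m π) : A.gspPerf q m π ≤ A.lp1 q := by
  refine A.perf_le_lp1 q hπ (fun e => A.abs_revenue_le e.act e.bids)
    (fun j a => A.assignment j a.called a.reserve)
    (fun j a => A.assignment_feasible j a.called a.reserve) fun j a => ?_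
  rw [expect_fintype, slotValue_assignment]
  exact Finset.sum_le_sum fun b _ =>
    mul_le_mul_of_nonneg_left (A.revenue_le a b) (A.bidLaw_nonneg j b)

theorem valPerf_le_lp1 [Fintype J] (q : PMF J) {m : ℕ} {π : Policy n K J}
    (hπ : A.Admissible q m π) : A.valPerf q m π ≤ A.lp1 q := by
  refine A.perf_le_lp1 q hπ (fun e => A.abs_welfare_le e.act.called e.bids)
    (fun j a => A.assignment j a.called 0)
    (fun j a => A.assignment_feasible j a.called 0) fun j a => ?_
  rw [expect_fintype, slotValue_assignment]
  exact le_rfl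

theorem optGSP_le_lp1 [Fintype J] (q : PMF J) (m : ℕ) : A.optGSP q m ≤ A.lp1 q := by
  refine Real.sSup_le ?_ (A.lp1_nonneg q)
  rintro v ⟨π, hπ, rfl⟩
  exact A.gspPerf_le_lp1 q hπ

theorem optVal_le_lp1 [Fintype J] (q : PMF J) (m : ℕ) : A.optVal q m ≤ A.lp1 q := by
  refine Real.sSup_le ?_ (A.lp1_nonneg q)
  rintro v ⟨π, hπ, rfl⟩
  exact A.valPerf_le_lp1 q hπ

end Exchange

/-! ### Independent samples -/

section Sample

variable {J : Type} (q : PMF J) {t : ℕ}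

/-- The probability that the sample of `t` impressions is `v`. -/
def sampleWeight (v : Fin t → J) : ℝ := ∏ r, (q (v r)).toReal

theorem sampleWeight_nonneg (v : Fin t → J) : 0 ≤ sampleWeight q v :=
  Finset.prod_nonneg fun _ _ => ENNReal.toReal_nonneg

variable [Fintype J]

theorem sum_sampleWeight_prod (g : J → ℝ) :
    ∑ v : Fin t → J, sampleWeight q v * ∏ r, g (v r) = (∑ j, (q j).toReal * g j) ^ t := by
  classical
  simp only [sampleWeight, ← Finset.prod_mul_distrib]
  rw [← Fintype.prod_sum fun (_ : Fin t) j => (q j).toReal * g j]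
  simp

theorem sum_sampleWeight : ∑ v : Fin t → J, sampleWeight q v = 1 := by
  have h := sum_sampleWeight_prod q (t := t) fun _ => 1
  simpa [sum_toReal] using h

/-- A Chernoff bound from a linear bound on the moment generating function. -/
theorem sample_tail_le {z : J → ℝ} {θ β a : ℝ}
    (hmgf : ∀ j, Real.exp (θ * z j) ≤ 1 + β * z j) (P : (Fin t → J) → Prop) [DecidablePred P]
    (hP : ∀ v, P v → t * (β * ∑ j, (q j).toReal * z j) + a ≤ θ * ∑ r, z (v r)) :
    ∑ v : Fin t → J, sampleWeight q v * (if P v then 1 else 0) ≤ Real.exp (-a) := by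
  set c := ∑ j, (q j).toReal * z j
  have h1 : ∀ v : Fin t → J, (if P v then (1 : ℝ) else 0)
      ≤ Real.exp (-(t * (β * c)) - a) * ∏ r, Real.exp (θ * z (v r)) := fun v => by
    rw [← Real.exp_sum, ← Real.exp_add, ← Finset.mul_sum]
    split_ifs with h
    · exact Real.one_le_exp (by linarith [hP v h])
    · exact (Real.exp_pos _).le
  have h2 : ∑ j, (q j).toReal * Real.exp (θ * z j) ≤ Real.exp (β * c) := by
    calc ∑ j, (q j).toReal * Real.exp (θ * z j) ≤ ∑ j, (q j).toReal * (1 + β * z j) :=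
          Finset.sum_le_sum fun j _ => mul_le_mul_of_nonneg_left (hmgf j) ENNReal.toReal_nonneg
      _ = β * c + 1 := by
          simp only [mul_add, mul_one, Finset.sum_add_distrib, sum_toReal, c, Finset.mul_sum]
          rw [add_comm]
          congr 1
          exact Finset.sum_congr rfl fun j _ => by ring
      _ ≤ _ := Real.add_one_le_exp _
  calc ∑ v : Fin t → J, sampleWeight q v * (if P v then 1 else 0)
      ≤ ∑ v : Fin t → J, Real.exp (-(t * (β * c)) - a) *
          (sampleWeight q v * ∏ r, Real.exp (θ * z (v r))) :=
        Finset.sum_le_sum fun v _ =>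
          (mul_le_mul_of_nonneg_left (h1 v) (sampleWeight_nonneg q v)).trans_eq (by ring)
    _ = Real.exp (-(t * (β * c)) - a) * (∑ j, (q j).toReal * Real.exp (θ * z j)) ^ t := by
        rw [← Finset.mul_sum, sum_sampleWeight_prod q fun j => Real.exp (θ * z j)]
    _ ≤ Real.exp (-(t * (β * c)) - a) * Real.exp (β * c) ^ t :=
        mul_le_mul_of_nonneg_left (pow_le_pow_left₀ (Finset.sum_nonneg fun j _ =>
          mul_nonneg ENNReal.toReal_nonneg (Real.exp_pos _).le) h2 t) (Real.exp_pos _).le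
    _ = Real.exp (-a) := by
        rw [← Real.exp_nat_mul, ← Real.exp_add]
        congr 1
        ring

theorem exp_le_one_add_two_mul {z : ℝ} (h0 : 0 ≤ z) (h1 : z ≤ 1) :
    Real.exp (1 * z) ≤ 1 + 2 * z := by
  have := (abs_le.1 (Real.abs_exp_sub_one_sub_id_le (x := z) (by rwa [abs_of_nonneg h0]))).2
  rw [one_mul]
  nlinarith

theorem exp_neg_half_le {z : ℝ} (h0 : 0 ≤ z) (h1 : z ≤ 1) :
    Real.exp (-(1 / 2) * z) ≤ 1 + -(1 / 4) * z := by
  have := (abs_le.1 (Real.abs_exp_sub_one_sub_id_le (x := -(1 / 2) * z)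
    (by rw [abs_mul, abs_of_nonneg h0]; norm_num; linarith))).2
  nlinarith

end Sample

namespace Exchange

variable {n M K : ℕ} {J : Type} [Fintype J] (A : Exchange n M K J)

/-- The expected frequency of call-outs of network `i`. -/
def trueRate (q : PMF J) (x : J → Fin n → ℝ) (i : Fin n) : ℝ := ∑ j, (q j).toReal * x j i

theorem abs_trueRate_sub_le (q : PMF J) {x x' : J → Fin n → ℝ} {i : Fin n} {e : ℝ}
    (h : ∀ j, |x j i - x' j i| ≤ e) : |trueRate q x i - trueRate q x' i| ≤ e := by
  unfold trueRate
  rw [← Finset.sum_sub_distrib]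
  calc |∑ j, ((q j).toReal * x j i - (q j).toReal * x' j i)| ≤ ∑ j, (q j).toReal * e := by
        refine (Finset.abs_sum_le_sum_abs _ _).trans (Finset.sum_le_sum fun j _ => ?_)
        rw [← mul_sub, abs_mul, abs_of_nonneg ENNReal.toReal_nonneg]
        exact mul_le_mul_of_nonneg_left (h j) ENNReal.toReal_nonneg
    _ = e := by rw [← Finset.sum_mul, sum_toReal, one_mul]

/-- The sampled and the true call-out rates agree up to constant factors and an additive error. -/
def RatesAgree (q : PMF J) {t : ℕ} (v : Fin t → J) (η₁ η₂ : ℝ) (x : J → Fin n → ℝ) (i : Fin n) :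
    Prop :=
  sampleRate v x i ≤ 2 * trueRate q x i + η₁ ∧ trueRate q x i ≤ 2 * sampleRate v x i + η₂

-- Two multiplicative Chernoff bounds. Because a factor 2 is tolerated, the exponent is linear in
-- `η`; this is why the number of samples grows like 1/η rather than 1/η².
open Classical in
theorem prob_not_ratesAgree_le (q : PMF J) {t : ℕ} (ht : 0 < t) {x : J → Fin n → ℝ} {i : Fin n}
    (hx : ∀ j, 0 ≤ x j i ∧ x j i ≤ 1) (η : ℝ) :
    ∑ v : Fin t → J, sampleWeight q v * (if RatesAgree q v η (4 * η) x i then 0 else 1)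
      ≤ 2 * Real.exp (-(t * η)) := by
  have ht' : (0 : ℝ) < t := Nat.cast_pos.2 ht
  have hmul : ∀ v : Fin t → J, ∑ r, x (v r) i = t * sampleRate v x i := fun v => by
    rw [sampleRate, ← mul_assoc, mul_one_div_cancel ht'.ne', one_mul]
  have hup := sample_tail_le q (t := t) (z := fun j => x j i) (θ := 1) (β := 2) (a := t * η)
    (fun j => exp_le_one_add_two_mul (hx j).1 (hx j).2)
    (fun v => 2 * trueRate q x i + η < sampleRate v x i) fun v hv => by
      rw [hmul]
      have := mul_le_mul_of_nonneg_left hv.le ht'.le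
      unfold trueRate at this
      linarith
  have hlo := sample_tail_le q (t := t) (z := fun j => x j i) (θ := -(1 / 2)) (β := -(1 / 4))
    (a := t * η) (fun j => exp_neg_half_le (hx j).1 (hx j).2)
    (fun v => 2 * sampleRate v x i + 4 * η < trueRate q x i) fun v hv => by
      rw [hmul]
      have := mul_le_mul_of_nonneg_left hv.le ht'.le
      unfold trueRate at this
      linarith
  rw [two_mul]
  refine le_trans ?_ (add_le_add hup hlo)
  rw [← Finset.sum_add_distrib]
  refine Finset.sum_le_sum fun v _ => ?_
  rw [← mul_add]
  refine mul_le_mul_of_nonneg_left ?_ (sampleWeight_nonneg q v)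
  by_cases h1 : 2 * trueRate q x i + η < sampleRate v x i
  · rw [if_pos h1]
    split_ifs <;> norm_num
  · by_cases h2 : 2 * sampleRate v x i + 4 * η < trueRate q x i
    · rw [if_pos h2]
      split_ifs <;> norm_num
    · rw [if_pos ⟨not_lt.1 h1, not_lt.1 h2⟩, if_neg h1, if_neg h2]
      norm_num

variable {A} in
theorem RatesAgree.of_close {q : PMF J} {t : ℕ} {v : Fin t → J} {η₁ η₂ e : ℝ}
    {x x' : J → Fin n → ℝ} {i : Fin n} (h : RatesAgree q v η₁ η₂ x' i) (he : 0 ≤ e)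
    (hx : ∀ j, |x j i - x' j i| ≤ e) : RatesAgree q v (η₁ + 3 * e) (η₂ + 3 * e) x i := by
  have h1 := abs_le.1 (abs_sampleRate_sub_le v he hx)
  have h2 := abs_le.1 (abs_trueRate_sub_le q hx)
  constructor
  · linarith [h.1, h1.2, h2.1]
  · linarith [h.2, h1.1, h2.2]

/-- Every point of `[0, L]` is close to a point of the grid of mesh `L / N`. -/
theorem exists_grid_close {L : ℝ} (hL : 0 ≤ L) {N : ℕ} (hN : 0 < N) {u : ℝ} (h0 : 0 ≤ u)
    (h1 : u ≤ L) : ∃ g : Fin (N + 1), |u - L * (g : ℕ) / N| ≤ L / N := by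
  have hN' : (0 : ℝ) < N := Nat.cast_pos.2 hN
  rcases hL.eq_or_lt with rfl | hL
  · exact ⟨0, by simp [le_antisymm h1 h0]⟩
  have hr : 0 ≤ u * N / L := by positivity
  have hle : u * N / L ≤ N := by
    rw [div_le_iff₀ hL]
    nlinarith
  have hfl : ⌊u * N / L⌋₊ < N + 1 :=
    Nat.lt_succ_of_le (Nat.cast_le.1 ((Nat.floor_le hr).trans hle))
  refine ⟨⟨_, hfl⟩, ?_⟩
  have h2 := Nat.floor_le hr
  have h3 := (Nat.lt_floor_add_one (u * N / L)).le
  have h4 : u - L * (⌊u * N / L⌋₊ : ℝ) / N = (L / N) * (u * N / L - ⌊u * N / L⌋₊) := by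
    field_simp
  have h5 : 0 ≤ L / N := by positivity
  rw [h4, abs_mul, abs_of_nonneg h5, abs_of_nonneg (by linarith)]
  exact mul_le_of_le_one_right h5 (by linarith)

/-- With high probability, the sampled and the true call-out rates agree for all multipliers. -/
theorem exists_good_samples (q : PMF J) {σ : ℝ} (hσ : 0 < σ) {t : ℕ} (ht : 0 < t) {N : ℕ}
    (hN : 0 < N) (η : ℝ) :
    ∃ G : (Fin t → J) → Prop, (∀ [DecidablePred G],
      1 - 2 * n * (N + 1) ^ n * Real.exp (-(t * η))
        ≤ ∑ v, sampleWeight q v * if G v then 1 else 0) ∧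
      ∀ v, G v → ∀ lam, (∀ i, 0 ≤ lam i) → ∀ x, (∀ j, A.IsLP2Optimal σ j lam (x j)) → ∀ i,
        RatesAgree q v (η + 3 * (2 * n * (A.maxBid / N) / σ))
          (4 * η + 3 * (2 * n * (A.maxBid / N) / σ)) x i := by
  classical
  -- Solutions at the grid points are fixed before the sample is seen, so finitely many Chernoff
  -- bounds suffice; Lipschitz continuity covers the data-dependent multipliers.
  choose x' hx' using fun (g : Fin n → Fin (N + 1)) (j : J) =>
    A.exists_isLP2Optimal σ j fun i => A.maxBid * (g i : ℕ) / N
  refine ⟨fun v => ∀ g i, RatesAgree q v η (4 * η) (x' g) i, ?_, fun v hv lam hlam x hx i => ?_⟩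
  · intro hdec
    have h1 : ∀ v : Fin t → J, 1 - ∑ g, ∑ i, (if RatesAgree q v η (4 * η) (x' g) i then 0 else 1)
        ≤ (if ∀ g i, RatesAgree q v η (4 * η) (x' g) i then (1 : ℝ) else 0) := fun v => by
      by_cases h : ∀ g i, RatesAgree q v η (4 * η) (x' g) i
      · rw [if_pos h]
        refine sub_le_self _ (Finset.sum_nonneg fun g _ => Finset.sum_nonneg fun i _ => ?_)
        split_ifs <;> norm_num
      · rw [if_neg h, sub_nonpos]
        push Not at h
        obtain ⟨g, i, hgi⟩ := h
        have hnn : ∀ g i, 0 ≤ (if RatesAgree q v η (4 * η) (x' g) i then (0 : ℝ) else 1) :=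
          fun g i => by split_ifs <;> norm_num
        calc (1 : ℝ) = if RatesAgree q v η (4 * η) (x' g) i then 0 else 1 := (if_neg hgi).symm
          _ ≤ ∑ i, if RatesAgree q v η (4 * η) (x' g) i then 0 else 1 :=
            Finset.single_le_sum (fun i _ => hnn g i) (Finset.mem_univ i)
          _ ≤ _ := Finset.single_le_sum
            (f := fun g => ∑ i, if RatesAgree q v η (4 * η) (x' g) i then (0 : ℝ) else 1)
            (fun g _ => Finset.sum_nonneg fun i _ => hnn g i) (Finset.mem_univ g)
    calc 1 - 2 * n * (N + 1) ^ n * Real.exp (-(t * η))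
        = 1 - ∑ _g : Fin n → Fin (N + 1), ∑ _i : Fin n, 2 * Real.exp (-(t * η)) := by
          simp only [Finset.sum_const, Finset.card_univ, Fintype.card_fin, Fintype.card_pi,
            Finset.prod_const, nsmul_eq_mul]
          push_cast
          ring
      _ ≤ 1 - ∑ g, ∑ i, ∑ v : Fin t → J, sampleWeight q v *
            (if RatesAgree q v η (4 * η) (x' g) i then 0 else 1) :=
          sub_le_sub_left (Finset.sum_le_sum fun g _ => Finset.sum_le_sum fun i _ =>
            prob_not_ratesAgree_le q ht (fun j => (hx' g j).mem i) η) _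
      _ = ∑ v : Fin t → J, sampleWeight q v *
            (1 - ∑ g, ∑ i, (if RatesAgree q v η (4 * η) (x' g) i then 0 else 1)) := by
          simp only [mul_sub, mul_one, Finset.sum_sub_distrib, sum_sampleWeight, Finset.mul_sum]
          congr 1
          rw [Finset.sum_comm]
          rw [Finset.sum_congr rfl fun i _ => Finset.sum_comm]
          rw [Finset.sum_comm]
          exact Finset.sum_congr rfl fun v _ => Finset.sum_comm
      _ ≤ _ := Finset.sum_le_sum fun v _ =>
          (mul_le_mul_of_nonneg_left (h1 v) (sampleWeight_nonneg q v)).trans_eq (by congr)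
  · choose g hg using fun i => exists_grid_close A.maxBid_nonneg hN
      (le_min (hlam i) A.maxBid_nonneg) (min_le_right (lam i) A.maxBid)
    have := A.maxBid_nonneg
    refine (hv g i).of_close (by positivity) fun j => ?_
    exact ((hx j).truncate hσ.le).abs_sub_le hσ (hx' g j) hg i

variable {n M K : ℕ} {J : Type} (A : Exchange n M K J)

/-! ### Randomized rounding of call-outs -/

/-- The same contention resolution, now over the random selection. The value is kept network by
network, so any set `T` of available networks may be imposed afterwards. -/
theorem half_netValue_le_lpSet {j : J} {x : Fin n → ℝ} {y : Fin n → Fin (K + 1) → Fin M → ℝ}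
    (h : A.Feasible j x y) (T : Fin n → Prop) [DecidablePred T] :
    1 / 2 * ∑ i, (if T i then A.netValue A.disc y i else 0)
      ≤ ∑ S, (randomSubset x S).toReal * A.lpSet A.disc j (S.filter T) := by
  obtain ⟨hslot, hx, hnet, hy0⟩ := h
  let β : Fin n → Fin (K + 1) → Fin M → ℝ := fun i k l => y i k l / x i
  have hβ0 : ∀ i k l, 0 ≤ β i k l := fun i k l => div_nonneg (hy0 i k l) (hx i).1
  have hrow : ∀ i k, ∑ l, β i k l ≤ (A.p i j k).toReal := fun i k => by
    simp only [β]
    rw [← Finset.sum_div]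
    exact div_le_of_le_mul₀ (hx i).1 ENNReal.toReal_nonneg (hnet i k)
  have hxβ : ∀ i k l, x i * β i k l = y i k l := fun i k l => by
    rcases (hx i).1.eq_or_lt with h0 | h0
    · have h1 := hnet i k
      rw [← h0, mul_zero] at h1
      have h2 : y i k l ≤ 0 := (Finset.single_le_sum (f := fun l => y i k l)
        (fun l _ => hy0 i k l) (Finset.mem_univ l)).trans h1
      rw [← h0, zero_mul]
      exact le_antisymm (hy0 i k l) h2
    · exact mul_div_cancel₀ _ h0.ne'
  let a : Fin n → Fin M → ℝ := fun i l => ∑ k, β i k l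
  have ha0 : ∀ i l, 0 ≤ a i l := fun i l => Finset.sum_nonneg fun k _ => hβ0 i k l
  have ha1 : ∀ i l, a i l ≤ 1 := fun i l => by
    rw [← sum_toReal (A.p i j)]
    refine Finset.sum_le_sum fun k _ => le_trans ?_ (hrow i k)
    exact Finset.single_le_sum (f := fun l => β i k l) (fun l _ => hβ0 i k l) (Finset.mem_univ l)
  have hxa : ∀ i l, x i * a i l = ∑ k, y i k l := fun i l => by
    simp only [a, Finset.mul_sum, hxβ]
  -- All selected networks count here, available or not: a larger divisor stays feasible, and the
  -- mean does not depend on `T`.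
  let Z : Finset (Fin n) → Fin n → Fin M → ℝ := fun S i l => ∑ i' ∈ S.erase i, a i' l
  have hZ0 : ∀ S i l, 0 ≤ Z S i l := fun S i l => Finset.sum_nonneg fun i' _ => ha0 _ _
  have hinv0 : ∀ S i l, 0 ≤ 1 / (1 + Z S i l) := fun S i l =>
    one_div_nonneg.2 (by linarith [hZ0 S i l])
  have hinv1 : ∀ S i l, 1 / (1 + Z S i l) ≤ 1 := fun S i l => by
    rw [div_le_one (by linarith [hZ0 S i l])]
    linarith [hZ0 S i l]
  let y' : Finset (Fin n) → Fin n → Fin (K + 1) → Fin M → ℝ := fun S i k l =>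
    if i ∈ S.filter T then β i k l * (1 / (1 + Z S i l)) else 0
  have hy'0 : ∀ S i k l, 0 ≤ y' S i k l := fun S i k l => by
    simp only [y']
    split_ifs
    exacts [mul_nonneg (hβ0 i k l) (hinv0 S i l), le_rfl]
  have hfeas : ∀ S, A.Feasible j (fun i => if i ∈ S.filter T then 1 else 0) (y' S) := fun S => by
    refine ⟨fun l => ?_, fun i => ?_, fun i k => ?_, hy'0 S⟩
    · refine le_trans ?_ (sum_div_one_add_le S (a := fun i => a i l) (fun i _ => ha0 i l)
        fun i _ => ha1 i l)
      rw [← Finset.sum_subset (Finset.subset_univ S)]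
      · refine Finset.sum_le_sum fun i _ => ?_
        simp only [a]
        rw [Finset.sum_mul]
        refine Finset.sum_le_sum fun k _ => ?_
        simp only [y']
        split_ifs
        exacts [le_rfl, mul_nonneg (hβ0 i k l) (hinv0 S i l)]
      · intro i _ hi
        exact Finset.sum_eq_zero fun k _ => if_neg fun hm => hi (Finset.mem_filter.1 hm).1
    · beta_reduce
      split_ifs <;> norm_num
    · by_cases hi : i ∈ S.filter T
      · simp only [y', if_pos hi, mul_one]
        exact (Finset.sum_le_sum fun l _ => mul_le_of_le_one_right (hβ0 i k l)
          (hinv1 S i l)).trans (hrow i k)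
      · have h0 : ∑ l, y' S i k l = 0 := Finset.sum_eq_zero fun l _ => if_neg hi
        beta_reduce
        rw [h0, if_neg hi, mul_zero]
  have hkey : ∀ i l, x i / 2 ≤ ∑ S, (randomSubset x S).toReal *
      if i ∈ S then 1 / (1 + Z S i l) else 0 := fun i l => by
    have e1 : ∑ S, (randomSubset x S).toReal * (if i ∈ S then (1 : ℝ) else 0) = x i := by
      have := sum_randomSubset_superset hx {i}
      simpa only [Finset.singleton_subset_iff, Finset.prod_singleton] using this
    have e2 : ∀ i' ∈ Finset.univ.erase i, ∑ S, (randomSubset x S).toReal *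
        (if i ∈ S then if i' ∈ S then a i' l else 0 else 0) = x i * ∑ k, y i' k l := by
      intro i' hi'
      have h1 := sum_randomSubset_superset hx {i, i'}
      rw [Finset.prod_pair (Finset.ne_of_mem_erase hi').symm] at h1
      rw [← hxa i' l, ← mul_assoc, ← h1, Finset.sum_mul]
      refine Finset.sum_congr rfl fun S _ => ?_
      simp only [Finset.insert_subset_iff, Finset.singleton_subset_iff]
      by_cases h2 : i ∈ S <;> by_cases h3 : i' ∈ S <;> simp [h2, h3]
    have e3 : ∀ S, (if i ∈ S then Z S i l else 0)
        = ∑ i' ∈ Finset.univ.erase i, if i ∈ S then if i' ∈ S then a i' l else 0 else 0 := by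
      intro S
      split_ifs with hi
      · simp only [Z]
        rw [← Finset.sum_filter]
        refine Finset.sum_congr ?_ fun _ _ => rfl
        ext i'
        simp [and_comm]
      · simp
    have e4 : ∑ S, (randomSubset x S).toReal * (if i ∈ S then Z S i l else 0) ≤ x i := by
      simp only [e3, Finset.mul_sum]
      rw [Finset.sum_comm]
      rw [Finset.sum_congr rfl e2, ← Finset.mul_sum]
      refine mul_le_of_le_one_right (hx i).1 ?_
      exact (Finset.sum_le_sum_of_subset_of_nonneg (Finset.erase_subset _ _)
        fun i' _ _ => Finset.sum_nonneg fun k _ => hy0 _ _ _).trans (hslot l)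
    calc x i / 2 ≤ 3 / 4 * ∑ S, (randomSubset x S).toReal * (if i ∈ S then (1 : ℝ) else 0)
          - 1 / 4 * ∑ S, (randomSubset x S).toReal * (if i ∈ S then Z S i l else 0) := by
          rw [e1]; linarith
      _ = ∑ S, (randomSubset x S).toReal * (if i ∈ S then 3 / 4 - Z S i l / 4 else 0) := by
          rw [Finset.mul_sum, Finset.mul_sum, ← Finset.sum_sub_distrib]
          refine Finset.sum_congr rfl fun S _ => ?_
          split_ifs <;> ring
      _ ≤ _ := Finset.sum_le_sum fun S _ => mul_le_mul_of_nonneg_left (by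
          split_ifs
          exacts [inv_one_add_ge (hZ0 S i l), le_rfl]) ENNReal.toReal_nonneg
  have hval : ∀ S, A.slotValue A.disc (y' S) = ∑ i, ∑ l, (if T i then
      A.disc l * (∑ k, A.bid k * β i k l) * (if i ∈ S then 1 / (1 + Z S i l) else 0) else 0) := by
    intro S
    refine Finset.sum_congr rfl fun i _ => ?_
    rw [Finset.sum_comm]
    refine Finset.sum_congr rfl fun l _ => ?_
    by_cases hT : T i <;> by_cases hS : i ∈ S
    · simp only [y', Finset.mem_filter, hT, hS, and_self, if_true, Finset.mul_sum, Finset.sum_mul]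
      exact Finset.sum_congr rfl fun k _ => by ring
    all_goals simp [y', hT, hS]
  calc 1 / 2 * ∑ i, (if T i then A.netValue A.disc y i else 0)
      = ∑ i, ∑ l, (if T i then A.disc l * (∑ k, A.bid k * β i k l) * (x i / 2) else 0) := by
        rw [Finset.mul_sum]
        refine Finset.sum_congr rfl fun i _ => ?_
        split_ifs
        · rw [netValue, Finset.sum_comm, Finset.mul_sum]
          refine Finset.sum_congr rfl fun l _ => ?_
          simp only [Finset.mul_sum, Finset.sum_mul]
          refine Finset.sum_congr rfl fun k _ => ?_
          rw [← hxβ i k l]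
          ring
        · simp
    _ ≤ ∑ i, ∑ l, ∑ S, (randomSubset x S).toReal * (if T i then
          A.disc l * (∑ k, A.bid k * β i k l) * (if i ∈ S then 1 / (1 + Z S i l) else 0)
          else 0) := by
        refine Finset.sum_le_sum fun i _ => Finset.sum_le_sum fun l _ => ?_
        split_ifs
        · refine (mul_le_mul_of_nonneg_left (hkey i l) (mul_nonneg (A.disc_nonneg l)
            (Finset.sum_nonneg fun k _ => mul_nonneg (A.bid_nonneg k) (hβ0 i k l)))).trans_eq ?_
          rw [Finset.mul_sum (s := Finset.univ)
            (f := fun S => (randomSubset x S).toReal * if i ∈ S then 1 / (1 + Z S i l) else 0)]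
          exact Finset.sum_congr rfl fun S _ => by ring
        · simp
    _ = ∑ S, (randomSubset x S).toReal * A.slotValue A.disc (y' S) := by
        simp only [hval]
        simp only [Finset.mul_sum (s := (Finset.univ : Finset (Fin n))),
          Finset.mul_sum (s := (Finset.univ : Finset (Fin M)))]
        rw [Finset.sum_congr rfl fun i _ => Finset.sum_comm]
        exact Finset.sum_comm
    _ ≤ _ := Finset.sum_le_sum fun S _ => mul_le_mul_of_nonneg_left
        (A.le_lpSet A.disc_le_one (hfeas S)) ENNReal.toReal_nonneg

/-! ### The sample in a run -/

/-- The first `t` impressions of a run. -/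
def firstImps {t : ℕ} (h : List (Record n K J)) (hl : t ≤ h.length) : Fin t → J :=
  fun r => (h.get (r.castLE hl)).imp

/-- A function of the first `t` impressions of a run. -/
def onSample {t : ℕ} (g : (Fin t → J) → ℝ) (h : List (Record n K J)) : ℝ :=
  if hl : t ≤ h.length then g (firstImps h hl) else 0

theorem firstImps_append {t : ℕ} {h : List (Record n K J)} (hl : t ≤ h.length)
    (e : Record n K J) (hl' : t ≤ (h ++ [e]).length) : firstImps (h ++ [e]) hl' = firstImps h hl := by
  funext r
  have hr : (r : ℕ) < h.length := r.2.trans_le hl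
  simp [firstImps, List.getElem_append_left, hr]

theorem onSample_eq {t : ℕ} (g : (Fin t → J) → ℝ) {h : List (Record n K J)}
    (hl : t ≤ h.length) : onSample g h = g (firstImps h hl) := dif_pos hl

theorem onSample_append {t : ℕ} (g : (Fin t → J) → ℝ) {h : List (Record n K J)}
    (hl : t ≤ h.length) (e : Record n K J) : onSample g (h ++ [e]) = onSample g h := by
  have hl' : t ≤ (h ++ [e]).length := by simp; omega
  rw [onSample_eq g hl, onSample_eq g hl', firstImps_append hl]

theorem abs_onSample_le [Fintype J] {t : ℕ} (g : (Fin t → J) → ℝ) (h : List (Record n K J)) :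
    |onSample g h| ≤ ∑ v, |g v| := by
  classical
  unfold onSample
  split_ifs with hl
  · exact Finset.single_le_sum (f := fun v => |g v|) (fun _ _ => abs_nonneg _)
      (Finset.mem_univ _)
  · rw [abs_zero]
    exact Finset.sum_nonneg fun _ _ => abs_nonneg _

theorem bddOn_onSample [Fintype J] {t : ℕ} (g : (Fin t → J) → ℝ)
    (p : PMF (List (Record n K J))) : BddOn p (onSample g) :=
  BddOn.of_le fun h => abs_onSample_le g h

/-- The impressions are independent draws from q whatever the policy does. -/
theorem expect_onSample [Fintype J] (q : PMF J) (π : Policy n K J) {t : ℕ}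
    (g : (Fin t → J) → ℝ) :
    expect (A.runLaw q π t) (onSample g) = ∑ v, sampleWeight q v * g v := by
  classical
  induction t with
  | zero =>
    rw [runLaw, expect_pure, onSample_eq g (Nat.zero_le _)]
    simp only [Finset.univ_unique, Finset.sum_singleton, sampleWeight, Finset.univ_eq_empty,
      Finset.prod_empty, one_mul]
    exact congrArg g (Subsingleton.elim _ _)
  | succ t ih =>
    have h1 : expect (A.runLaw q π (t + 1)) (onSample g) = expect (A.runLaw q π t)
        (onSample fun v => ∑ j, (q j).toReal * g (Fin.snoc (α := fun _ => J) v j)) := by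
      rw [A.expect_runLaw_succ (bddOn_onSample g _)]
      refine expect_congr fun h hh => ?_
      have hlen := A.length_of_mem_support hh
      rw [onSample_eq _ hlen.ge, ← expect_fintype q fun j =>
        g (Fin.snoc (α := fun _ => J) (firstImps h hlen.ge) j)]
      have h2 : ∀ e : Record n K J, onSample g (h ++ [e])
          = g (Fin.snoc (α := fun _ => J) (firstImps h hlen.ge) e.imp) := fun e => by
        rw [onSample_eq g (by simp [hlen])]
        congr 1
        funext r
        refine Fin.lastCases ?_ (fun r => ?_) r
        · simp [firstImps, ← hlen]
        · have hr : (r : ℕ) < h.length := r.2.trans_eq hlen.symm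
          simp [firstImps, List.getElem_append_left, hr]
      simp only [h2, stepExpect, expect_const]
    rw [h1, ih]
    rw [← Fintype.sum_equiv (Fin.snocEquiv fun _ : Fin (t + 1) => J)
      (fun z => sampleWeight q z.2 * ((q z.1).toReal * g (Fin.snoc (α := fun _ => J) z.2 z.1)))
      (fun v => sampleWeight q v * g v)]
    · rw [Fintype.sum_prod_type, Finset.sum_comm]
      exact Finset.sum_congr rfl fun v _ => Finset.mul_sum _ _ _
    · rintro ⟨j, v⟩
      have h2 : Fin.snocEquiv (fun _ : Fin (t + 1) => J) (j, v)
          = Fin.snoc (α := fun _ => J) v j := rfl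
      rw [h2]
      simp only [sampleWeight, Fin.prod_univ_castSucc, Fin.snoc_castSucc,
        Fin.snoc_last]
      ring

theorem expect_onSample_of_le [Fintype J] (q : PMF J) (π : Policy n K J) {t s : ℕ} (hs : t ≤ s)
    (g : (Fin t → J) → ℝ) :
    expect (A.runLaw q π s) (onSample g) = ∑ v, sampleWeight q v * g v := by
  induction s, hs using Nat.le_induction with
  | base => exact A.expect_onSample q π g
  | succ s hs ih =>
    rw [A.expect_runLaw_succ (bddOn_onSample g _), ← ih]
    refine expect_congr fun h hh => ?_
    have hlen : t ≤ h.length := (A.length_of_mem_support hh).symm ▸ hs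
    simp only [onSample_append g hlen, stepExpect_const]

/-! ### Call-outs of LP-GSP -/

theorem gspAction_called (j : J) (S : Finset (Fin n)) : (A.gspAction j S).called = S := by
  unfold gspAction
  split_ifs <;> rfl

theorem calls_append (h : List (Record n K J)) (e : Record n K J) (i : Fin n) :
    (calls ((h ++ [e]).map Record.observe) i : ℝ)
      = calls (h.map Record.observe) i + if i ∈ e.act.called then 1 else 0 := by
  simp only [calls, List.map_append, List.countP_append, List.map_cons, List.map_nil,
    List.countP_cons, List.countP_nil, Record.observe]
  split_ifs <;> simp_all

variable {A} {σ : ℝ} {t : ℕ} (R : A.LPValRun σ t)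

theorem lpVal_of_le (m : ℕ) {h : List (Record n K J)} (hl : t ≤ h.length) (j : J) :
    A.lpVal R m (h.map Record.observe) j
      = (randomSubset (R.x (firstImps h hl) j)).map fun S =>
        S.filter fun i => (calls (h.map Record.observe) i : ℝ) + 1 ≤ A.rate i * m := by
  have hl' : t ≤ (h.map Record.observe).length := by simpa using hl
  unfold lpVal
  rw [dif_pos hl']
  have : (fun r : Fin t => ((h.map Record.observe).get (r.castLE hl')).imp) = firstImps h hl := by
    funext r
    simp [firstImps, Record.observe]
  rw [this]

theorem lpVal_of_lt (m : ℕ) {h : List (Record n K J)} (hl : h.length < t) (j : J) :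
    A.lpVal R m (h.map Record.observe) j = PMF.pure ∅ := by
  unfold lpVal
  rw [dif_neg (by simpa using hl)]

theorem lpGSP_map_called (m : ℕ) (h : List (Obs n K J)) (j : J) :
    (A.lpGSP R m h j).map Action.called = A.lpVal R m h j := by
  unfold lpGSP
  rw [PMF.map_comp]
  have : Action.called ∘ A.gspAction j = id := by
    funext S
    exact A.gspAction_called j S
  rw [this, PMF.map_id]

theorem mem_support_lpGSP {m : ℕ} {h : List (Obs n K J)} {j : J} {a : Action n}
    (ha : a ∈ (A.lpGSP R m h j).support) : a.called ∈ (A.lpVal R m h j).support := by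
  rw [← lpGSP_map_called]
  exact (PMF.mem_support_map_iff _ _ _).2 ⟨a, ha, rfl⟩

theorem lpGSP_calls_le (q : PMF J) (m s : ℕ) :
    ∀ h ∈ (A.runLaw q (A.lpGSP R m) s).support, ∀ i,
      (calls (h.map Record.observe) i : ℝ) ≤ A.rate i * m := by
  induction s with
  | zero =>
    intro h hh i
    rw [runLaw, PMF.mem_support_pure_iff] at hh
    subst hh
    simpa [calls] using mul_nonneg (A.rate_nonneg i) (Nat.cast_nonneg m)
  | succ s ih =>
    intro h hh i
    simp only [runLaw, PMF.mem_support_bind_iff, PMF.mem_support_pure_iff] at hh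
    obtain ⟨h', hh', j, -, a, ha, b, -, rfl⟩ := hh
    rw [calls_append]
    have ha' := mem_support_lpGSP R ha
    dsimp only
    split_ifs with hi
    · rcases le_or_gt t h'.length with hl | hl
      · rw [lpVal_of_le R m hl, PMF.mem_support_map_iff] at ha'
        obtain ⟨S, -, hS⟩ := ha'
        rw [← hS] at hi
        exact (Finset.mem_filter.1 hi).2
      · rw [lpVal_of_lt R m hl, PMF.mem_support_pure_iff] at ha'
        rw [ha'] at hi
        exact absurd hi (Finset.notMem_empty i)
    · rw [add_zero]
      exact ih h' hh' i

theorem lpGSP_calls_eq_zero (q : PMF J) (m s : ℕ) (hs : s ≤ t) :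
    ∀ h ∈ (A.runLaw q (A.lpGSP R m) s).support, ∀ i,
      (calls (h.map Record.observe) i : ℝ) = 0 := by
  induction s with
  | zero =>
    intro h hh i
    rw [runLaw, PMF.mem_support_pure_iff] at hh
    subst hh
    simp [calls]
  | succ s ih =>
    intro h hh i
    simp only [runLaw, PMF.mem_support_bind_iff, PMF.mem_support_pure_iff] at hh
    obtain ⟨h', hh', j, -, a, ha, b, -, rfl⟩ := hh
    have ha' := mem_support_lpGSP R ha
    rw [lpVal_of_lt R m ((A.length_of_mem_support hh').trans_lt hs),
      PMF.mem_support_pure_iff] at ha'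
    rw [calls_append, ih (by omega) h' hh' i, ha']
    simp

theorem expect_lpGSP (m : ℕ) {h : List (Record n K J)} (hl : t ≤ h.length) (j : J)
    (f : Action n → ℝ) :
    expect (A.lpGSP R m (h.map Record.observe) j) f
      = ∑ S, (randomSubset (R.x (firstImps h hl) j) S).toReal * f (A.gspAction j (S.filter fun i =>
        (calls (h.map Record.observe) i : ℝ) + 1 ≤ A.rate i * m)) := by
  unfold lpGSP
  rw [expect_map _ _ (BddOn.of_finite _), lpVal_of_le R m hl, expect_map _ _ (BddOn.of_finite _),
    expect_fintype]

theorem bddOn_calls (q : PMF J) (m s : ℕ) (i : Fin n) :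
    BddOn (A.runLaw q (A.lpGSP R m) s) fun h => (calls (h.map Record.observe) i : ℝ) :=
  ⟨A.rate i * m, fun h hh => by
    rw [abs_of_nonneg (Nat.cast_nonneg _)]
    exact lpGSP_calls_le R q m s h hh i⟩

variable [Fintype J]

theorem stepExpect_called_le (q : PMF J) (m : ℕ) {h : List (Record n K J)} (hl : t ≤ h.length)
    (i : Fin n) :
    A.stepExpect q (A.lpGSP R m) h (fun e => if i ∈ e.act.called then 1 else 0)
      ≤ trueRate q (R.x (firstImps h hl)) i := by
  unfold stepExpect trueRate
  rw [expect_fintype]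
  refine Finset.sum_le_sum fun j _ => mul_le_mul_of_nonneg_left ?_ ENNReal.toReal_nonneg
  have hx := (R.x_opt (firstImps h hl) j).mem
  have e1 := sum_randomSubset_superset hx {i}
  rw [Finset.prod_singleton] at e1
  rw [← e1, expect_lpGSP R m hl]
  refine Finset.sum_le_sum fun S _ => mul_le_mul_of_nonneg_left ?_ ENNReal.toReal_nonneg
  refine (expect_const (A.bidLaw j) (if i ∈ (A.gspAction j (S.filter fun i =>
    (calls (h.map Record.observe) i : ℝ) + 1 ≤ A.rate i * m)).called then 1 else 0)).trans_le ?_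
  simp only [gspAction_called, Finset.mem_filter, Finset.singleton_subset_iff]
  split_ifs with h1 h2 h2
  · exact le_rfl
  · exact absurd h1.1 h2
  · exact zero_le_one
  · exact le_rfl

/-- No calls occur during the sample, and each later arrival adds a call with conditional
probability at most the true rate. The weight `g` replaces conditioning on the sample. -/
theorem expect_onSample_mul_calls_le (q : PMF J) (m : ℕ) {g : (Fin t → J) → ℝ}
    (hg : ∀ v, 0 ≤ g v) (i : Fin n) (s : ℕ) :
    expect (A.runLaw q (A.lpGSP R m) (t + s))
        (fun h => onSample g h * calls (h.map Record.observe) i)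
      ≤ s * ∑ v, sampleWeight q v * (g v * trueRate q (R.x v) i) := by
  induction s with
  | zero =>
    rw [Nat.cast_zero, zero_mul, add_zero]
    refine le_of_eq ?_
    rw [← expect_const (A.runLaw q (A.lpGSP R m) t) 0]
    refine expect_congr fun h hh => ?_
    rw [lpGSP_calls_eq_zero R q m t le_rfl h hh i, mul_zero]
  | succ s ih =>
    have hb : ∀ s', BddOn (A.runLaw q (A.lpGSP R m) s')
        fun h => onSample g h * calls (h.map Record.observe) i := fun s' =>
      (bddOn_onSample g _).mul (bddOn_calls R q m s' i)
    rw [← add_assoc, A.expect_runLaw_succ (hb (t + s + 1))]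
    have h1 : ∀ h ∈ (A.runLaw q (A.lpGSP R m) (t + s)).support,
        A.stepExpect q (A.lpGSP R m) h
          (fun e => onSample g (h ++ [e]) * calls ((h ++ [e]).map Record.observe) i)
        ≤ onSample g h * calls (h.map Record.observe) i
          + onSample (fun v => g v * trueRate q (R.x v) i) h := fun h hh => by
      have hl : t ≤ h.length := by rw [A.length_of_mem_support hh]; omega
      simp only [onSample_append g hl, calls_append, mul_add]
      rw [A.stepExpect_add (B := |onSample g h * calls (h.map Record.observe) i|)
        (B' := |onSample g h|) (fun _ => le_rfl) (fun e => by split_ifs <;> simp),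
        stepExpect_const, stepExpect_const_mul, onSample_eq g hl, onSample_eq _ hl]
      exact add_le_add_right (mul_le_mul_of_nonneg_left (stepExpect_called_le R q m hl i) (hg _)) _
    refine (expect_mono ?_ ((hb _).add (bddOn_onSample _ _)) h1).trans ?_
    · have h2 := hb (t + s + 1)
      rw [runLaw] at h2
      obtain ⟨B, hB⟩ := h2
      refine ⟨B, fun h hh => ?_⟩
      refine abs_expect_le fun j hj => abs_expect_le fun a ha => abs_expect_le fun b hb' => ?_
      exact hB _ (mem_support_bind hh (mem_support_bind hj (mem_support_bind ha
        (mem_support_bind hb' (PMF.mem_support_pure_iff _ _ |>.2 rfl)))))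
    · rw [expect_add (hb _) (bddOn_onSample _ _), A.expect_onSample_of_le q _ (Nat.le_add_right t s)]
      push_cast
      linarith

/-- Rounding (1/2) times auction (1/39). Given the history, the available networks are fixed and the
new impression, selection and bids are fresh. -/
theorem stepExpect_revenue_ge (hA : A.MHR) (q : PMF J) (m : ℕ) {h : List (Record n K J)}
    (hl : t ≤ h.length) {y : J → Fin n → Fin (K + 1) → Fin M → ℝ}
    (hy : ∀ j, A.Feasible j (R.x (firstImps h hl) j) (y j)) :
    1 / 78 * ∑ i, (if (calls (h.map Record.observe) i : ℝ) + 1 ≤ A.rate i * m then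
        ∑ j, (q j).toReal * A.netValue A.disc (y j) i else 0)
      ≤ A.stepExpect q (A.lpGSP R m) h fun e => A.revenue e.act e.bids := by
  unfold stepExpect
  rw [expect_fintype]
  have h1 : ∀ j, 1 / 78 * ∑ i, (if (calls (h.map Record.observe) i : ℝ) + 1 ≤ A.rate i * m then
      A.netValue A.disc (y j) i else 0) ≤ expect (A.lpGSP R m (h.map Record.observe) j) fun a =>
        expect (A.bidLaw j) fun b => A.revenue a b := fun j => by
    rw [expect_lpGSP R m hl]
    have h2 := A.half_netValue_le_lpSet (hy j)
      fun i => (calls (h.map Record.observe) i : ℝ) + 1 ≤ A.rate i * m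
    calc _ = 1 / 39 * (1 / 2 * ∑ i, (if (calls (h.map Record.observe) i : ℝ) + 1 ≤ A.rate i * m then
          A.netValue A.disc (y j) i else 0)) := by ring
      _ ≤ 1 / 39 * _ := mul_le_mul_of_nonneg_left h2 (by norm_num)
      _ ≤ _ := by
        rw [Finset.mul_sum]
        refine Finset.sum_le_sum fun S _ => ?_
        rw [mul_left_comm, expect_fintype]
        exact mul_le_mul_of_nonneg_left (hA.gspAction_revenue_ge j _) ENNReal.toReal_nonneg
  refine le_trans (le_of_eq ?_)
    (Finset.sum_le_sum fun j _ => mul_le_mul_of_nonneg_left (h1 j) ENNReal.toReal_nonneg)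
  simp only [Finset.mul_sum]
  rw [Finset.sum_comm]
  refine Finset.sum_congr rfl fun i _ => ?_
  split_ifs
  · rw [Finset.mul_sum]
    exact Finset.sum_congr rfl fun j _ => by ring
  · simp

variable {n M K : ℕ} {J : Type} {A : Exchange n M K J} {σ : ℝ} {t : ℕ} (R : A.LPValRun σ t)

/-! ### The revenue of LP-GSP -/

theorem lpGSP_admissible (q : PMF J) (m : ℕ) : A.Admissible q m (A.lpGSP R m) :=
  lpGSP_calls_le R q m m

variable [Fintype J]

/-- Markov's inequality. With a budget of at least 2, an exhausted network has used at least half of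
it, while the expected use is at most 4s times the rate. -/
theorem expect_onSample_available_ge (q : PMF J) {m : ℕ} {g : (Fin t → J) → ℝ}
    (hg : ∀ v, 0 ≤ g v) {i : Fin n} (hi : 2 ≤ A.rate i * m)
    (hrate : ∀ v, g v * trueRate q (R.x v) i ≤ 4 * A.rate i * g v) (s : ℕ) :
    (1 - 8 * s / m) * ∑ v, sampleWeight q v * g v
      ≤ expect (A.runLaw q (A.lpGSP R m) (t + s)) fun h => onSample g h *
        if (calls (h.map Record.observe) i : ℝ) + 1 ≤ A.rate i * m then 1 else 0 := by
  set p := A.runLaw q (A.lpGSP R m) (t + s) with hp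
  have hB : 0 < A.rate i * m := by linarith
  have hm0 : (m : ℝ) ≠ 0 := fun h => by rw [h, mul_zero] at hB; exact hB.ne rfl
  have hr0 : A.rate i ≠ 0 := fun h => by rw [h, zero_mul] at hB; exact hB.ne rfl
  have hg' : ∀ h : List (Record n K J), 0 ≤ onSample g h := fun h => by
    unfold onSample
    split_ifs
    exacts [hg _, le_rfl]
  have h1 : ∀ h : List (Record n K J), onSample g h - 2 / (A.rate i * m) *
      (onSample g h * calls (h.map Record.observe) i)
      ≤ onSample g h * if (calls (h.map Record.observe) i : ℝ) + 1 ≤ A.rate i * m then 1 else 0 := by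
    intro h
    have hc : (0 : ℝ) ≤ calls (h.map Record.observe) i := Nat.cast_nonneg _
    have : 1 - 2 / (A.rate i * m) * (calls (h.map Record.observe) i : ℝ)
        ≤ if (calls (h.map Record.observe) i : ℝ) + 1 ≤ A.rate i * m then 1 else 0 := by
      split_ifs with hav
      · have : 0 ≤ 2 / (A.rate i * m) * (calls (h.map Record.observe) i : ℝ) := by positivity
        linarith
      · rw [sub_nonpos, div_mul_eq_mul_div, le_div_iff₀ hB]
        linarith
    have h2 := mul_le_mul_of_nonneg_left this (hg' h)
    linarith
  have hb1 := bddOn_onSample g p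
  have hb2 := hb1.mul (bddOn_calls R q m (t + s) i)
  have hb3 : BddOn p fun h => onSample g h *
      if (calls (h.map Record.observe) i : ℝ) + 1 ≤ A.rate i * m then 1 else 0 :=
    hb1.mul (BddOn.of_le (B := 1) fun h => by split_ifs <;> simp)
  refine le_trans ?_ (expect_mono (hb1.sub ((BddOn.const _).mul hb2)) hb3 fun h _ => h1 h)
  rw [expect_sub hb1 ((BddOn.const _).mul hb2), expect_const_mul, hp,
    A.expect_onSample_of_le q _ (Nat.le_add_right t s)]
  have h2 := expect_onSample_mul_calls_le R q m hg i s
  have h3 : ∑ v, sampleWeight q v * (g v * trueRate q (R.x v) i)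
      ≤ 4 * A.rate i * ∑ v, sampleWeight q v * g v := by
    rw [Finset.mul_sum]
    refine Finset.sum_le_sum fun v _ => ?_
    rw [mul_left_comm (4 * A.rate i)]
    exact mul_le_mul_of_nonneg_left (hrate v) (sampleWeight_nonneg q v)
  have h4 := h2.trans (mul_le_mul_of_nonneg_left h3 (Nat.cast_nonneg s))
  have h5 := mul_le_mul_of_nonneg_left h4 (by positivity : 0 ≤ 2 / (A.rate i * m))
  have h6 : 2 / (A.rate i * m) * (s * (4 * A.rate i * ∑ v, sampleWeight q v * g v))
      = 8 * s / m * ∑ v, sampleWeight q v * g v := by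
    field_simp
    ring
  linarith

/-- The revenue bound is linear in the networks, so their individual availabilities suffice and
their dependence is irrelevant. 2496 = 78 * 2 * 16: revenue per arrival, availability 1/2, and a
sixteenth of the arrivals. -/
theorem gspPerf_lpGSP_ge (hA : A.MHR) (q : PMF J) {m : ℕ} (ht : 0 < t) (hm : 2 * t ≤ m)
    {y : (Fin t → J) → J → Fin n → Fin (K + 1) → Fin M → ℝ}
    (hy : ∀ v j, A.Feasible j (R.x v j) (y v j)) (I : Finset (Fin n))
    (hI : ∀ i ∈ I, 2 ≤ A.rate i * m) (G : (Fin t → J) → Prop) [DecidablePred G]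
    (hG : ∀ v, G v → ∀ i ∈ I, trueRate q (R.x v) i ≤ 4 * A.rate i) :
    1 / 2496 * ∑ v, sampleWeight q v * (if G v then
        ∑ i ∈ I, ∑ j, (q j).toReal * A.netValue A.disc (y v j) i else 0)
      ≤ A.gspPerf q m (A.lpGSP R m) := by
  set val : (Fin t → J) → Fin n → ℝ := fun v i =>
    ∑ j, (q j).toReal * A.netValue A.disc (y v j) i with hval
  have hval0 : ∀ v i, 0 ≤ val v i := fun v i => Finset.sum_nonneg fun j _ =>
    mul_nonneg ENNReal.toReal_nonneg (Feasible.netValue_nonneg A (hy v j) A.disc_nonneg i)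
  let g : Fin n → (Fin t → J) → ℝ := fun i v => if G v then val v i else 0
  have hg0 : ∀ i v, 0 ≤ g i v := fun i v => by
    simp only [g]
    split_ifs
    exacts [hval0 v i, le_rfl]
  set W := ∑ v, sampleWeight q v * (if G v then ∑ i ∈ I, val v i else 0) with hW
  have hWg : W = ∑ i ∈ I, ∑ v, sampleWeight q v * g i v := by
    rw [hW, Finset.sum_comm]
    refine Finset.sum_congr rfl fun v _ => ?_
    simp only [g]
    split_ifs
    · rw [Finset.mul_sum]
    · simp
  have hm0 : (0 : ℝ) < m := by
    have : 0 < m := by omega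
    exact_mod_cast this
  have hrev : ∀ e : Record n K J, |A.revenue e.act e.bids| ≤ M * A.maxBid :=
    fun e => A.abs_revenue_le e.act e.bids
  have hstep0 : ∀ h, 0 ≤ A.stepExpect q (A.lpGSP R m) h fun e => A.revenue e.act e.bids :=
    fun h => expect_nonneg fun _ _ => expect_nonneg fun _ _ => expect_nonneg fun _ _ =>
      A.revenue_nonneg _ _
  have hstep : ∀ s : ℕ, 1 / 78 * ((1 - 8 * s / m) * W) ≤
      expect (A.runLaw q (A.lpGSP R m) (t + s)) fun h =>
        A.stepExpect q (A.lpGSP R m) h fun e => A.revenue e.act e.bids := by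
    intro s
    set p := A.runLaw q (A.lpGSP R m) (t + s) with hp
    have hb : ∀ i ∈ I, BddOn p fun h => onSample (g i) h *
        if (calls (h.map Record.observe) i : ℝ) + 1 ≤ A.rate i * m then 1 else 0 := fun i _ =>
      (bddOn_onSample (g i) p).mul (BddOn.of_le (B := 1) fun h => by split_ifs <;> simp)
    calc 1 / 78 * ((1 - 8 * s / m) * W)
        ≤ 1 / 78 * expect p fun h => ∑ i ∈ I, onSample (g i) h *
            if (calls (h.map Record.observe) i : ℝ) + 1 ≤ A.rate i * m then 1 else 0 := by
          refine mul_le_mul_of_nonneg_left ?_ (by norm_num)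
          rw [expect_sum hb, hWg, Finset.mul_sum]
          refine Finset.sum_le_sum fun i hi =>
            expect_onSample_available_ge R q (hg0 i) (hI i hi) (fun v => ?_) s
          simp only [g]
          split_ifs with hv
          · rw [mul_comm]
            exact mul_le_mul_of_nonneg_right (hG v hv i hi) (hval0 v i)
          · simp
      _ = expect p fun h => 1 / 78 * ∑ i ∈ I, onSample (g i) h *
            if (calls (h.map Record.observe) i : ℝ) + 1 ≤ A.rate i * m then 1 else 0 :=
          (expect_const_mul _).symm
      _ ≤ _ := by
          refine expect_mono ((BddOn.const _).mul (BddOn.sum hb))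
            (BddOn.of_le fun h => A.abs_stepExpect_le hrev) fun h hh => ?_
          have hl : t ≤ h.length := by rw [A.length_of_mem_support hh]; omega
          refine le_trans ?_ (stepExpect_revenue_ge R hA q m hl (hy (firstImps h hl)))
          refine mul_le_mul_of_nonneg_left ?_ (by norm_num)
          refine (Finset.sum_le_sum fun i _ => ?_).trans
            (Finset.sum_le_sum_of_subset_of_nonneg (Finset.subset_univ I) fun i _ _ => ?_)
          · rw [onSample_eq _ hl]
            have : g i (firstImps h hl) ≤ val (firstImps h hl) i := by
              simp only [g]
              split_ifs
              exacts [le_rfl, hval0 _ i]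
            split_ifs
            · rw [mul_one]
              exact this
            · rw [mul_zero]
          · split_ifs
            exacts [hval0 _ i, le_rfl]
  have hW0 : 0 ≤ W := by
    rw [hWg]
    exact Finset.sum_nonneg fun i _ => Finset.sum_nonneg fun v _ =>
      mul_nonneg (sampleWeight_nonneg q v) (hg0 i v)
  have hperf : A.gspPerf q m (A.lpGSP R m) = (expect (A.runLaw q (A.lpGSP R m) m)
      fun h => (h.map fun e => A.revenue e.act e.bids).sum) / m := rfl
  rw [hperf, le_div_iff₀ hm0, A.expect_sum_map hrev]
  -- Rounded up, so that `T ≥ m / 16`, while every `s < T` still satisfies `16 * s ≤ m`.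
  set T := m / 16 + 1 with hT
  have hTm : t + T ≤ m := by omega
  have hTge : (m : ℝ) / 16 ≤ T := by
    rw [hT, div_le_iff₀ (by norm_num)]
    have : m ≤ (m / 16 + 1) * 16 := by omega
    exact_mod_cast this
  calc 1 / 2496 * W * m = m / 16 * (1 / 156 * W) := by ring
    _ ≤ T * (1 / 156 * W) := mul_le_mul_of_nonneg_right hTge (by positivity)
    _ = ∑ _s ∈ Finset.range T, 1 / 156 * W := by simp
    _ ≤ ∑ s ∈ Finset.range T, expect (A.runLaw q (A.lpGSP R m) (t + s)) fun h =>
        A.stepExpect q (A.lpGSP R m) h fun e => A.revenue e.act e.bids := by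
        refine Finset.sum_le_sum fun s hs => le_trans ?_ (hstep s)
        have h1 : (s : ℝ) * 16 ≤ m := by
          have : s * 16 ≤ m := by
            have := Finset.mem_range.1 hs
            omega
          exact_mod_cast this
        have h2 : 8 * (s : ℝ) / m ≤ 1 / 2 := by
          rw [div_le_iff₀ hm0]
          linarith
        have h3 := mul_le_mul_of_nonneg_right (by linarith : 1 / 2 ≤ 1 - 8 * (s : ℝ) / m) hW0
        linarith
    _ = ∑ s ∈ Finset.Ico t (t + T), expect (A.runLaw q (A.lpGSP R m) s) fun h =>
        A.stepExpect q (A.lpGSP R m) h fun e => A.revenue e.act e.bids := by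
        rw [Finset.sum_Ico_eq_sum_range, Nat.add_sub_cancel_left]
    _ ≤ _ := by
        refine Finset.sum_le_sum_of_subset_of_nonneg (fun s hs => ?_)
          fun s _ _ => expect_nonneg fun h _ => hstep0 h
        rw [Finset.mem_Ico] at hs
        exact Finset.mem_range.2 (by omega)

/-- On a good sample, the networks with a non-negligible budget carry an eighth of the linear
program. -/
theorem eighth_lp1_le {q : PMF J} {δ η : ℝ} (hσ : 0 < σ) (hη : 0 ≤ η)
    (hσn : σ * n ≤ δ) (hηn : 36 * (n * (A.maxBid * η)) ≤ δ) (hδ : δ ≤ A.lp1 q)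
    {v : Fin t → J} (hv : ∀ i, RatesAgree q v η (2 * η) (R.x v) i)
    {y : J → Fin n → Fin (K + 1) → Fin M → ℝ} (hy : ∀ j, A.Feasible j (R.x v j) (y j))
    (hopt : ∀ j x' y', A.Feasible j x' y' →
      A.lp2Obj σ (R.lam v) x' y' ≤ A.lp2Obj σ (R.lam v) (R.x v j) (y j)) :
    A.lp1 q / 8 ≤ ∑ i ∈ Finset.univ.filter (fun i => η ≤ A.rate i),
        ∑ j, (q j).toReal * A.netValue A.disc (y j) i ∧
      ∀ i, η ≤ A.rate i → trueRate q (R.x v) i ≤ 4 * A.rate i := by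
  have hsample : ∀ i, sampleRate v (R.x v) i ≤ A.rate i := fun i =>
    (R.lam_opt v).sampleRate_le hσ (R.x_opt v) i
  have htrue : ∀ i, trueRate q (R.x v) i ≤ 2 * A.rate i + 2 * η := fun i => by
    linarith [(hv i).2, hsample i]
  refine ⟨?_, fun i hi => by linarith [htrue i]⟩
  have hmain := A.lp1_le_slotValue hσ hη q (R.lam_opt v) hy hopt fun i => (hv i).1
  have hsplit : ∑ j, (q j).toReal * A.slotValue A.disc (y j)
      = ∑ i, ∑ j, (q j).toReal * A.netValue A.disc (y j) i := by
    simp only [slotValue_eq_sum, Finset.mul_sum]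
    exact Finset.sum_comm
  have hsmall : ∑ i ∈ Finset.univ.filter (fun i => ¬ η ≤ A.rate i),
      ∑ j, (q j).toReal * A.netValue A.disc (y j) i ≤ n * (A.maxBid * (4 * η)) := by
    calc _ ≤ ∑ i ∈ Finset.univ.filter (fun i => ¬ η ≤ A.rate i), A.maxBid * (4 * η) := by
          refine Finset.sum_le_sum fun i hi => ?_
          have hi' := not_le.1 (Finset.mem_filter.1 hi).2
          calc ∑ j, (q j).toReal * A.netValue A.disc (y j) i
              ≤ ∑ j, (q j).toReal * (A.maxBid * R.x v j i) := Finset.sum_le_sum fun j _ =>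
                mul_le_mul_of_nonneg_left (Feasible.netValue_le A (hy j) A.disc_le_one i)
                  ENNReal.toReal_nonneg
            _ = A.maxBid * trueRate q (R.x v) i := by
                rw [trueRate, Finset.mul_sum]
                exact Finset.sum_congr rfl fun j _ => by ring
            _ ≤ _ := mul_le_mul_of_nonneg_left (by linarith [htrue i]) A.maxBid_nonneg
      _ ≤ ∑ _i : Fin n, A.maxBid * (4 * η) :=
          Finset.sum_le_sum_of_subset_of_nonneg (Finset.subset_univ _) fun _ _ _ =>
            mul_nonneg A.maxBid_nonneg (by linarith)
      _ = _ := by simp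
  rw [← Finset.sum_filter_add_sum_filter_not Finset.univ (fun i => η ≤ A.rate i)] at hsplit
  -- The errors are 8 + 1 multiples of n * maxBid * η, at most δ/4, plus σn/2 ≤ δ/2. They absorb
  -- three quarters of LP1, and the factor 2 leaves an eighth.
  rw [hsplit] at hmain
  linarith

/-! ### The number of samples -/

theorem log_two_add_ge_one {X : ℝ} (hX : 1 ≤ X) : 1 ≤ Real.log (2 + X) := by
  rw [Real.le_log_iff_exp_le (by linarith)]
  linarith [Real.exp_one_lt_d9]

/-- The size of the union bound: 4n ≤ 27^n ≤ (2+X)^(3n) and N + 1 ≤ 3^6 X² ≤ (2+X)^8, whence 11 = 3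
+ 8. -/
theorem four_mul_grid_le {n N : ℕ} {X : ℝ} (hX : 1 ≤ X) (hN : (N : ℝ) ≤ 288 * X ^ 2 + 1) :
    4 * n * ((N : ℝ) + 1) ^ n ≤ Real.exp (11 * n * Real.log (2 + X)) := by
  have h0 : 0 < 2 + X := by linarith
  have h3 : 3 ≤ 2 + X := by linarith
  have h1 : Real.exp (11 * n * Real.log (2 + X)) = ((2 + X) ^ 3) ^ n * ((2 + X) ^ 8) ^ n := by
    rw [mul_comm, Real.exp_mul, Real.exp_log h0, ← mul_pow, ← pow_add, ← pow_mul]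
    norm_num
    rw [← Real.rpow_natCast]
    push_cast
    rfl
  rw [h1]
  refine mul_le_mul ?_ (pow_le_pow_left₀ (by positivity) ?_ n) (by positivity) (by positivity)
  · have h2 : (27 : ℝ) ^ n ≤ ((2 + X) ^ 3) ^ n := by
      refine pow_le_pow_left₀ (by norm_num) ?_ n
      calc (27 : ℝ) = 3 ^ 3 := by norm_num
        _ ≤ _ := pow_le_pow_left₀ (by norm_num) h3 3
    have h4 := one_add_mul_le_pow (a := (26 : ℝ)) (by norm_num) n
    norm_num at h4
    linarith [(Nat.cast_nonneg n : (0 : ℝ) ≤ n)]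
  · have h4 : (3 : ℝ) ^ 6 ≤ (2 + X) ^ 6 := pow_le_pow_left₀ (by norm_num) h3 6
    have h5 : X ^ 2 ≤ (2 + X) ^ 2 := pow_le_pow_left₀ (by linarith) (by linarith) 2
    have h6 : (3 : ℝ) ^ 6 * X ^ 2 ≤ (2 + X) ^ 6 * (2 + X) ^ 2 :=
      mul_le_mul h4 h5 (by positivity) (by positivity)
    rw [← pow_add] at h6
    have h7 : 1 ≤ X ^ 2 := one_le_pow₀ hX
    norm_num at h6
    linarith

theorem lpGSP_ge_lp1 (hA : A.MHR) {ε δ : ℝ} (hε : 0 < ε) (hε1 : ε ≤ 1) (hδ : 0 < δ) {m : ℕ}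
    (ht : 1584 * ((n : ℝ) ^ 2 * A.maxBid / (δ * ε)) *
      Real.log (2 + (n : ℝ) ^ 2 * A.maxBid / (δ * ε)) ≤ t) (hm : 2 * t ≤ m) (hσ : σ = ε * δ / n)
    {q : PMF J} (hlp : δ ≤ A.lp1 q) :
    1 / 40000 * A.lp1 q ≤ A.gspPerf q m (A.lpGSP R m) := by
  classical
  set X := (n : ℝ) ^ 2 * A.maxBid / (δ * ε) with hX
  have hnL : δ ≤ n * A.maxBid := hlp.trans (A.lp1_le q)
  have hL0 := A.maxBid_nonneg
  have hL : 0 < A.maxBid := by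
    refine lt_of_le_of_ne hL0 fun h => ?_
    rw [← h, mul_zero] at hnL
    linarith
  have hn : 0 < n := by
    refine Nat.pos_of_ne_zero fun h => ?_
    have h0 : (n : ℝ) = 0 := by exact_mod_cast h
    rw [h0, zero_mul] at hnL
    linarith
  have hn1 : (1 : ℝ) ≤ n := by exact_mod_cast hn
  have hn0 : (0 : ℝ) < n := by linarith
  have hXge : n * A.maxBid / δ ≤ X := by
    rw [hX, div_le_div_iff₀ hδ (by positivity)]
    have h1 : n * A.maxBid * (δ * ε) ≤ n * A.maxBid * (δ * n) := by gcongr; linarith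
    linarith
  have hX1 : 1 ≤ X := le_trans (by rwa [le_div_iff₀ hδ, one_mul]) hXge
  have hlog := log_two_add_ge_one hX1
  -- 144 = 36 * 4, since the rates will agree with error 4η. Then Xη ≥ n/144, and 1584 = 144 * 11
  -- gives the exponent required by the grid.
  set η := δ / (144 * (n * A.maxBid)) with hη
  have hη0 : 0 < η := by positivity
  have hXη : (n : ℝ) / 144 ≤ X * η := by
    have : X * η = n / (144 * ε) := by
      rw [hX, hη]
      field_simp
    rw [this]
    exact div_le_div_of_nonneg_left hn0.le (by positivity) (by linarith)
  have htη : 11 * n * Real.log (2 + X) ≤ t * η := by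
    have h1 := mul_le_mul_of_nonneg_right ht hη0.le
    have h2 := mul_le_mul_of_nonneg_right hXη (by linarith : 0 ≤ 1584 * Real.log (2 + X))
    linarith
  have ht1 : 11 ≤ t * η := by
    have : (1 : ℝ) * 1 ≤ n * Real.log (2 + X) := mul_le_mul hn1 hlog zero_le_one hn0.le
    linarith
  have ht0 : 0 < t := by
    refine Nat.pos_of_ne_zero fun h => ?_
    rw [h, Nat.cast_zero, zero_mul] at ht1
    linarith
  have hσ0 : 0 < σ := by rw [hσ]; positivity
  -- For this σ the Lipschitz error across one grid cell is 2X/N, to be at most η.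
  obtain ⟨N, hNlo, hNhi⟩ : ∃ N : ℕ, 2 * X / η ≤ N ∧ (N : ℝ) < 2 * X / η + 1 :=
    ⟨⌈2 * X / η⌉₊, Nat.le_ceil _, Nat.ceil_lt_add_one (by positivity)⟩
  have hN0 : (0 : ℝ) < N := lt_of_lt_of_le (by positivity) hNlo
  have hNle : (N : ℝ) ≤ 288 * X ^ 2 + 1 := by
    have h1 : 2 * X / η = 288 * X * (n * A.maxBid / δ) := by
      rw [hη]
      field_simp
      norm_num
    have h2 := mul_le_mul_of_nonneg_left hXge (by positivity : 0 ≤ 288 * X)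
    linarith
  have he : 2 * n * (A.maxBid / N) / σ ≤ η := by
    have h1 : 2 * n * (A.maxBid / N) / σ = 2 * X / N := by
      rw [hσ, hX]
      field_simp
    rw [h1, div_le_iff₀ hN0]
    rwa [div_le_iff₀' hη0] at hNlo
  obtain ⟨G, hGprob, hG⟩ := A.exists_good_samples q hσ0 ht0 (Nat.cast_pos.1 hN0) η
  have hprob : 1 / 2 ≤ ∑ v, sampleWeight q v * if G v then 1 else 0 := by
    refine le_trans ?_ hGprob
    have h1 := (four_mul_grid_le (n := n) hX1 hNle).trans (Real.exp_le_exp.2 htη)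
    have h2 : 4 * n * ((N : ℝ) + 1) ^ n * Real.exp (-(t * η)) ≤ 1 := by
      rw [Real.exp_neg, ← div_eq_mul_inv, div_le_one (Real.exp_pos _)]
      exact h1
    linarith
  choose y hy hopt using R.x_opt
  -- The additive errors η + 3η and 4η + 3η fit into 4η and 2 * (4η).
  have hgood := fun v (hv : G v) => eighth_lp1_le R (δ := δ) (η := 4 * η) (q := q) hσ0
    (by positivity)
    (by rw [hσ, div_mul_cancel₀ _ hn0.ne']; nlinarith)
    (by rw [hη]; field_simp; norm_num) hlp (v := v) (fun i => by
      have := hG v hv (R.lam v) (R.lam_opt v).1 (R.x v) (R.x_opt v) i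
      exact ⟨by linarith [this.1], by linarith [this.2]⟩) (hy v) (hopt v)
  have hmη : ∀ i, 4 * η ≤ A.rate i → 2 ≤ A.rate i * m := fun i hi => by
    have h1 : (2 * t : ℝ) ≤ m := by exact_mod_cast hm
    have h2 : 4 * η * (2 * t) ≤ A.rate i * m :=
      mul_le_mul hi h1 (by positivity) (A.rate_nonneg i)
    linarith
  have hperf := gspPerf_lpGSP_ge R hA q ht0 hm hy (Finset.univ.filter fun i => 4 * η ≤ A.rate i)
    (fun i hi => hmη i (Finset.mem_filter.1 hi).2) G
    fun v hv i hi => (hgood v hv).2 i (Finset.mem_filter.1 hi).2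
  refine le_trans ?_ hperf
  have hlp0 := A.lp1_nonneg q
  have hsum : A.lp1 q / 16 ≤ ∑ v, sampleWeight q v * (if G v then
      ∑ i ∈ Finset.univ.filter (fun i => 4 * η ≤ A.rate i),
        ∑ j, (q j).toReal * A.netValue A.disc (y v j) i else 0) := by
    calc A.lp1 q / 16 = A.lp1 q / 8 * (1 / 2) := by ring
      _ ≤ A.lp1 q / 8 * ∑ v, sampleWeight q v * if G v then 1 else 0 :=
          mul_le_mul_of_nonneg_left hprob (by positivity)
      _ = ∑ v, sampleWeight q v * if G v then A.lp1 q / 8 else 0 := by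
          rw [Finset.mul_sum]
          refine Finset.sum_congr rfl fun v _ => ?_
          split_ifs <;> ring
      _ ≤ _ := by
          refine Finset.sum_le_sum fun v _ =>
            mul_le_mul_of_nonneg_left ?_ (sampleWeight_nonneg q v)
          split_ifs with hv
          exacts [(hgood v hv).1, le_rfl]
  linarith

end Exchange

end CallOut

end

/-! ### Assembly of both claims. -/

theorem theorem2 :
    ∃ c : ℝ, 0 < c ∧ ∃ C : ℝ, 0 < C ∧ ∃ κ : ℕ,
      ∀ {n M K : ℕ} {J : Type} [Fintype J] (A : CallOut.Exchange n M K J), A.MHR →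
        (∀ (j : J) (S : Finset (Fin n)),
          c * A.lpSet A.disc j S ≤ A.expRevenue j (A.gspAction j S)) ∧
        ∀ ε δ : ℝ, 0 < ε → ε ≤ 1 → 0 < δ →
        ∀ t m : ℕ,
          C * ((n : ℝ) ^ 2 * A.maxBid / (δ * ε)) *
              Real.log (2 + (n : ℝ) ^ 2 * A.maxBid / (δ * ε)) ^ κ ≤ (t : ℝ) →
          2 * t ≤ m →
          Nonempty (A.LPValRun (ε * δ / n) t) ∧
          ∀ (R : A.LPValRun (ε * δ / n) t) (q : PMF J), δ ≤ A.optGSP q m →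
            A.Admissible q m (A.lpGSP R m) ∧
            (∀ h j, (A.lpGSP R m h j).map CallOut.Action.called = A.lpVal R m h j) ∧
            c * A.optGSP q m ≤ A.gspPerf q m (A.lpGSP R m) ∧
            c * A.lp1 q ≤ A.gspPerf q m (A.lpGSP R m) ∧
            A.optVal q m ≤ A.lp1 q := by
  -- 2496 * 16 = 39936, where 16 combines the eighth of LP1 with the probability 1/2 of a good
  -- sample. One logarithm suffices.
  refine ⟨1 / 40000, by norm_num, 1584, by norm_num, 1, ?_⟩
  intro n M K J _ A hA
  refine ⟨fun j S => le_trans ?_ (hA.gspAction_revenue_ge j S), ?_⟩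
  · exact mul_le_mul_of_nonneg_right (by norm_num)
      (A.lpSet_nonneg A.disc_nonneg A.disc_le_one j S)
  intro ε δ hε hε1 hδ t m ht hm
  rw [pow_one] at ht
  -- For n = 0 the perturbation is a division by zero, hence 0; existence of a run needs only σ ≥ 0,
  -- and a positive optimum rules this case out later.
  refine ⟨A.nonempty_lpValRun (by positivity) t, fun R q hopt => ?_⟩
  have hle := A.optGSP_le_lp1 q m
  have hmain := CallOut.Exchange.lpGSP_ge_lp1 R hA hε hε1 hδ ht hm rfl (hopt.trans hle)
  exact ⟨CallOut.Exchange.lpGSP_admissible R q m, CallOut.Exchange.lpGSP_map_called R m,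
    (mul_le_mul_of_nonneg_left hle (by norm_num)).trans hmain, hmain, A.optVal_le_lp1 q m⟩
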